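/- Consider an ordered linear-probing hash table with $n \ge 1$ slots, arranged circularly, and a uniformly random, fully independent hash function $h$ from the keys to the slots. Keys and tombstones in a run of non-free slots are stored in the (circular) order of their hashes. An insertion of $u$ starts at slot $h(u)$, walks clockwise to the first slot that is free or holds a key or tombstone whose hash does not precede $h(u)$, puts $u$ there, and shifts the contents from that slot on by one until reaching a free slot or a tombstone, which it makes use of (overwrites). A deletion replaces the key by a tombstone, whose hash is the hash of the deleted key. There are no rebuilds during the workload. Let $x > 1$ be real. Initially the table contains a fixed set of $(1-1/x)n$ keys and no tombstones. Let $S$ be a fixed (independent of $h$) sequence of operations that alternates between insertions (of keys that are absent at that time) and deletions (of keys that are present at that time), starting with either; the same key may be inserted and deleted repeatedly. The crossing number $c_j$ of a slot $j$ is the number of insertions in $S$ whose hash is smaller than $j$ and which either use a tombstone whose hash is at least $j$ or use a free slot in a position at least $j$. Comparisons are along the clockwise way: writing $p$ for the hash of the tombstone, or the position of the free slot, used by an insertion $u$, the condition is $0 < \operatorname{dist}(h(u), j) \le \operatorname{dist}(h(u), p)$, where $\operatorname{dist}(a,b) = (b-a) \bmod n$. There is a positive integer constant $d$ such that for every $\kappa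 > 0$ the following hold. (1) For every $c > 0$ there is a constant $C = C(\kappa, c)$ such that for all $n$, $x$, initial key sets and workloads $S$ as above with $\kappa n/x \le |S| \le n$, all slots $j$ and all real $$r \ge \sqrt{\frac{|S|}{n}x^2}\,\log^d x, \qquad r > 0,$$ one has $\Pr[c_j \ge r] \le C/r^{c}$. (2) There is a constant $C = C(\kappa)$ such that for all $n$, $x$, initial key sets and workloads $S$ as above with $\kappa n/x \le |S| \le n$, and all slots $j$, $$\mathbb{E}[c_j] \le \sqrt{\frac{|S|}{n}x^2}\cdot C\,(1+\log x)^d .$$ -/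

import Mathlib

open MeasureTheory ProbabilityTheory

/-- The content of a slot of the hash table: it is free, holds a key, or holds the tombstone left
by the deletion of a key. -/
inductive Slot (U : Type*) where
  | free : Slot U
  | key (u : U) : Slot U
  | tomb (u : U) : Slot U

/-- A hash table with `n` slots, arranged in a circle (slot `0` comes after slot `n - 1`). -/
abbrev Table (n : ℕ) (U : Type*) := Fin n → Slot U

/-- The operations of a workload. -/
inductive Op (U : Type*) where
  | insert (u : U) : Op U
  | delete (u : U) : Op U

namespace Op

/-- Whether an operation is an insertion. -/
def isInsert {U : Type*} : Op U → Bool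
  | insert _ => true
  | delete _ => false

end Op

namespace OrderedProbing

variable {n : ℕ} [NeZero n] {U : Type*}

/-- The clockwise distance from slot `a` to slot `b`, an element of `{0, …, n - 1}`. -/
def dist (a b : Fin n) : ℕ := (b - a).val

/-- The least offset `t ∈ {0, …, n - 1}` such that slot `a + t` satisfies `q`, if there is one. -/
def firstOffset (q : Fin n → Bool) (a : Fin n) : Option (Fin n) :=
  (List.finRange n).find? fun t => q (a + t)

/-- Whether a key with hash `a`, whose insertion is examining slot `p`, belongs at slot `p`:
the slot is free, or the key or tombstone stored there does not precede hash `a` in the circular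
order of hashes along the run. An item in slot `p` with hash `b` has been probed from `b` up to `p`,
so its hash is at or after `a` on the way to `p` exactly if `b` is no farther behind `p` than `a`. -/
def belongsAt (h : U → Fin n) (T : Table n U) (a p : Fin n) : Bool :=
  match T p with
  | .free => true
  | .key w => decide (dist (h w) p ≤ dist a p)
  | .tomb w => decide (dist (h w) p ≤ dist a p)

/-- Whether slot `p` can be made use of by an insertion, that is, holds no key. -/
def vacant (T : Table n U) (p : Fin n) : Bool :=
  match T p with
  | .free => true
  | .key _ => false
  | .tomb _ => true

/-- Insertion of the key `u`: starting at `h u`, find the slot `j` at which `u` belongs, then the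
first slot `j + e` at or after `j` which is free or holds a tombstone; put `u` into slot `j` and
move the content of the slots `j, …, j + e - 1` one slot further. Returned are the new table and
the peak of the insertion: the position of the free slot, or the hash of the tombstone, of which it
makes use. The result is `none` only if all slots hold keys. -/
def insertKey (h : U → Fin n) (T : Table n U) (u : U) : Option (Table n U × Fin n) :=
  (firstOffset (belongsAt h T (h u)) (h u)).bind fun s =>
    (firstOffset (vacant T) (h u + s)).map fun e =>
      (fun q =>
        if dist (h u + s) q = 0 then .key u
        else if dist (h u + s) q ≤ e.val then T (q - 1)
        else T q,
      match T (h u + s + e) with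
        | .tomb v => h v
        | _ => h u + s + e)

/-- Deletion of the key `u`: the key is replaced with a tombstone. -/
def deleteKey [DecidableEq U] (T : Table n U) (u : U) : Table n U := fun p =>
  match T p with
  | .key w => if w = u then .tomb u else .key w
  | s => s

/-- The table after one operation. -/
def step [DecidableEq U] (h : U → Fin n) (T : Table n U) : Op U → Table n U
  | .insert u => ((insertKey h T u).map Prod.fst).getD T
  | .delete u => deleteKey T u

/-- The table, free of tombstones, which contains exactly the keys in the list `A`. -/
def initialTable [DecidableEq U] (h : U → Fin n) (A : List U) : Table n U :=
  (A.map Op.insert).foldl (step h) fun _ => .free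

/-- An insertion with hash `a` and peak `p` crosses position `i`: on the way clockwise from `a`,
the hash `a` lies strictly before `i` and the peak `p` lies at or after `i`. -/
def Crosses (a p i : Fin n) : Prop := 0 < dist a i ∧ dist a i ≤ dist a p

instance (a p i : Fin n) : Decidable (Crosses a p i) := by
  unfold Crosses; infer_instance

/-- The contribution (`0` or `1`) of an operation on the table `T` to the crossing number of `i`. -/
def crossing (h : U → Fin n) (i : Fin n) (T : Table n U) : Op U → ℕ
  | .insert u =>
    match insertKey h T u with
    | some (_, p) => if Crosses (h u) p i then 1 else 0
    | none => 0
  | .delete _ => 0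

/-- The number of insertions crossing position `i` when the workload is performed on `T`. -/
def crossingsFrom [DecidableEq U] (h : U → Fin n) (i : Fin n) : Table n U → List (Op U) → ℕ
  | _, [] => 0
  | T, op :: S => crossing h i T op + crossingsFrom h i (step h T op) S

/-- The crossing number of position `i`, when the workload `S` is performed on the table
which initially contains the keys in `A` and no tombstones. -/
def crossingNumber [DecidableEq U] (h : U → Fin n) (A : List U) (S : List (Op U)) (i : Fin n) : ℕ :=
  crossingsFrom h i (initialTable h A) S

end OrderedProbing

/-- A workload is valid for a table with key set `K` if it inserts only keys that are absent, and
deletes only keys that are present, at the time of the operation. -/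
def ValidWorkload {U : Type*} : Set U → List (Op U) → Prop
  | _, [] => True
  | K, .insert u :: S => u ∉ K ∧ ValidWorkload (K ∪ {u}) S
  | K, .delete u :: S => u ∈ K ∧ ValidWorkload (K \ {u}) S

/-- Insertions and deletions alternate (starting with either). -/
def Alternating {U : Type*} (S : List (Op U)) : Prop :=
  S.IsChain fun a b => a.isInsert ≠ b.isInsert

/-- A uniformly random, fully independent hash function with values in the `n` slots. -/
structure IsUniformHash {Ω U : Type*} [MeasurableSpace Ω] {n : ℕ} (P : Measure Ω)
    (h : Ω → U → Fin n) : Prop where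
  measurable : ∀ u, Measurable fun ω => h ω u
  indep : iIndepFun (fun u ω => h ω u) P
  uniform : ∀ u i, P {ω | h ω u = i} = (n : ENNReal)⁻¹

/-- The standing assumptions on a table with `n` slots that initially contains the distinct keys
in `A`, at load factor `1 - 1 / x`, and on an alternating workload `S` with
`κ n / x ≤ |S| ≤ n`. -/
structure Admissible {U : Type*} (n : ℕ) (x κ : ℝ) (A : List U) (S : List (Op U)) : Prop where
  one_lt : 1 < x
  nodup : A.Nodup
  load : (A.length : ℝ) = (1 - 1 / x) * n
  valid : ValidWorkload {u | u ∈ A} S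
  alternating : Alternating S
  length_lower : κ * (n / x) ≤ S.length
  length_upper : S.length ≤ n

/-! Cut the circle at `j` and locate every slot by its distance `behind j`, in `1, …, n`. Call free
slots and tombstones resources. Since items are sorted by hash, an insertion uses the first resource
clockwise from its hash, and it crosses `j` exactly if the peak has a greater distance than the
hash. This gives a variational bound (`exists_path`). Going backwards through the workload one
builds an antitone boundary `g` such that the number of crossings is at most the surplus (insertions
minus deletions in the space-time region below `g`) minus the resources initially within distance `g
0`. On the circle a crossing may also consume a resource of the region itself. Then all resources,
at least `n / x` of them, lie in the region, and such a path is beaten by a small linear rate `β`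
per operation. The surplus of all paths is bounded simultaneously by chaining. Over any time window
a key has net weight in `{-1, 0, 1}` by validity, and all keys together have net weight at most `1`
by alternation, so only fluctuations remain. The region below `g` is cut into dyadic time blocks
times intervals of slots. Bernstein's inequality (`IsUniformHash.measureReal_le`) controls each of
polynomially many fixed boxes, and Cauchy–Schwarz sums the boxes of one scale. A path within
distance `y` has surplus at most about `√(|S| * y / n)` times the square of a logarithmic factor
`L`. On the other hand, for `y` beyond about `x ^ 2 * L ^ 4`, the initial table offers about `y / (2
* x)` resources, which exceeds this surplus. Hence only `√y` up to about `x * L ^ 2` matters, and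
the crossings are at most about `√(|S| / n) * x * L ^ 4` (`crossingNumber_lt`). A fifth logarithm
absorbs the constants, so `d = 5`. Summing the tail over dyadic thresholds gives the expectation. -/

set_option linter.unusedSectionVars false

namespace OrderedProbing

/-! ### Clockwise distances on the circle. -/

section Circle

variable {n : ℕ} [NeZero n]

theorem dist_lt (a b : Fin n) : dist a b < n := (b - a).isLt

@[simp] theorem dist_self (a : Fin n) : dist a a = 0 := by simp [dist]

theorem dist_trans (a b c : Fin n) :
    dist a c = if n ≤ dist a b + dist b c then dist a b + dist b c - n
      else dist a b + dist b c := by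
  have h : c - a = (b - a) + (c - b) := by abel
  rw [dist, h, Fin.val_add_eq_ite]
  rfl

@[simp] theorem dist_add_right (a t : Fin n) : dist a (a + t) = t.val := by
  simp [dist]

theorem dist_eq_zero {a b : Fin n} : dist a b = 0 ↔ a = b := by
  constructor
  · intro h
    have : b - a = 0 := Fin.ext (by simpa [dist] using h)
    exact (sub_eq_zero.mp this).symm
  · rintro rfl; simp

theorem dist_add_one (a b : Fin n) :
    dist a (b + 1) = if dist a b + 1 = n then 0 else dist a b + 1 := by
  have h : b + 1 - a = (b - a) + 1 := by abel
  have hlt := dist_lt a b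
  unfold dist at *
  rw [h, Fin.val_add]
  have h1 : ((1 : Fin n) : ℕ) = 1 % n := Fin.val_one' n
  rw [h1, Nat.add_mod_mod]
  split_ifs with h2
  · rw [h2, Nat.mod_self]
  · exact Nat.mod_eq_of_lt (by omega)

theorem dist_sub_one {a b : Fin n} (h : dist a b ≠ 0) : dist a (b - 1) + 1 = dist a b := by
  have h1 := dist_add_one a (b - 1)
  rw [sub_add_cancel] at h1
  split_ifs at h1 with h2
  · exact absurd h1 h
  · exact h1.symm

theorem dist_inj {a b c : Fin n} (h : dist a b = dist a c) : b = c := by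
  have := Fin.ext h
  simpa using this

theorem firstOffset_some {q : Fin n → Bool} {a t : Fin n} (h : firstOffset q a = some t) :
    q (a + t) = true ∧ ∀ t' < t, q (a + t') = false := by
  unfold firstOffset at h
  rw [List.find?_eq_some_iff_getElem] at h
  obtain ⟨h1, i, hi, h2, h3⟩ := h
  refine ⟨h1, fun t' ht' => ?_⟩
  simp only [List.getElem_finRange] at h2
  have hlt : t'.val < i := by
    rw [← h2] at ht'
    exact ht'
  have := h3 t'.val hlt
  simpa using this

theorem firstOffset_none {q : Fin n → Bool} {a : Fin n} (h : firstOffset q a = none) (t : Fin n) :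
    q (a + t) = false := by
  unfold firstOffset at h
  rw [List.find?_eq_none] at h
  simpa using h t (List.mem_finRange t)

end Circle

/-! ### Sorted tables, described by displacements. -/

section Tables

variable {n : ℕ} [NeZero n] {U : Type*}

/-- The position of a slot content in the circular order: its hash, or the slot if it is free. -/
def pos (h : U → Fin n) (T : Table n U) (p : Fin n) : Fin n :=
  match T p with
  | .free => p
  | .key w => h w
  | .tomb w => h w

/-- `0` for a free slot, and otherwise one more than the displacement of the stored item. -/
def depth (h : U → Fin n) (T : Table n U) (p : Fin n) : ℕ :=
  match T p with
  | .free => 0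
  | .key w => dist (h w) p + 1
  | .tomb w => dist (h w) p + 1

/-- The items of the table appear in the circular order of their hashes. -/
def Sorted (h : U → Fin n) (T : Table n U) : Prop :=
  ∀ p, depth h T (p + 1) ≤ depth h T p + 1

variable {h : U → Fin n} {T : Table n U}

theorem depth_le (p : Fin n) : depth h T p ≤ n := by
  unfold depth
  split
  · omega
  · exact dist_lt _ _
  · exact dist_lt _ _

theorem belongsAt_iff {a p : Fin n} : belongsAt h T a p = true ↔ depth h T p ≤ dist a p + 1 := by
  rcases hT : T p with _ | w | w <;> simp [belongsAt, depth, hT]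

/-- An item of depth `d > 0` in slot `p` has its hash `d - 1` slots before `p`. Going back that far
passes `a` exactly if `d > dist a p + 1`, which adds a full turn. Comparisons of hashes thereby
become linear arithmetic in depths. -/
theorem dist_pos (a p : Fin n) :
    dist a (pos h T p) = if depth h T p = 0 then dist a p
      else if depth h T p ≤ dist a p + 1 then dist a p + 1 - depth h T p
      else n + dist a p + 1 - depth h T p := by
  have key : ∀ w : U, dist a (h w) = if dist (h w) p + 1 ≤ dist a p + 1
      then dist a p + 1 - (dist (h w) p + 1) else n + dist a p + 1 - (dist (h w) p + 1) := by
    intro w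
    have h1 := dist_trans a (h w) p
    have h2 := dist_lt a (h w)
    have h3 := dist_lt (h w) p
    split_ifs at h1 ⊢ <;> omega
  unfold pos depth
  split
  · simp
  · simpa using key _
  · simpa using key _

theorem Sorted.depth_le_add (hs : Sorted h T) (p q : Fin n) :
    depth h T q ≤ depth h T p + dist p q := by
  obtain ⟨k, hk⟩ : ∃ k, dist p q = k := ⟨_, rfl⟩
  induction k generalizing q with
  | zero =>
    rw [dist_eq_zero.mp hk]; omega
  | succ k ih =>
    have h1 : dist p (q - 1) + 1 = dist p q := dist_sub_one (by omega)
    have h2 := ih (q - 1) (by omega)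
    have h3 := hs (q - 1)
    rw [sub_add_cancel] at h3
    omega

/-- The table after the insertion of `u` in slot `b`, with the contents of the `e` slots from `b`
on moved by one. -/
def shiftInsert (T : Table n U) (u : U) (b : Fin n) (e : ℕ) : Table n U := fun q =>
  if dist b q = 0 then .key u else if dist b q ≤ e then T (q - 1) else T q

theorem insertKey_spec {u : U} {T' : Table n U} {k : Fin n} (hi : insertKey h T u = some (T', k)) :
    ∃ b v : Fin n, depth h T b ≤ dist (h u) b + 1 ∧
      (∀ q, dist (h u) q < dist (h u) b → dist (h u) q + 1 < depth h T q) ∧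
      vacant T v = true ∧ (∀ q, dist b q < dist b v → vacant T q = false) ∧
      T' = shiftInsert T u b (dist b v) ∧ k = pos h T v := by
  unfold insertKey at hi
  rw [Option.bind_eq_some_iff] at hi
  obtain ⟨s, hs, hi⟩ := hi
  rw [Option.map_eq_some_iff] at hi
  obtain ⟨e, he, hi⟩ := hi
  obtain ⟨hs1, hs2⟩ := firstOffset_some hs
  obtain ⟨he1, he2⟩ := firstOffset_some he
  rw [Prod.mk.injEq] at hi
  refine ⟨h u + s, h u + s + e, belongsAt_iff.mp hs1, ?_, he1, ?_, ?_, ?_⟩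
  · intro q hq
    have := hs2 (q - h u) (by
      rw [dist_add_right] at hq
      exact hq)
    rw [add_sub_cancel] at this
    have h2 := (not_congr (belongsAt_iff (h := h) (T := T) (a := h u) (p := q))).mp
      (by simp [this])
    omega
  · intro q hq
    have := he2 (q - (h u + s)) (by
      rw [dist_add_right] at hq
      exact hq)
    rwa [add_sub_cancel] at this
  · rw [← hi.1, dist_add_right]
    rfl
  · rw [← hi.2]
    unfold vacant at he1
    unfold pos
    split at he1 <;> simp_all

theorem insertKey_isSome (u : U) (hv : ∃ v, vacant T v = true) :
    ∃ T' k, insertKey h T u = some (T', k) := by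
  obtain ⟨v, hv⟩ := hv
  unfold insertKey
  rcases hs : firstOffset (belongsAt h T (h u)) (h u) with _ | s
  -- The slot before `h u` is the last one probed, at offset `n - 1`. Its rejection would require a
  -- depth above `n`.
  · have h1 := firstOffset_none hs (-1)
    have h2 := (not_congr (belongsAt_iff (h := h) (T := T) (a := h u) (p := h u + -1))).mp
      (by simp [h1])
    have h3 := depth_le (h := h) (T := T) (h u + -1)
    have h4 := dist_add_one (h u) (h u + -1)
    simp only [neg_add_cancel_right, dist_self] at h4
    split_ifs at h4
    omega
  · rcases he : firstOffset (vacant T) (h u + s) with _ | e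
    · have h1 := firstOffset_none he (v - (h u + s))
      rw [add_sub_cancel] at h1
      simp [h1] at hv
    · exact ⟨_, _, by rw [Option.bind_some, he, Option.map_some]⟩

/-- From the slot `b` where hash `a` belongs, positions only advance clockwise from `a`. So the
vacant slot found first along the table is also the first in hash order, and shifting amounts to
using the next resource after the hash. -/
theorem Sorted.dist_pos_le (hs : Sorted h T) {a b v p : Fin n}
    (hb : depth h T b ≤ dist a b + 1)
    (hlt : ∀ q, dist a q < dist a b → dist a q + 1 < depth h T q)
    (hv : dist b v ≤ dist b p) : dist a (pos h T v) ≤ dist a (pos h T p) := by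
  have h1 := hs.depth_le_add b v
  have h2 := hs.depth_le_add b p
  have h3 := hs.depth_le_add v p
  have h4 := dist_trans a b v
  have h5 := dist_trans a b p
  have h6 := dist_trans b v p
  have h7 := depth_le (h := h) (T := T) v
  have h8 := depth_le (h := h) (T := T) p
  have := dist_lt a b
  have := dist_lt b v
  have := dist_lt b p
  have := dist_lt v p
  have h9 := hlt v
  have h10 := hlt p
  rw [dist_pos, dist_pos]
  split_ifs at * <;> omega

theorem vacant_eq_false {p : Fin n} (hp : vacant T p = false) : ∃ w, T p = .key w := by
  unfold vacant at hp
  split at hp <;> simp_all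

/-- The bound `hn` prevents a shifted item from coming round to its own hash slot, where its
distance would drop to `0`. -/
theorem depth_shiftInsert {u : U} {b v : Fin n}
    (hv : ∀ q, dist b q < dist b v → vacant T q = false)
    (hn : ∀ q, depth h T q + 1 ≤ n) (q : Fin n) :
    depth h (shiftInsert T u b (dist b v)) q =
      if dist b q = 0 then dist (h u) q + 1
      else if dist b q ≤ dist b v then depth h T (q - 1) + 1 else depth h T q := by
  unfold shiftInsert
  by_cases h0 : dist b q = 0
  · simp [depth, h0]
  by_cases h1 : dist b q ≤ dist b v
  · have h2 := dist_sub_one h0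
    obtain ⟨w, hw⟩ := vacant_eq_false (hv (q - 1) (by omega))
    have h3 := hn (q - 1)
    have h4 := dist_add_one (h w) (q - 1)
    simp only [depth, h0, h1, hw, if_true, if_false, sub_add_cancel] at *
    split_ifs at h4 <;> omega
  · simp [depth, h0, h1]

theorem depth_shiftInsert_le {u : U} {b v : Fin n} {B : ℕ}
    (hlt : ∀ q, dist (h u) q < dist (h u) b → dist (h u) q + 1 < depth h T q)
    (hv : ∀ q, dist b q < dist b v → vacant T q = false)
    (hB : ∀ q, depth h T q ≤ B) (hn : B + 1 ≤ n) (q : Fin n) :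
    depth h (shiftInsert T u b (dist b v)) q ≤ B + 1 := by
  rw [depth_shiftInsert hv (fun q => by have := hB q; omega)]
  split_ifs with h0 h1
  · have hq := dist_eq_zero.mp h0
    subst hq
    by_cases h2 : dist (h u) b = 0
    · omega
    -- Slot `b - 1` rejected `u`, so the item there is displaced farther than `u` would be in that
    -- slot.
    · have h3 := dist_sub_one h2
      have := hlt (b - 1) (by omega)
      have := hB (b - 1)
      omega
  · have := hB (q - 1); omega
  · have := hB q; omega

theorem Sorted.shiftInsert (hs : Sorted h T) {u : U} {b v : Fin n}
    (hb : depth h T b ≤ dist (h u) b + 1)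
    (hlt : ∀ q, dist (h u) q < dist (h u) b → dist (h u) q + 1 < depth h T q)
    (hv : ∀ q, dist b q < dist b v → vacant T q = false)
    (hn : ∀ q, depth h T q + 1 ≤ n) :
    Sorted h (shiftInsert T u b (dist b v)) := by
  intro p
  rw [depth_shiftInsert hv hn, depth_shiftInsert hv hn]
  have h1 := dist_add_one b p
  have h2 := dist_lt b p
  have h3 := hs p
  have h4 := hs (p - 1)
  rw [sub_add_cancel] at h4
  have h6 := dist_lt b v
  rw [add_sub_cancel_right]
  by_cases h0 : dist b (p + 1) = 0
  · have hp := dist_eq_zero.mp h0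
    have h7 := dist_add_one (h u) p
    have h8 := hlt p
    rw [← hp] at h7 h3 ⊢
    rw [if_pos (dist_self b)]
    by_cases h10 : dist b p = 0
    · have := dist_eq_zero.mp h10
      subst this
      rw [if_pos h10]
      omega
    · rw [if_neg h10]
      split_ifs at h7 ⊢ <;> omega
  · by_cases h10 : dist b p = 0
    · have := dist_eq_zero.mp h10
      subst this
      rw [if_neg h0, if_pos h10]
      split_ifs at h1 ⊢ <;> omega
    · rw [if_neg h0, if_neg h10]
      split_ifs at h1 ⊢ <;> omega

end Tables

/-! ### How operations change the resources of a table. -/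

section Resources

variable {n : ℕ} [NeZero n] {U : Type*}

/-- The number of free slots and tombstones with position `c`. -/
def resources (h : U → Fin n) (T : Table n U) (c : Fin n) : ℕ :=
  (Finset.univ.filter fun p => vacant T p = true ∧ pos h T p = c).card

/-- A table in which the items are in order, exactly the keys in `K` are stored, each of them once,
and displacements are less than `B`. -/
structure Consistent (h : U → Fin n) (T : Table n U) (K : Set U) (B : ℕ) : Prop where
  sorted : Sorted h T
  existsUnique : ∀ w ∈ K, ∃! p, T p = .key w
  mem : ∀ p w, T p = .key w → w ∈ K
  depth_le : ∀ p, depth h T p ≤ B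

variable {h : U → Fin n} {T : Table n U}

theorem vacant_key {p : Fin n} {w : U} (hp : T p = .key w) : vacant T p = false := by
  simp [vacant, hp]

theorem pos_congr {T' : Table n U} {p : Fin n} (hp : T p = T' p) : pos h T p = pos h T' p := by
  simp [pos, hp]

theorem vacant_congr {T' : Table n U} {p : Fin n} (hp : T p = T' p) :
    vacant T p = vacant T' p := by
  simp [vacant, hp]

theorem shiftInsert_of_le {u : U} {b v p : Fin n}
    (hf : ∀ q, dist b q < dist b v → vacant T q = false) (hp : dist b p ≤ dist b v) :
    vacant (shiftInsert T u b (dist b v)) p = false := by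
  by_cases h0 : dist b p = 0
  · exact vacant_key (w := u) (by simp [shiftInsert, h0])
  · have h1 := dist_sub_one h0
    obtain ⟨w, hw⟩ := vacant_eq_false (hf (p - 1) (by omega))
    exact vacant_key (w := w) (by simp [shiftInsert, h0, hp, hw])

theorem shiftInsert_of_lt {u : U} {b v p : Fin n} (hp : dist b v < dist b p) :
    shiftInsert T u b (dist b v) p = T p := by
  have h0 : dist b p ≠ 0 := by omega
  have h1 : ¬ dist b p ≤ dist b v := by omega
  simp [shiftInsert, h0, h1]

theorem resources_shiftInsert {u : U} {b v : Fin n} (hv : vacant T v = true)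
    (hf : ∀ q, dist b q < dist b v → vacant T q = false) (c : Fin n) :
    resources h T c = resources h (shiftInsert T u b (dist b v)) c +
      if pos h T v = c then 1 else 0 := by
  -- Among the slots from `b` to `v` only `v` was vacant, and after the shift none is; the other
  -- slots are untouched.
  have hset : (Finset.univ.filter fun p => vacant (shiftInsert T u b (dist b v)) p = true ∧
      pos h (shiftInsert T u b (dist b v)) p = c) =
      (Finset.univ.filter fun p => vacant T p = true ∧ pos h T p = c).erase v := by
    ext p
    simp only [Finset.mem_filter, Finset.mem_univ, true_and, Finset.mem_erase]
    rcases lt_trichotomy (dist b p) (dist b v) with hp | hp | hp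
    · simp [shiftInsert_of_le (u := u) hf hp.le, hf p hp]
    · have := dist_inj hp
      subst this
      simp [shiftInsert_of_le (u := u) hf hp.le]
    · have h1 := shiftInsert_of_lt (T := T) (u := u) hp
      rw [vacant_congr h1, pos_congr h1]
      have : p ≠ v := by rintro rfl; omega
      simp [this]
  unfold resources
  rw [hset]
  split_ifs with hc
  · rw [Finset.card_erase_add_one]
    simp [hv, hc]
  · rw [Finset.erase_eq_of_notMem, add_zero]
    simp [hc]

/-- The slot from which the content of a slot comes in `shiftInsert`. -/
def unshift (b v q : Fin n) : Fin n :=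
  if dist b q = 0 then v else if dist b q ≤ dist b v then q - 1 else q

theorem unshift_injective (b v : Fin n) : Function.Injective (unshift b v) := by
  intro p q hpq
  unfold unshift at hpq
  have hsub : ∀ r : Fin n, dist b r ≠ 0 → dist b (r - 1) + 1 = dist b r := fun r => dist_sub_one
  have h1 := hsub p
  have h2 := hsub q
  apply dist_inj (a := b)
  have h3 := congrArg (dist b) hpq
  split_ifs at h3 <;> omega

/-- Up to a permutation of the slots the insertion only overwrites slot `v`, so that uniqueness of
stored keys can be checked for a single update. -/
theorem shiftInsert_eq_unshift [DecidableEq (Fin n)] (u : U) (b v q : Fin n) :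
    shiftInsert T u b (dist b v) q = Function.update T v (.key u) (unshift b v q) := by
  unfold shiftInsert unshift
  split_ifs with h0 h1
  · simp
  · have h2 := dist_sub_one h0
    rw [Function.update_of_ne]
    rintro rfl
    omega
  · rw [Function.update_of_ne]
    rintro rfl
    omega

theorem shiftInsert_existsUnique {u w : U} {b v : Fin n} :
    (∃! p, shiftInsert T u b (dist b v) p = .key w) ↔
      ∃! p, Function.update T v (.key u) p = .key w := by
  simp_rw [shiftInsert_eq_unshift]
  exact ((Finite.injective_iff_bijective.mp (unshift_injective b v)).existsUnique_iff
    (p := fun q => Function.update T v (.key u) q = .key w)).symm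

/-- The last two clauses are all that the counting of crossings uses of an insertion: one resource
disappears at the peak, and there is none from the hash up to the peak. -/
theorem Consistent.insert {K : Set U} {B : ℕ} (hc : Consistent h T K B) {u : U} (hu : u ∉ K)
    (hB : B + 1 ≤ n) (hv : ∃ v, vacant T v = true) :
    ∃ T' k, insertKey h T u = some (T', k) ∧ Consistent h T' (K ∪ {u}) (B + 1) ∧
      (∀ c, resources h T c = resources h T' c + if k = c then 1 else 0) ∧
      (∀ c, dist (h u) c < dist (h u) k → resources h T c = 0) := by
  obtain ⟨T', k, hi⟩ := insertKey_isSome (h := h) u hv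
  obtain ⟨b, v, hb, hlt, hv, hf, rfl, rfl⟩ := insertKey_spec hi
  refine ⟨_, _, hi, ?_, resources_shiftInsert hv hf, ?_⟩
  · have hn : ∀ q, depth h T q + 1 ≤ n := fun q => by have := hc.depth_le q; omega
    refine ⟨hc.sorted.shiftInsert hb hlt hf hn, ?_, ?_, depth_shiftInsert_le hlt hf hc.depth_le hB⟩
    · intro w hw
      rw [shiftInsert_existsUnique]
      by_cases hwu : w = u
      · subst hwu
        refine ⟨v, by simp, fun q hq => ?_⟩
        by_contra hne
        simp only [Function.update_of_ne hne] at hq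
        exact hu (hc.mem q w hq)
      · have hw' : w ∈ K := by simpa [hwu] using hw
        obtain ⟨p, hp, hp2⟩ := hc.existsUnique w hw'
        have hpv : p ≠ v := by
          rintro rfl
          rw [vacant_key hp] at hv
          exact absurd hv (by simp)
        refine ⟨p, by simpa [Function.update_of_ne hpv] using hp, fun q hq => ?_⟩
        by_cases hq2 : q = v
        · subst hq2
          simp only [Function.update_self, Slot.key.injEq] at hq
          exact absurd hq.symm hwu
        · simp only [Function.update_of_ne hq2] at hq
          exact hp2 q hq
    · intro p w hp
      unfold OrderedProbing.shiftInsert at hp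
      split_ifs at hp
      · exact Or.inr (by simpa using hp.symm)
      · exact Or.inl (hc.mem _ _ hp)
      · exact Or.inl (hc.mem _ _ hp)
  · intro c hcd
    unfold resources
    rw [Finset.card_eq_zero, Finset.filter_eq_empty_iff]
    rintro p - ⟨hp, rfl⟩
    have hvp : dist b v ≤ dist b p := by
      by_contra hlt'
      rw [hf p (by omega)] at hp
      exact absurd hp (by simp)
    have := hc.sorted.dist_pos_le hb hlt hvp
    omega

theorem insertKey_noTomb {u : U} {T' : Table n U} {k : Fin n}
    (hi : insertKey h T u = some (T', k)) (hT : ∀ p w, T p ≠ .tomb w) (p : Fin n) (w : U) :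
    T' p ≠ .tomb w := by
  obtain ⟨b, v, -, -, -, -, rfl, -⟩ := insertKey_spec hi
  unfold OrderedProbing.shiftInsert
  split_ifs
  · simp
  · exact hT _ _
  · exact hT _ _

theorem Consistent.delete [DecidableEq U] {K : Set U} {B : ℕ} (hc : Consistent h T K B) {u : U}
    (hu : u ∈ K) : Consistent h (deleteKey T u) (K \ {u}) B ∧
      ∀ c, resources h (deleteKey T u) c = resources h T c + if h u = c then 1 else 0 := by
  obtain ⟨v, hv, hv2⟩ := hc.existsUnique u hu
  have hd : ∀ p, deleteKey T u p = if p = v then .tomb u else T p := by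
    intro p
    split_ifs with hp
    · subst hp
      simp [deleteKey, hv]
    · unfold deleteKey
      have := mt (hv2 p) hp
      split
      · rename_i w hw
        rw [if_neg]
        · exact hw.symm
        · rintro rfl
          exact this hw
      · rfl
  have hdepth : ∀ p, depth h (deleteKey T u) p = depth h T p := by
    intro p
    by_cases hp : p = v
    · subst hp
      simp [depth, hd, hv]
    · simp [depth, hd, hp]
  refine ⟨⟨fun p => ?_, fun w hw => ?_, fun p w hp => ?_, fun p => ?_⟩, fun c => ?_⟩
  · rw [hdepth, hdepth]
    exact hc.sorted p
  · obtain ⟨p, hp, hp2⟩ := hc.existsUnique w hw.1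
    have hpv : p ≠ v := by
      rintro rfl
      rw [hv] at hp
      exact hw.2 (by simpa using hp.symm)
    refine ⟨p, by simp [hd, hpv, hp], fun q hq => ?_⟩
    simp only [hd] at hq
    split_ifs at hq
    exact hp2 q hq
  · rw [hd] at hp
    split_ifs at hp with hpv
    refine ⟨hc.mem p w hp, ?_⟩
    rintro rfl
    exact hpv (hv2 p hp)
  · rw [hdepth]
    exact hc.depth_le p
  · have hset : (Finset.univ.filter fun p => vacant T p = true ∧ pos h T p = c) =
        (Finset.univ.filter fun p => vacant (deleteKey T u) p = true ∧
          pos h (deleteKey T u) p = c).erase v := by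
      ext p
      simp only [Finset.mem_filter, Finset.mem_univ, true_and, Finset.mem_erase]
      by_cases hp : p = v
      · subst hp
        simp [vacant_key hv]
      · have h1 : deleteKey T u p = T p := by simp [hd, hp]
        rw [vacant_congr h1, pos_congr h1]
        simp [hp]
    have h2 : vacant (deleteKey T u) v = true := by simp [vacant, hd]
    have h3 : pos h (deleteKey T u) v = h u := by simp [pos, hd]
    unfold resources
    rw [hset]
    split_ifs with hcc
    · rw [Finset.card_erase_add_one]
      simp [h2, h3, hcc]
    · rw [Finset.erase_eq_of_notMem, add_zero]
      simp [h3, hcc]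

theorem exists_vacant_of_resources_pos {c : Fin n} (hc : 0 < resources h T c) :
    ∃ v, vacant T v = true := by
  obtain ⟨v, hv⟩ := Finset.card_pos.mp hc
  exact ⟨v, (Finset.mem_filter.mp hv).2.1⟩

end Resources

end OrderedProbing

namespace Op

/-- The key which is inserted or deleted. -/
def key {U : Type*} : Op U → U
  | insert u => u
  | delete u => u

/-- The change of the number of keys in the table. -/
def sgn {U : Type*} : Op U → ℤ
  | insert _ => 1
  | delete _ => -1

end Op

namespace OrderedProbing

/-! ### Crossings bounded by the surplus of a path. -/

section Path

variable {n : ℕ} [NeZero n] {U : Type*}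

/-- The distance from slot `c` forward to slot `j`, where slot `j` itself is at distance `n`. -/
def behind (j c : Fin n) : ℕ := n - dist j c

theorem behind_pos (j c : Fin n) : 0 < behind j c := by
  have := dist_lt j c
  unfold behind
  omega

theorem behind_le (j c : Fin n) : behind j c ≤ n := Nat.sub_le _ _

theorem dist_eq_behind (j a c : Fin n) :
    dist a c = if behind j c ≤ behind j a then behind j a - behind j c
      else n + behind j a - behind j c := by
  have h1 := dist_trans j a c
  have h2 := dist_lt j a
  have h3 := dist_lt j c
  have h4 := dist_lt a c
  unfold behind
  split_ifs at * <;> omega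

/-- Moving clockwise decreases `behind j` down to `1`, and the step into slot `j` resets it to `n`.
-/
theorem crosses_iff {a p j : Fin n} : Crosses a p j ↔ behind j a < behind j p := by
  have h1 := dist_trans j a p
  have h2 := dist_lt j a
  have h3 := dist_lt j p
  have h4 := dist_lt a p
  have h5 := dist_trans j a j
  have h6 := dist_lt a j
  rw [dist_self] at h5
  unfold Crosses behind
  split_ifs at * <;> omega

/-- The number of free slots and tombstones at a distance of at most `y` behind `j`. -/
def resourcesUpTo (h : U → Fin n) (T : Table n U) (j : Fin n) (y : ℕ) : ℕ :=
  ∑ c with behind j c ≤ y, resources h T c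

variable {h : U → Fin n} {T T' : Table n U} {j : Fin n}

theorem resourcesUpTo_zero : resourcesUpTo h T j 0 = 0 := by
  unfold resourcesUpTo
  rw [Finset.filter_eq_empty_iff.mpr, Finset.sum_empty]
  intro c _
  have := behind_pos j c
  omega

theorem resourcesUpTo_add {k : Fin n}
    (hk : ∀ c, resources h T c = resources h T' c + if k = c then 1 else 0) (y : ℕ) :
    resourcesUpTo h T j y = resourcesUpTo h T' j y + if behind j k ≤ y then 1 else 0 := by
  unfold resourcesUpTo
  simp_rw [hk, Finset.sum_add_distrib]
  congr 1
  rw [Finset.sum_ite_eq]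
  simp

theorem resourcesUpTo_congr {y z : ℕ} (hyz : y ≤ z)
    (h0 : ∀ c, y < behind j c → behind j c ≤ z → resources h T c = 0) :
    resourcesUpTo h T j y = resourcesUpTo h T j z := by
  unfold resourcesUpTo
  refine Finset.sum_subset (fun c hc => ?_) (fun c hc hc' => ?_)
  · simp only [Finset.mem_filter, Finset.mem_univ, true_and] at *
    omega
  · simp only [Finset.mem_filter, Finset.mem_univ, true_and] at *
    exact h0 c (by omega) hc

theorem exists_vacant_of_resourcesUpTo_pos {y : ℕ} (hy : 0 < resourcesUpTo h T j y) :
    ∃ v, vacant T v = true := by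
  obtain ⟨c, -, hc⟩ := Finset.exists_ne_zero_of_sum_ne_zero hy.ne'
  exact exists_vacant_of_resources_pos (Nat.pos_of_ne_zero hc)

/-- The number of insertions minus the number of deletions in the region below `g`: an operation
at time `t` counts if its key `w` satisfies `Y w ≤ g t`. -/
def surplus (Y : U → ℕ) : (ℕ → ℕ) → List (Op U) → ℤ
  | _, [] => 0
  | g, op :: S => (if Y op.key ≤ g 0 then op.sgn else 0) + surplus Y (fun t => g (t + 1)) S

/-- Prepends a value to a sequence. -/
def prepend (y : ℕ) (g : ℕ → ℕ) : ℕ → ℕ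
  | 0 => y
  | t + 1 => g t

theorem prepend_antitone {y : ℕ} {g : ℕ → ℕ} (hg : Antitone g) (hy : g 0 ≤ y) :
    Antitone (prepend y g) := by
  refine antitone_nat_of_succ_le fun t => ?_
  cases t with
  | zero => exact hy
  | succ t => exact hg (Nat.le_succ t)

theorem prepend_le {y b : ℕ} {g : ℕ → ℕ} (hg : ∀ t, g t ≤ b) (hy : y ≤ b) (t : ℕ) :
    prepend y g t ≤ b := by
  cases t with
  | zero => exact hy
  | succ t => exact hg t

theorem surplus_prepend_insert (Y : U → ℕ) (y : ℕ) (g : ℕ → ℕ) (u : U) (S : List (Op U)) :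
    surplus Y (prepend y g) (Op.insert u :: S) = (if Y u ≤ y then 1 else 0) + surplus Y g S := rfl

theorem surplus_prepend_delete (Y : U → ℕ) (y : ℕ) (g : ℕ → ℕ) (u : U) (S : List (Op U)) :
    surplus Y (prepend y g) (Op.delete u :: S) = (if Y u ≤ y then -1 else 0) + surplus Y g S := rfl

variable [DecidableEq U]

/-- If crossings never use up the region of a path, then their number is the surplus of a path
minus the number of resources initially in its region. Where they do, the time before
that is negligible if the surplus of all paths over time windows is small. -/
theorem exists_path {M β : ℝ} (hM : 0 < M) (hβ : 0 ≤ β) (S : List (Op U)) :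
    ∀ {T : Table n U} {K : Set U} {B : ℕ}, Consistent h T K B →
    B + S.countP Op.isInsert ≤ n → ValidWorkload K S →
    (∀ S₁ u, S₁ ++ [Op.insert u] <+: S →
      M + ((S₁.map Op.sgn).sum : ℤ) ≤ resourcesUpTo h T j n) →
    (∀ S₁, S₁ <:+: S → ∀ g : ℕ → ℕ, Antitone g → (∀ t, g t ≤ n) →
      (surplus (fun w => behind j (h w)) g S₁ : ℝ) ≤ β * S₁.length + M - 2) →
    ∃ S₁ S₂, S = S₁ ++ S₂ ∧ ∃ g : ℕ → ℕ, Antitone g ∧ (∀ t, g t ≤ n) ∧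
      (crossingsFrom h j T S : ℝ) + resourcesUpTo h T j (g 0) ≤
        surplus (fun w => behind j (h w)) g S₁ + β * S₂.length := by
  induction S with
  | nil =>
    intro T K B hc hB hval hbud hwin
    exact ⟨[], [], rfl, fun _ => 0, antitone_const, fun _ => Nat.zero_le _, by
      simp [crossingsFrom, resourcesUpTo_zero, surplus]⟩
  | cons op S ih =>
    intro T K B hc hB hval hbud hwin
    have hwin' : ∀ S₁, S₁ <:+: S → ∀ g : ℕ → ℕ, Antitone g → (∀ t, g t ≤ n) →
        (surplus (fun w => behind j (h w)) g S₁ : ℝ) ≤ β * S₁.length + M - 2 :=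
      fun S₁ hS₁ => hwin S₁ (hS₁.trans (List.suffix_cons op S).isInfix)
    cases op with
    | delete u =>
      obtain ⟨hu, hval⟩ := hval
      obtain ⟨hc', hr⟩ := hc.delete hu
      have hN := resourcesUpTo_add (j := j) (T := deleteKey T u) (T' := T) hr
      obtain ⟨S₁, S₂, rfl, g, hg, hgn, hle⟩ := ih hc' (by simpa [Op.isInsert] using hB) hval
        (fun S₁ w hS => by
          have := hbud (Op.delete u :: S₁) w ((List.prefix_cons_inj _).mpr hS)
          rw [hN, if_pos (behind_le _ _)]
          simp only [List.map_cons, Op.sgn, List.sum_cons] at this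
          push_cast at this ⊢
          linarith) hwin'
      -- With the boundary unchanged, the new tombstone is a resource of the region exactly if the
      -- deletion counts `-1` in the surplus.
      refine ⟨Op.delete u :: S₁, S₂, rfl, prepend (g 0) g, prepend_antitone hg le_rfl,
        prepend_le hgn (hgn 0), ?_⟩
      rw [surplus_prepend_delete]
      simp only [crossingsFrom, crossing, step, prepend]
      rw [hN] at hle
      push_cast at hle ⊢
      split_ifs at hle ⊢ <;> linarith
    | insert u =>
      obtain ⟨hu, hval⟩ := hval
      have hpos := hbud [] u (by simp)
      have hv : ∃ v, vacant T v = true :=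
        exists_vacant_of_resourcesUpTo_pos (h := h) (j := j) (y := n) (by
          have : (0 : ℝ) < resourcesUpTo h T j n := by
            simp only [List.map_nil, List.sum_nil] at hpos
            push_cast at hpos
            linarith
          exact_mod_cast this)
      simp only [List.countP_cons, Op.isInsert, if_true] at hB
      obtain ⟨T', k, hi, hc', hr, hnear⟩ := hc.insert hu (by omega) hv
      have hN := resourcesUpTo_add (j := j) hr
      obtain ⟨S₁, S₂, hS, g, hg, hgn, hle⟩ := ih hc' (by omega) hval
        (fun S₁ w hS => by
          have := hbud (Op.insert u :: S₁) w ((List.prefix_cons_inj _).mpr hS)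
          rw [hN, if_pos (behind_le _ _)] at this
          simp only [List.map_cons, Op.sgn, List.sum_cons] at this
          push_cast at this ⊢
          linarith) hwin'
      have hcr : (crossingsFrom h j T (Op.insert u :: S) : ℝ) =
          (if behind j (h u) < behind j k then 1 else 0) + crossingsFrom h j T' S := by
        simp [crossingsFrom, crossing, step, hi, crosses_iff]
      have hka := behind_le j k
      rw [hcr]
      by_cases hx : behind j (h u) < behind j k
      -- A crossing insertion passes all slots from its hash to `j` and from `j` to its peak. Hence
      -- every resource has a distance above that of the hash and at most that of the peak.
      · have h0 : ∀ c, behind j c ≤ behind j (h u) → resources h T c = 0 := fun c hcu => by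
          refine hnear c ?_
          have := behind_pos j c
          rw [dist_eq_behind j, dist_eq_behind j]
          split_ifs <;> omega
        have h1 : ∀ c, behind j k < behind j c → resources h T c = 0 := fun c hcu => by
          refine hnear c ?_
          have := behind_le j c
          rw [dist_eq_behind j, dist_eq_behind j]
          split_ifs <;> omega
        by_cases ha : behind j (h u) ≤ g 0
        · by_cases hk : behind j k ≤ g 0
          -- The crossing consumes a resource of the region, so the path cannot be extended. But all
          -- resources, at least `M`, are within `g 0`, and at least `M - 1` of them remain in `T'`.
          -- Since the surplus on `S₁` is at most `β * S₁.length + M - 2`, the later crossings and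
          -- the present one are paid by the rate `β`, and the path is dropped.
          · refine ⟨[], Op.insert u :: S, rfl, fun _ => 0, antitone_const,
              fun _ => Nat.zero_le _, ?_⟩
            have h2 := resourcesUpTo_congr (h := h) (T := T) (j := j) (hgn 0)
              (fun c hc1 _ => h1 c (by omega))
            have h3 := hwin' S₁ (hS ▸ (List.prefix_append S₁ S₂).isInfix) g hg hgn
            rw [hN, if_pos hk] at h2
            rw [← h2] at hpos
            have h4 : (S.length : ℝ) = S₁.length + S₂.length := by
              rw [hS]
              push_cast [List.length_append]
              rfl
            simp only [if_pos hx, resourcesUpTo_zero, surplus, List.length_cons, List.map_nil,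
              List.sum_nil] at hpos ⊢
            push_cast at hpos ⊢
            rw [h4]
            nlinarith
          -- The resource comes from outside the region: crossings and surplus both grow by `1`.
          · refine ⟨Op.insert u :: S₁, S₂, by rw [hS]; rfl, prepend (g 0) g,
              prepend_antitone hg le_rfl, prepend_le hgn (hgn 0), ?_⟩
            rw [surplus_prepend_insert]
            simp only [prepend, if_pos ha, if_pos hx, hN, if_neg hk]
            push_cast
            linarith
        -- Raising the boundary to the hash makes the insertion count, and this region holds no
        -- resource yet.
        · refine ⟨Op.insert u :: S₁, S₂, by rw [hS]; rfl, prepend (behind j (h u)) g,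
            prepend_antitone hg (by omega), prepend_le hgn (behind_le _ _), ?_⟩
          have h2 := resourcesUpTo_congr (h := h) (T := T) (j := j) (Nat.zero_le (behind j (h u)))
            (fun c _ hc1 => h0 c hc1)
          rw [resourcesUpTo_zero] at h2
          rw [surplus_prepend_insert]
          simp only [prepend, if_pos hx, ← h2, le_refl, if_true]
          push_cast
          have : (0 : ℝ) ≤ resourcesUpTo h T' j (g 0) := Nat.cast_nonneg _
          linarith
      · have h0 : ∀ c, behind j k < behind j c → behind j c ≤ behind j (h u) →
            resources h T c = 0 := fun c hc1 hc2 => by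
          refine hnear c ?_
          rw [dist_eq_behind j, dist_eq_behind j]
          split_ifs <;> omega
        by_cases ha : behind j (h u) ≤ g 0
        · refine ⟨Op.insert u :: S₁, S₂, by rw [hS]; rfl, prepend (g 0) g,
            prepend_antitone hg le_rfl, prepend_le hgn (hgn 0), ?_⟩
          rw [surplus_prepend_insert]
          simp only [prepend, if_pos ha, if_neg hx, hN,
            if_pos (show behind j k ≤ g 0 by omega)]
          push_cast
          linarith
        · by_cases hk : behind j k ≤ g 0
          -- A resource of the region is used from outside. Raising the boundary to the hash costs
          -- nothing, as no resource lies between peak and hash.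
          · refine ⟨Op.insert u :: S₁, S₂, by rw [hS]; rfl, prepend (behind j (h u)) g,
              prepend_antitone hg (by omega), prepend_le hgn (behind_le _ _), ?_⟩
            have h2 := resourcesUpTo_congr (h := h) (T := T) (j := j)
              (show g 0 ≤ behind j (h u) by omega) (fun c hc1 hc2 => h0 c (by omega) hc2)
            rw [surplus_prepend_insert]
            simp only [prepend, if_neg hx, ← h2, hN, if_pos hk, le_refl, if_true]
            push_cast
            linarith
          · refine ⟨Op.insert u :: S₁, S₂, by rw [hS]; rfl, prepend (g 0) g,
              prepend_antitone hg le_rfl, prepend_le hgn (hgn 0), ?_⟩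
            rw [surplus_prepend_insert]
            simp only [prepend, if_neg ha, if_neg hx, hN, if_neg hk]
            push_cast
            linarith

end Path

/-! ### Displacements and resources of the initial table. -/

section Initial

variable {n : ℕ} [NeZero n] {U : Type*}

theorem behind_injective (j : Fin n) : Function.Injective (behind j) := by
  intro a b hab
  have h1 := dist_lt j a
  have h2 := dist_lt j b
  unfold behind at hab
  exact dist_inj (a := j) (by omega)

theorem card_behind (j : Fin n) (y z : ℕ) (hz : z ≤ n) :
    (Finset.univ.filter fun c => y < behind j c ∧ behind j c ≤ z).card = z - y := by
  rw [← Nat.card_Ioc, ← Finset.card_image_of_injective _ (behind_injective j)]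
  congr 1
  ext t
  simp only [Finset.mem_image, Finset.mem_filter, Finset.mem_univ, true_and, Finset.mem_Ioc]
  constructor
  · rintro ⟨c, hc, rfl⟩
    exact hc
  · intro ht
    have hc : behind j (j + ⟨n - t, by omega⟩) = t := by
      simp only [behind, dist_add_right]
      omega
    exact ⟨_, by rw [hc]; exact ht, hc⟩

theorem card_dist_lt (b : Fin n) (l : ℕ) (hl : l ≤ n) :
    (Finset.univ.filter fun c => dist b c < l).card = l := by
  conv_rhs => rw [← Finset.card_range l]
  rw [← Finset.card_image_of_injective (f := dist b) _ (fun x y hxy => dist_inj hxy)]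
  congr 1
  ext t
  simp only [Finset.mem_image, Finset.mem_filter, Finset.mem_univ, true_and, Finset.mem_range]
  constructor
  · rintro ⟨c, hc, rfl⟩
    exact hc
  · intro ht
    exact ⟨b + ⟨t, by omega⟩, by simpa using ht, by simp⟩

variable {h : U → Fin n} {T : Table n U} {j : Fin n}

theorem resourcesUpTo_empty {y : ℕ} (hy : y ≤ n) :
    resourcesUpTo h (fun _ => .free) j y = y := by
  have h1 : ∀ c, resources h (fun _ : Fin n => .free) c = 1 := by
    intro c
    unfold resources
    simp [vacant, pos, Finset.filter_eq']
  unfold resourcesUpTo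
  simp_rw [h1]
  rw [Finset.sum_const, smul_eq_mul, mul_one]
  refine Eq.trans ?_ (card_behind j 0 y hy)
  congr 1
  ext c
  simp [behind_pos]

/-- If a table without tombstones has a free slot, then an item with a large displacement ends an
interval into which many keys hash. -/
theorem Consistent.exists_le_card {K : Set U} {B : ℕ} (hc : Consistent h T K B)
    {s : Finset U} (hs : ∀ w, w ∈ K → w ∈ s)
    (hT : ∀ p w, T p ≠ .tomb w) (hfree : ∃ v, vacant T v = true) {p : Fin n}
    (hp : depth h T p ≠ 0) :
    ∃ b : Fin n, ∃ l ≤ n, l + depth h T p ≤ (s.filter fun w => dist b (h w) < l).card + 1 := by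
  -- Let `f` be the nearest free slot before `p`. The `dist f p` slots after `f` up to `p` hold
  -- distinct keys. By sortedness their hashes lie between `f + 1` and the hash of the item in `p`,
  -- an interval of `dist f p + 1 - depth h T p` slots.
  obtain ⟨f, hf, hmin⟩ := Finset.exists_min_image
    (Finset.univ.filter fun f => vacant T f = true) (fun f => dist f p)
    (by obtain ⟨v, hv⟩ := hfree; exact ⟨v, by simpa using hv⟩)
  simp only [Finset.mem_filter, Finset.mem_univ, true_and] at hf hmin
  have hf0 : depth h T f = 0 := by
    unfold vacant at hf
    unfold depth
    split at hf
    · simp_all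
    · simp_all
    · rename_i w hw
      exact absurd hw (hT f w)
  have hpf := hc.sorted.depth_le_add f p
  refine ⟨f + 1, dist f p + 1 - depth h T p, by have := dist_lt f p; omega, ?_⟩
  have hkey : ∀ q, 0 < dist f q → dist f q ≤ dist f p → ∃ w, T q = .key w := by
    intro q hq1 hq2
    apply vacant_eq_false
    by_contra hne
    have h1 := hmin q (by simpa using hne)
    have h2 := dist_trans f q p
    have := dist_lt f p
    have := dist_lt f q
    have := dist_lt q p
    split_ifs at h2 <;> omega
  have : Nonempty U := by
    rw [depth] at hp
    split at hp
    · simp at hp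
    all_goals rename_i w _; exact ⟨w⟩
  choose! key hkey using hkey
  have hQ : (Finset.univ.filter fun q => 0 < dist f q ∧ dist f q ≤ dist f p).card = dist f p := by
    have h1 := card_dist_lt f (dist f p + 1) (dist_lt f p)
    have h2 := card_dist_lt f 1 (by have := dist_lt f p; omega)
    have h3 : (Finset.univ.filter fun q => 0 < dist f q ∧ dist f q ≤ dist f p) =
        (Finset.univ.filter fun q => dist f q < dist f p + 1) \
          (Finset.univ.filter fun q => dist f q < 1) := by
      ext q
      simp only [Finset.mem_filter, Finset.mem_univ, true_and, Finset.mem_sdiff]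
      omega
    rw [h3, Finset.card_sdiff_of_subset, h1, h2]
    · omega
    · intro q
      simp only [Finset.mem_filter, Finset.mem_univ, true_and]
      omega
  have hcard : dist f p ≤
      (s.filter fun w => dist (f + 1) (h w) < dist f p + 1 - depth h T p).card := by
    rw [← hQ]
    refine Finset.card_le_card_of_injOn key ?_ ?_
    · intro q hq
      simp only [Finset.coe_filter, Finset.mem_univ, true_and, Set.mem_ofPred_eq] at hq ⊢
      have hk := hkey q hq.1 hq.2
      refine ⟨hs _ (hc.mem _ _ hk), ?_⟩
      have hpos : pos h T q = h (key q) := by simp [pos, hk]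
      have hd : depth h T q = dist (h (key q)) q + 1 := by simp [depth, hk]
      have h1 := dist_pos (h := h) (T := T) (f + 1) q
      have h2 := hc.sorted.depth_le_add f q
      have h3 := hc.sorted.depth_le_add q p
      have h4 := dist_trans f q p
      have h5 := dist_trans f (f + 1) q
      have h6 := dist_add_one f f
      have := dist_lt f p
      have := dist_lt f q
      have := dist_lt q p
      have := dist_lt (f + 1) q
      rw [hpos] at h1
      rw [h1]
      rw [dist_self] at h6
      split_ifs at * <;> omega
    · intro q hq q' hq' he
      simp only [Finset.coe_filter, Finset.mem_univ, true_and, Set.mem_ofPred_eq] at hq hq'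
      have hk := hkey q hq.1 hq.2
      have hk' := hkey q' hq'.1 hq'.2
      exact (hc.existsUnique _ (hc.mem _ _ hk)).unique hk (by rw [he]; exact hk')
  have := dist_lt f p
  omega

variable [DecidableEq U]

/-- The last clause is the static counterpart of `exists_path`: a shortage of resources within `y`
is explained by an excess of keys that hash within a possibly larger distance `z`. -/
theorem initialTable_spec (A : List U) (hA : A.Nodup) (hn : A.length ≤ n) :
    Consistent h (initialTable h A) {u | u ∈ A} A.length ∧
      (∀ p w, initialTable h A p ≠ .tomb w) ∧
      ∀ j, resourcesUpTo h (initialTable h A) j n + A.length = n ∧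
        ∀ y ≤ n, ∃ z ≤ n, y ≤ z ∧
          z ≤ resourcesUpTo h (initialTable h A) j y + A.countP fun w => behind j (h w) ≤ z := by
  induction A using List.reverseRecOn with
  | nil =>
    refine ⟨⟨fun p => ?_, by simp, by simp [initialTable], by simp [initialTable, depth]⟩,
      by simp [initialTable], fun j => ⟨?_, fun y hy => ⟨y, hy, le_rfl, ?_⟩⟩⟩
    · simp [initialTable, depth]
    · exact resourcesUpTo_empty le_rfl
    · simp [initialTable, resourcesUpTo_empty hy]
  | append_singleton A u ih =>
    rw [List.nodup_append] at hA
    obtain ⟨hA1, -, hA2⟩ := hA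
    rw [List.length_append, List.length_singleton] at hn
    obtain ⟨hc, hT, hres⟩ := ih hA1 (by omega)
    have hu : u ∉ {u | u ∈ A} := fun hu => hA2 u hu u (by simp) rfl
    have hv : ∃ v, vacant (initialTable h A) v = true :=
      exists_vacant_of_resourcesUpTo_pos (h := h) (j := 0) (y := n) (by
        have := (hres 0).1
        omega)
    obtain ⟨T', k, hi, hc', hr, hnear⟩ := hc.insert hu (by omega) hv
    have hstep : initialTable h (A ++ [u]) = T' := by
      unfold initialTable
      rw [List.map_append, List.foldl_append]
      have : step h (initialTable h A) (Op.insert u) = T' := by simp [step, hi]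
      simpa [initialTable] using this
    rw [hstep, List.length_append, List.length_singleton]
    have hN := fun j => resourcesUpTo_add (j := j) hr
    refine ⟨?_, insertKey_noTomb hi hT, fun j => ⟨?_, fun y hy => ?_⟩⟩
    · convert hc' using 1
      ext w
      simp [or_comm]
    · have h1 := (hres j).1
      rw [hN, if_pos (behind_le j k)] at h1
      omega
    · have hcount : ∀ z, (A ++ [u]).countP (fun w => behind j (h w) ≤ z) =
          A.countP (fun w => behind j (h w) ≤ z) + if behind j (h u) ≤ z then 1 else 0 := by
        intro z
        rw [List.countP_append, List.countP_singleton]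
        simp
      simp_rw [hcount]
      by_cases hky : behind j k ≤ y
      -- If a key hashing beyond `y` takes a resource within `y`, then `y` can be raised to its hash
      -- without meeting further resources.
      · obtain ⟨y₂, hy₂, hyy, hya, heq⟩ : ∃ y₂ ≤ n, y ≤ y₂ ∧ behind j (h u) ≤ y₂ ∧
            resourcesUpTo h (initialTable h A) j y = resourcesUpTo h (initialTable h A) j y₂ := by
          by_cases hua : behind j (h u) ≤ y
          · exact ⟨y, hy, le_rfl, hua, rfl⟩
          · refine ⟨behind j (h u), behind_le _ _, by omega, le_rfl,
              resourcesUpTo_congr (by omega) fun c hc1 hc2 => hnear c ?_⟩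
            rw [dist_eq_behind j, dist_eq_behind j]
            split_ifs <;> omega
        obtain ⟨z, hz, hyz, hle⟩ := (hres j).2 y₂ hy₂
        refine ⟨z, hz, by omega, ?_⟩
        rw [← heq, hN, if_pos hky] at hle
        rw [if_pos (by omega)]
        omega
      · obtain ⟨z, hz, hyz, hle⟩ := (hres j).2 y hy
        refine ⟨z, hz, hyz, ?_⟩
        rw [hN, if_neg hky] at hle
        omega

theorem crossingsFrom_le (T : Table n U) (S : List (Op U)) :
    crossingsFrom h j T S ≤ S.length := by
  induction S generalizing T with
  | nil => simp [crossingsFrom]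
  | cons op S ih =>
    have h1 : crossing h j T op ≤ 1 := by
      unfold crossing
      split
      · split
        · split_ifs <;> simp
        · simp
      · simp
    have := ih (step h T op)
    simp only [crossingsFrom, List.length_cons]
    omega

end Initial

end OrderedProbing

/-! ### A Bernstein inequality for hashed weights. -/

section Bernstein

variable {n : ℕ} [NeZero n] {U Ω : Type*} [MeasurableSpace Ω] {P : Measure Ω}
  [IsProbabilityMeasure P] {h : Ω → U → Fin n}

theorem IsUniformHash.measurableSet_mem (hh : IsUniformHash P h) (u : U) (J : Finset (Fin n)) :
    MeasurableSet {ω | h ω u ∈ J} :=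
  hh.measurable u (Finset.measurableSet J)

theorem IsUniformHash.measureReal_mem (hh : IsUniformHash P h) (u : U) (J : Finset (Fin n)) :
    P.real {ω | h ω u ∈ J} = J.card / n := by
  have h1 : {ω | h ω u ∈ J} = ⋃ i ∈ J, {ω | h ω u = i} := by
    ext ω
    simp
  rw [h1, measureReal_biUnion_finset]
  · simp only [measureReal_def, hh.uniform]
    simp [div_eq_mul_inv]
  · intro i _ i' _ hii
    refine Set.disjoint_left.mpr fun ω hω hω' => hii ?_
    exact hω.symm.trans hω'
  · intro i _
    exact hh.measurable u (measurableSet_singleton i)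

/-- With `p = J.card / n`, the generating function is `1 + p * (exp (l * a) - 1)`, and `exp t ≤ 1 +
t + t ^ 2` for `|t| ≤ 1`. -/
theorem IsUniformHash.mgf_le (hh : IsUniformHash P h) (u : U) (J : Finset (Fin n)) {a l : ℝ}
    (ha : |a| ≤ 1) (hl0 : 0 ≤ l) (hl : l ≤ 1) :
    mgf (fun ω => if h ω u ∈ J then a else 0) P l ≤
      Real.exp (l * (J.card / n * a) + l ^ 2 * (J.card / n * a ^ 2)) := by
  have h1 : ∀ ω, Real.exp (l * if h ω u ∈ J then a else 0) =
      1 + {ω | h ω u ∈ J}.indicator (fun _ => Real.exp (l * a) - 1) ω := by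
    intro ω
    by_cases hω : h ω u ∈ J <;> simp [hω, Set.indicator]
  have hp : 0 ≤ (J.card / n : ℝ) := by positivity
  have h2 : mgf (fun ω => if h ω u ∈ J then a else 0) P l =
      1 + (J.card / n) * (Real.exp (l * a) - 1) := by
    unfold mgf
    simp_rw [h1]
    rw [integral_add (integrable_const _)
      ((integrable_const _).indicator (hh.measurableSet_mem u J)),
      integral_indicator_const _ (hh.measurableSet_mem u J), hh.measureReal_mem]
    simp
  have h3 := abs_le.mp (Real.abs_exp_sub_one_sub_id_le (x := l * a) (by
    rw [abs_mul, abs_of_nonneg hl0]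
    nlinarith [abs_nonneg a]))
  rw [h2]
  refine le_trans ?_ (Real.add_one_le_exp _)
  nlinarith [mul_le_mul_of_nonneg_left h3.2 hp]

/-- A Bernstein inequality for the weight of the keys that hash into a set of slots. -/
theorem IsUniformHash.measureReal_le (hh : IsUniformHash P h) (s : Finset U) (a : U → ℝ)
    (ha : ∀ u ∈ s, |a u| ≤ 1) (J : Finset (Fin n)) {μ v σ : ℝ}
    (hμ : J.card / n * ∑ u ∈ s, a u ≤ μ) (hv : J.card / n * ∑ u ∈ s, a u ^ 2 ≤ v) (hσ : 1 ≤ σ) :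
    P.real {ω | μ + 2 * σ * (√v + 1) ≤ ∑ u ∈ s, if h ω u ∈ J then a u else 0} ≤
      Real.exp (-σ) := by
  have hv0 : 0 ≤ v := le_trans (by positivity) hv
  have hs : 0 < √v + 1 := by positivity
  -- This choice gives `l ^ 2 * v ≤ 1` and `l * (2 * σ * (√v + 1)) = 2 * σ`, so the Chernoff bound
  -- is `exp (1 - 2 * σ)`, at most `exp (-σ)`.
  set l : ℝ := (√v + 1)⁻¹ with hl
  have hl0 : 0 ≤ l := by positivity
  have hl1 : l ≤ 1 := inv_le_one_of_one_le₀ (by linarith [Real.sqrt_nonneg v])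
  have hlv : l ^ 2 * v ≤ 1 := by
    have h1 : l * (√v + 1) = 1 := inv_mul_cancel₀ hs.ne'
    have h2 : l * √v ≤ 1 := by nlinarith
    have h3 : 0 ≤ l * √v := by positivity
    calc l ^ 2 * v = (l * √v) ^ 2 := by rw [mul_pow, Real.sq_sqrt hv0]
      _ ≤ 1 := by nlinarith
  set X : U → Ω → ℝ := fun u ω => if h ω u ∈ J then a u else 0 with hX
  have hf : ∀ u, Measurable fun i : Fin n => if i ∈ J then a u else 0 :=
    fun u => measurable_of_finite _
  have hXm : ∀ u, Measurable (X u) := fun u => (hf u).comp (hh.measurable u)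
  have hind : iIndepFun X P := hh.indep.comp (fun u i => if i ∈ J then a u else 0) hf
  have hmgf := hind.mgf_sum (t := l) hXm s
  have hle : mgf (∑ u ∈ s, X u) P l ≤ Real.exp (l * μ + 1) := by
    rw [hmgf]
    calc ∏ u ∈ s, mgf (X u) P l
        ≤ ∏ u ∈ s, Real.exp (l * (J.card / n * a u) + l ^ 2 * (J.card / n * a u ^ 2)) :=
          Finset.prod_le_prod (fun u _ => mgf_nonneg) fun u hu => hh.mgf_le u J (ha u hu) hl0 hl1
      _ = Real.exp (l * (J.card / n * ∑ u ∈ s, a u) + l ^ 2 * (J.card / n * ∑ u ∈ s, a u ^ 2)) := by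
          rw [← Real.exp_sum]
          simp only [Finset.sum_add_distrib, Finset.mul_sum]
      _ ≤ Real.exp (l * μ + 1) := by
          refine Real.exp_le_exp.mpr (add_le_add (mul_le_mul_of_nonneg_left hμ hl0) ?_)
          exact (mul_le_mul_of_nonneg_left hv (sq_nonneg l)).trans hlv
  have hint : Integrable (fun ω => Real.exp (l * (∑ u ∈ s, X u) ω)) P := by
    refine Integrable.of_bound (C := Real.exp (l * s.card)) ?_ (ae_of_all _ fun ω => ?_)
    · have : Measurable (∑ u ∈ s, X u) := by
        convert Finset.measurable_sum s fun u _ => hXm u using 1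
        ext ω
        simp
      exact (Real.measurable_exp.comp (this.const_mul l)).aestronglyMeasurable
    · rw [Real.norm_eq_abs, abs_of_pos (Real.exp_pos _)]
      refine Real.exp_le_exp.mpr (mul_le_mul_of_nonneg_left ?_ hl0)
      rw [Finset.sum_apply, Finset.card_eq_sum_ones, Nat.cast_sum]
      refine Finset.sum_le_sum fun u hu => ?_
      have := (abs_le.mp (ha u hu)).2
      simp only [hX]
      split_ifs <;> simp [this]
  have hch := measure_ge_le_exp_mul_mgf (μ + 2 * σ * (√v + 1)) hl0 hint
  have hset : {ω | μ + 2 * σ * (√v + 1) ≤ ∑ u ∈ s, if h ω u ∈ J then a u else 0} =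
      {ω | μ + 2 * σ * (√v + 1) ≤ (∑ u ∈ s, X u) ω} := by
    ext ω
    simp [hX]
  rw [hset]
  refine hch.trans ?_
  calc Real.exp (-l * (μ + 2 * σ * (√v + 1))) * mgf (∑ u ∈ s, X u) P l
      ≤ Real.exp (-l * (μ + 2 * σ * (√v + 1))) * Real.exp (l * μ + 1) :=
        mul_le_mul_of_nonneg_left hle (Real.exp_pos _).le
    _ = Real.exp (1 - 2 * σ) := by
        rw [← Real.exp_add]
        congr 1
        have h1 : l * (√v + 1) = 1 := inv_mul_cancel₀ hs.ne'
        linear_combination -2 * σ * h1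
    _ ≤ Real.exp (-σ) := Real.exp_le_exp.mpr (by linarith)

end Bernstein

/-! ### Net weights of keys over time windows. -/

theorem ValidWorkload.of_append {U : Type*} {S₁ S₂ : List (Op U)} :
    ∀ {K : Set U}, ValidWorkload K (S₁ ++ S₂) →
      ValidWorkload K S₁ ∧ ∃ K', ValidWorkload K' S₂ := by
  induction S₁ with
  | nil => exact fun {K} hv => ⟨trivial, K, hv⟩
  | cons op S₁ ih =>
    intro K hv
    cases op with
    | insert u => exact ⟨⟨hv.1, (ih hv.2).1⟩, (ih hv.2).2⟩
    | delete u => exact ⟨⟨hv.1, (ih hv.2).1⟩, (ih hv.2).2⟩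

namespace OrderedProbing

section Weights

variable {U : Type*}

/-- A workload which is valid for some set of keys and alternates. -/
def Balanced (S : List (Op U)) : Prop :=
  (∃ K, ValidWorkload K S) ∧ Alternating S

theorem Balanced.infix {S S₁ : List (Op U)} (hS : Balanced S) (h : S₁ <:+: S) : Balanced S₁ := by
  obtain ⟨⟨K, hv⟩, ha⟩ := hS
  refine ⟨?_, ha.infix h⟩
  obtain ⟨A, B, rfl⟩ := h
  exact (hv.of_append.1).of_append.2

/-- The change of the number of keys at time `t`. -/
def opSgn (S : List (Op U)) (t : ℕ) : ℤ :=
  match S[t]? with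
  | some op => op.sgn
  | none => 0

variable [DecidableEq U]

/-- The change of the presence of the key `u` at time `t`. -/
def opWeight (S : List (Op U)) (u : U) (t : ℕ) : ℤ :=
  match S[t]? with
  | some op => if op.key = u then op.sgn else 0
  | none => 0

/-- The change of the presence of the key `u` in the time window `[a, b)`. -/
def net (S : List (Op U)) (u : U) (a b : ℕ) : ℤ := ∑ t ∈ Finset.Ico a b, opWeight S u t

open Classical in
/-- Whether the key `u` occurs in the time window `[a, b)`. -/
noncomputable def active (S : List (Op U)) (u : U) (a b : ℕ) : ℤ :=
  if ∃ t ∈ Finset.Ico a b, opWeight S u t ≠ 0 then 1 else 0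

/-- Here `e` indicates the presence of `u`. The weights telescope, so reinserting a key many times
does not increase its net weight over a window. -/
theorem exists_potential_of_valid (u : U) (S : List (Op U)) : ∀ {K : Set U}, ValidWorkload K S →
    ∃ e : ℕ → ℤ, (∀ t, e t = 0 ∨ e t = 1) ∧ (e 0 = 1 ↔ u ∈ K) ∧
      ∀ t, opWeight S u t = e (t + 1) - e t := by
  classical
  induction S with
  | nil =>
    intro K _
    refine ⟨fun _ => if u ∈ K then 1 else 0, fun t => ?_, ?_, fun t => ?_⟩
    · by_cases hu : u ∈ K <;> simp [hu]
    · simp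
    · simp [opWeight]
  | cons op S ih =>
    intro K hv
    have hcons : ∀ K', ValidWorkload K' S →
        ((if op.key = u then op.sgn else 0) =
          (if u ∈ K' then 1 else 0) - (if u ∈ K then 1 else 0)) →
        ∃ e : ℕ → ℤ, (∀ t, e t = 0 ∨ e t = 1) ∧ (e 0 = 1 ↔ u ∈ K) ∧
          ∀ t, opWeight (op :: S) u t = e (t + 1) - e t := by
      intro K' hv' hop
      obtain ⟨e, he, he0, hee⟩ := ih hv'
      refine ⟨fun t => Nat.casesOn t (if u ∈ K then 1 else 0) e, fun t => ?_, ?_, fun t => ?_⟩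
      · cases t with
        | zero => by_cases hu : u ∈ K <;> simp [hu]
        | succ t => exact he t
      · simp
      · cases t with
        | zero =>
          have h1 : e 0 = if u ∈ K' then 1 else 0 := by
            by_cases hu : u ∈ K'
            · simp [hu, he0.mpr hu]
            · have := mt he0.mp hu
              simpa [hu, this] using he 0
          simp only [opWeight, List.getElem?_cons_zero]
          rw [hop, ← h1]
          rfl
        | succ t =>
          have := hee t
          simp only [opWeight, List.getElem?_cons_succ] at this ⊢
          exact this
    cases op with
    | insert w =>
      refine hcons _ hv.2 ?_
      by_cases hw : w = u
      · subst hw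
        simp [Op.key, Op.sgn, hv.1]
      · simp [Op.key, hw, Ne.symm hw]
    | delete w =>
      refine hcons _ hv.2 ?_
      by_cases hw : w = u
      · subst hw
        simp [Op.key, Op.sgn, hv.1]
      · simp [Op.key, hw, Ne.symm hw]

theorem exists_potential_of_alternating (S : List (Op U)) (hS : Alternating S) :
    ∃ e : ℕ → ℤ, (∀ t, e t = 0 ∨ e t = 1) ∧ ∀ t, opSgn S t = e (t + 1) - e t := by
  induction S with
  | nil => exact ⟨fun _ => 0, by simp, by simp [opSgn]⟩
  | cons op S ih =>
    have key : ∃ e : ℕ → ℤ, (∀ t, e t = 0 ∨ e t = 1) ∧ (∀ t, opSgn S t = e (t + 1) - e t) ∧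
        e 0 = if op.isInsert then 1 else 0 := by
      cases S with
      | nil =>
        refine ⟨fun _ => if op.isInsert then 1 else 0, fun t => ?_, by simp [opSgn], rfl⟩
        cases op.isInsert <;> simp
      | cons op' S =>
        obtain ⟨e, he, hee⟩ := ih (List.IsChain.tail hS)
        refine ⟨e, he, hee, ?_⟩
        have h1 : op.isInsert ≠ op'.isInsert := (List.isChain_cons_cons.mp hS).1
        have h2 := hee 0
        have h3 := he 0
        have h4 := he 1
        simp only [opSgn, List.getElem?_cons_zero, zero_add] at h2
        cases op <;> cases op' <;> simp [Op.sgn, Op.isInsert] at h1 h2 ⊢ <;> omega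
    obtain ⟨e, he, hee, he0⟩ := key
    refine ⟨fun t => Nat.casesOn t (if op.isInsert then 0 else 1) e, fun t => ?_, fun t => ?_⟩
    · cases t with
      | zero => cases op.isInsert <;> simp
      | succ t => exact he t
    · cases t with
      | zero => cases op <;> simp [opSgn, he0, Op.isInsert, Op.sgn]
      | succ t =>
        have := hee t
        simp only [opSgn, List.getElem?_cons_succ] at this ⊢
        exact this

theorem sum_Ico_potential {f e : ℕ → ℤ} (he : ∀ t, e t = 0 ∨ e t = 1)
    (hf : ∀ t, f t = e (t + 1) - e t) (a b : ℕ) : |∑ t ∈ Finset.Ico a b, f t| ≤ 1 := by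
  rcases le_total a b with hab | hab
  · rw [Finset.sum_Ico_eq_sub _ hab]
    simp_rw [hf, Finset.sum_range_sub]
    have h1 := he a
    have h2 := he b
    rw [abs_le]
    constructor <;> omega
  · simp [Finset.Ico_eq_empty_of_le hab]

theorem Balanced.abs_net_le {S : List (Op U)} (hS : Balanced S) (u : U) (a b : ℕ) :
    |net S u a b| ≤ 1 := by
  obtain ⟨⟨K, hK⟩, -⟩ := hS
  obtain ⟨e, he, -, hee⟩ := exists_potential_of_valid u S hK
  exact sum_Ico_potential he hee a b

theorem Balanced.abs_sum_opSgn_le {S : List (Op U)} (hS : Balanced S) (a b : ℕ) :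
    |∑ t ∈ Finset.Ico a b, opSgn S t| ≤ 1 := by
  obtain ⟨e, he, hee⟩ := exists_potential_of_alternating S hS.2
  exact sum_Ico_potential he hee a b

theorem sum_opWeight {S : List (Op U)} {s : Finset U} (hs : ∀ op ∈ S, op.key ∈ s) (t : ℕ) :
    ∑ u ∈ s, opWeight S u t = opSgn S t := by
  unfold opWeight opSgn
  rcases ht : S[t]? with _ | op
  · simp
  · rw [Finset.sum_ite_eq, if_pos (hs op (List.mem_of_getElem? ht))]

/-- Alternation enters the probabilistic estimate here: it keeps the mean of every box sum at most
`1`. -/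
theorem Balanced.sum_net_le {S : List (Op U)} (hS : Balanced S) {s : Finset U}
    (hs : ∀ op ∈ S, op.key ∈ s) (a b : ℕ) : ∑ u ∈ s, net S u a b ≤ 1 := by
  unfold net
  rw [Finset.sum_comm]
  simp_rw [sum_opWeight hs]
  exact (abs_le.mp (hS.abs_sum_opSgn_le a b)).2

theorem sum_active_le (S : List (Op U)) (s : Finset U) (a b : ℕ) :
    ∑ u ∈ s, active S u a b ≤ (b - a : ℕ) := by
  classical
  have h1 : ∀ u ∈ s, active S u a b ≤
      ∑ t ∈ Finset.Ico a b, if opWeight S u t ≠ 0 then 1 else 0 := by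
    intro u _
    unfold active
    split_ifs with hu
    · obtain ⟨t, ht, htu⟩ := hu
      refine le_trans ?_ (Finset.single_le_sum (fun t _ => ?_) ht)
      · simp [htu]
      · split_ifs <;> simp
    · exact Finset.sum_nonneg fun t _ => by split_ifs <;> simp
  refine (Finset.sum_le_sum h1).trans ?_
  rw [Finset.sum_comm]
  have h2 : ∀ t ∈ Finset.Ico a b, (∑ u ∈ s, if opWeight S u t ≠ 0 then (1 : ℤ) else 0) ≤ 1 := by
    intro t _
    unfold opWeight
    rcases S[t]? with _ | op
    · simp
    · calc (∑ u ∈ s, if (if op.key = u then op.sgn else 0) ≠ 0 then (1 : ℤ) else 0)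
          ≤ ∑ u ∈ s, if op.key = u then 1 else 0 := by
            refine Finset.sum_le_sum fun u _ => ?_
            split_ifs <;> simp_all
        _ ≤ 1 := by
            rw [Finset.sum_ite_eq]
            split_ifs <;> simp
  refine (Finset.sum_le_sum h2).trans ?_
  simp

theorem active_nonneg (S : List (Op U)) (u : U) (a b : ℕ) : 0 ≤ active S u a b := by
  unfold active
  split_ifs <;> simp

theorem active_le_one (S : List (Op U)) (u : U) (a b : ℕ) : active S u a b ≤ 1 := by
  unfold active
  split_ifs <;> simp

theorem Balanced.abs_net_le_active {S : List (Op U)} (hS : Balanced S) (u : U) {a b a' b' : ℕ}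
    (ha : a' ≤ a) (hb : b ≤ b') : |net S u a b| ≤ active S u a' b' := by
  unfold active
  split_ifs with hu
  · exact hS.abs_net_le u a b
  · push Not at hu
    have : net S u a b = 0 := Finset.sum_eq_zero fun t ht => hu t (by
      simp only [Finset.mem_Ico] at ht ⊢
      omega)
    simp [this]

theorem net_consecutive (S : List (Op U)) (u : U) {a b c : ℕ} (hab : a ≤ b) (hbc : b ≤ c) :
    net S u a b + net S u b c = net S u a c := Finset.sum_Ico_consecutive _ hab hbc

theorem filter_range_eq_range_card {p : ℕ → Prop} [DecidablePred p]
    (hp : ∀ t, p (t + 1) → p t) (m : ℕ) :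
    (Finset.range m).filter p = Finset.range ((Finset.range m).filter p).card := by
  have hp' : ∀ {t t'}, t ≤ t' → p t' → p t := by
    intro t t' htt
    induction htt with
    | refl => exact id
    | step _ ih => exact fun h => ih (hp _ h)
  induction m with
  | zero => simp
  | succ m ih =>
    rw [Finset.range_add_one, Finset.filter_insert]
    split_ifs with hm
    · have : (Finset.range m).filter p = Finset.range m :=
        Finset.filter_true_of_mem fun t ht => hp' (Finset.mem_range.mp ht).le hm
      rw [this, ← Finset.range_add_one, Finset.card_range]
    · exact ih

theorem surplus_eq_sum (Y : U → ℕ) {s : Finset U} (S : List (Op U)) :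
    (∀ op ∈ S, op.key ∈ s) → ∀ g : ℕ → ℕ, surplus Y g S =
      ∑ t ∈ Finset.range S.length, ∑ u ∈ s, if Y u ≤ g t then opWeight S u t else 0 := by
  induction S with
  | nil => simp [surplus]
  | cons op S ih =>
    intro hs g
    rw [List.length_cons, Finset.sum_range_succ', surplus,
      ih (fun op' hop => hs op' (List.mem_cons_of_mem _ hop)), add_comm]
    congr 1
    have h1 : ∀ u, (if Y u ≤ g 0 then opWeight (op :: S) u 0 else 0) =
        if op.key = u then (if Y op.key ≤ g 0 then op.sgn else 0) else 0 := by
      intro u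
      simp only [opWeight, List.getElem?_cons_zero]
      by_cases hu : op.key = u
      · subst hu
        simp
      · simp [hu]
    simp_rw [h1]
    rw [Finset.sum_ite_eq, if_pos (hs op (by simp))]

/-- As `g` decreases, each key lies in the region during an initial stretch of time, so a path only
selects one prefix for each key. -/
theorem surplus_eq_sum_net (Y : U → ℕ) {s : Finset U} {S : List (Op U)}
    (hs : ∀ op ∈ S, op.key ∈ s) {g : ℕ → ℕ} (hg : Antitone g) : surplus Y g S =
      ∑ u ∈ s, net S u 0 ((Finset.range S.length).filter fun t => Y u ≤ g t).card := by
  rw [surplus_eq_sum Y S hs g, Finset.sum_comm]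
  refine Finset.sum_congr rfl fun u _ => ?_
  rw [← Finset.sum_filter, net, ← Finset.range_eq_Ico]
  exact Finset.sum_congr (filter_range_eq_range_card
    (fun t (ht : Y u ≤ g (t + 1)) => ht.trans (hg (Nat.le_succ t))) _) fun _ _ => rfl

end Weights

/-! ### Chaining over dyadic time windows. -/

section Chaining

variable {n : ℕ} [NeZero n] {U : Type*}

/-- The slots at a distance in `(y, z]` behind `j`. -/
def slotsBehind (j : Fin n) (y z : ℕ) : Finset (Fin n) :=
  Finset.univ.filter fun c => y < behind j c ∧ behind j c ≤ z

theorem mem_slotsBehind {j c : Fin n} {y z : ℕ} :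
    c ∈ slotsBehind j y z ↔ y < behind j c ∧ behind j c ≤ z := by
  simp [slotsBehind]

theorem sum_sqrt_le (N : ℕ) (v : ℕ → ℝ) (hv : ∀ i, 0 ≤ v i) :
    ∑ i ∈ Finset.range N, √(v i) ≤ √(N * ∑ i ∈ Finset.range N, v i) := by
  refine Real.le_sqrt_of_sq_le ?_
  have := sq_sum_le_card_mul_sum_sq (s := Finset.range N) (f := fun i => √(v i))
  simpa [Real.sq_sqrt (hv _)] using this

variable {h : U → Fin n} {j : Fin n}

/-- Grouping the keys by the time block that contains `τ` cuts the distances up to `Y` into `N`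
disjoint intervals. Their variances sum to at most `l * Y / n`, and Cauchy–Schwarz bounds the sum of
the standard deviations. -/
theorem sum_level_le {s : Finset U} {τ : ℕ → ℕ} (hτ : Antitone τ) {l N Y : ℕ} (hl : 0 < l)
    (hN : ∀ y, τ y < N * l) (F : U → ℕ → ℝ) {c₀ c₁ σ : ℝ} (hc₁ : 0 ≤ c₁) (hσ : 0 ≤ σ)
    (hF : ∀ i < N, ∀ y z, y ≤ z → z ≤ Y →
      (∑ u ∈ s, if h u ∈ slotsBehind j y z then F u i else 0) ≤
        c₀ + c₁ * (l * (z - y) / n) + 2 * σ * (√(l * (z - y) / n) + 1)) :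
    (∑ u ∈ s, if behind j (h u) ≤ Y then F u (τ (behind j (h u)) / l) else 0) ≤
      N * (c₀ + 2 * σ) + c₁ * (l * Y / n) + 2 * σ * √(N * (l * Y / n)) := by
  -- `b i` is the greatest distance up to `Y` at which `τ` is still at least `i * l`, or `0`. The
  -- shift by one is there because distances start at `1`.
  set b : ℕ → ℕ := fun i => ((Finset.range Y).filter fun y => i * l ≤ τ (y + 1)).card with hb
  have hbY : ∀ i, b i ≤ Y := fun i => by
    simpa using Finset.card_filter_le (Finset.range Y) fun y => i * l ≤ τ (y + 1)
  have hbanti : ∀ i, b (i + 1) ≤ b i := fun i => by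
    refine Finset.card_le_card (Finset.monotone_filter_right _ fun y _ hy => ?_)
    have : i * l ≤ (i + 1) * l := Nat.mul_le_mul_right l (Nat.le_succ i)
    exact this.trans hy
  have hmem : ∀ i y, 0 < y → y ≤ Y → (y ≤ b i ↔ i * l ≤ τ y) := by
    intro i y hy0 hy
    have h1 := filter_range_eq_range_card (p := fun y => i * l ≤ τ (y + 1))
      (fun t ht => le_trans ht (hτ (by omega))) Y
    have h2 := congrArg (fun S => y - 1 ∈ S) h1
    simp only [Finset.mem_filter, Finset.mem_range, Nat.sub_add_cancel hy0, eq_iff_iff] at h2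
    constructor
    · intro hle
      exact (h2.mpr (by simp only [hb] at hle; omega)).2
    · intro hle
      have := h2.mp ⟨by omega, hle⟩
      simp only [hb]
      omega
  have hsplit : ∀ u ∈ s, (if behind j (h u) ≤ Y then F u (τ (behind j (h u)) / l) else 0) =
      ∑ i ∈ Finset.range N, if h u ∈ slotsBehind j (b (i + 1)) (b i) then F u i else 0 := by
    intro u _
    split_ifs with hu
    · have h1 : ∀ i ∈ Finset.range N,
          (if h u ∈ slotsBehind j (b (i + 1)) (b i) then F u i else 0) =
          if τ (behind j (h u)) / l = i then F u i else 0 := by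
        intro i _
        congr 1
        have h2 := hmem i _ (behind_pos j (h u)) hu
        have h3 := hmem (i + 1) _ (behind_pos j (h u)) hu
        rw [← Nat.le_div_iff_mul_le hl] at h2 h3
        rw [mem_slotsBehind, eq_iff_iff]
        omega
      rw [Finset.sum_congr rfl h1, Finset.sum_ite_eq, if_pos]
      rw [Finset.mem_range, Nat.div_lt_iff_lt_mul hl]
      exact hN _
    · rw [Finset.sum_eq_zero]
      intro i _
      rw [if_neg]
      rw [mem_slotsBehind]
      have := hbY i
      omega
  rw [Finset.sum_congr rfl hsplit, Finset.sum_comm]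
  set v : ℕ → ℝ := fun i => l * (b i - b (i + 1) : ℝ) / n with hv
  have hv0 : ∀ i, 0 ≤ v i := fun i => by
    have : (b (i + 1) : ℝ) ≤ b i := by exact_mod_cast hbanti i
    have : (0 : ℝ) ≤ b i - b (i + 1) := by linarith
    simp only [hv]
    positivity
  have hvs : ∑ i ∈ Finset.range N, v i ≤ l * Y / n := by
    have h1 : ∑ i ∈ Finset.range N, v i = l * (b 0 - b N : ℝ) / n := by
      simp only [hv]
      rw [← Finset.sum_div, ← Finset.mul_sum, Finset.sum_range_sub' fun i => (b i : ℝ)]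
    rw [h1]
    have h2 : (b 0 : ℝ) ≤ Y := by exact_mod_cast hbY 0
    have h3 : (0 : ℝ) ≤ b N := Nat.cast_nonneg _
    gcongr
    linarith
  have hsum : ∀ i ∈ Finset.range N,
      (∑ u ∈ s, if h u ∈ slotsBehind j (b (i + 1)) (b i) then F u i else 0) ≤
        c₀ + c₁ * v i + 2 * σ * (√(v i) + 1) := fun i hi =>
    hF i (Finset.mem_range.mp hi) _ _ (hbanti i) (hbY i)
  refine (Finset.sum_le_sum hsum).trans ?_
  have h1 : ∑ i ∈ Finset.range N, (c₀ + c₁ * v i + 2 * σ * (√(v i) + 1)) =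
      N * (c₀ + 2 * σ) + c₁ * ∑ i ∈ Finset.range N, v i +
        2 * σ * ∑ i ∈ Finset.range N, √(v i) := by
    simp only [Finset.sum_add_distrib, ← Finset.mul_sum, Finset.sum_const, Finset.card_range,
      nsmul_eq_mul]
    ring
  rw [h1]
  have h2 := (sum_sqrt_le N v hv0).trans
    (Real.sqrt_le_sqrt (mul_le_mul_of_nonneg_left hvs (Nat.cast_nonneg N)))
  gcongr

variable [DecidableEq U]

/-- In all dyadic time windows of length at least `2 ^ (a - K)` and all intervals of slots within
distance `Y` behind `j`, the surplus and the number of keys deviate little from the mean. -/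
def ChainGood (h : U → Fin n) (S : List (Op U)) (s : Finset U) (j : Fin n) (a K Y : ℕ) (σ : ℝ) :
    Prop :=
  ∀ k ∈ Finset.range (K + 1), ∀ i ∈ Finset.range (2 ^ k), ∀ y ∈ Finset.range (Y + 1),
    ∀ z ∈ Finset.range (Y + 1), y ≤ z →
      (∑ u ∈ s, if h u ∈ slotsBehind j y z then
          (net S u (i / 2 * 2 * 2 ^ (a - k)) (i * 2 ^ (a - k)) : ℝ) else 0) ≤
        1 + 2 * σ * (√((2 ^ (a - k) : ℕ) * (z - y) / n) + 1) ∧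
      (∑ u ∈ s, if h u ∈ slotsBehind j y z then
          (active S u (i * 2 ^ (a - k)) ((i + 1) * 2 ^ (a - k)) : ℝ) else 0) ≤
        (2 ^ (a - k) : ℕ) * (z - y) / n +
          2 * σ * (√((2 ^ (a - k) : ℕ) * (z - y) / n) + 1)

/-- This is the binary expansion of `t`: a digit `1` contributes one block of the corresponding
length, and a digit `0` an empty window. -/
theorem net_dyadic (S : List (Op U)) (u : U) (t a : ℕ) (ht : t < 2 ^ a) : ∀ K ≤ a,
    net S u 0 t = (∑ k ∈ Finset.range K, net S u (t / 2 ^ (a - (k + 1)) / 2 * 2 * 2 ^ (a - (k + 1)))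
      (t / 2 ^ (a - (k + 1)) * 2 ^ (a - (k + 1)))) + net S u (t / 2 ^ (a - K) * 2 ^ (a - K)) t := by
  intro K
  induction K with
  | zero =>
    intro _
    simp [Nat.div_eq_of_lt ht]
  | succ K ih =>
    intro hK
    rw [Finset.sum_range_succ, ih (by omega), add_assoc]
    congr 1
    have h1 : 2 ^ (a - K) = 2 * 2 ^ (a - (K + 1)) := by
      rw [← pow_succ']
      congr 1
      omega
    have h2 : t / 2 ^ (a - K) * 2 ^ (a - K) =
        t / 2 ^ (a - (K + 1)) / 2 * 2 * 2 ^ (a - (K + 1)) := by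
      rw [h1, mul_comm 2, ← Nat.div_div_eq_div_mul]
      ring
    rw [h2, net_consecutive]
    · exact Nat.mul_le_mul_right _ (Nat.div_mul_le_self _ _)
    · exact Nat.div_mul_le_self _ _

/-- The first sum comes from the `K` digits. Inside the finest block, net weight is bounded by
activity, which is not centred and contributes the mean `2 ^ a * Y / n / 2 ^ K`. -/
theorem ChainGood.surplus_le_aux {S : List (Op U)} {s : Finset U} {a K Y : ℕ} {σ : ℝ}
    (hc : ChainGood h S s j a K Y σ) (hS : Balanced S) (hs : ∀ op ∈ S, op.key ∈ s)
    (hσ : 0 ≤ σ) (ha : S.length < 2 ^ a) (hK : K ≤ a) {g : ℕ → ℕ} (hg : Antitone g)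
    (hgY : ∀ t, g t ≤ Y) :
    (surplus (fun w => behind j (h w)) g S : ℝ) ≤
      (∑ k ∈ Finset.range K, (2 ^ (k + 1) * (1 + 2 * σ) + 2 * σ * √(2 ^ a * Y / n))) +
        (2 ^ K * (2 * σ) + 2 ^ a * Y / n / 2 ^ K + 2 * σ * √(2 ^ a * Y / n)) := by
  set τ : ℕ → ℕ := fun y => ((Finset.range S.length).filter fun t => y ≤ g t).card with hτ
  have hτa : Antitone τ := fun y z hyz =>
    Finset.card_le_card (Finset.monotone_filter_right _ fun t _ ht => hyz.trans ht)
  have hτlt : ∀ y, τ y < 2 ^ a := fun y => by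
    refine lt_of_le_of_lt ?_ ha
    simpa using Finset.card_filter_le (Finset.range S.length) fun t => y ≤ g t
  have hτ0 : ∀ y, Y < y → τ y = 0 := fun y hy => by
    rw [hτ, Finset.card_eq_zero, Finset.filter_eq_empty_iff]
    intro t _
    have := hgY t
    omega
  have hpow : ∀ k ≤ a, 2 ^ k * 2 ^ (a - k) = 2 ^ a := fun k hk => by
    rw [← pow_add]
    congr 1
    omega
  have hlevel : ∀ k ≤ a, ∀ y, τ y < 2 ^ k * 2 ^ (a - k) := fun k hk y => by
    rw [hpow k hk]
    exact hτlt y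
  have hV : ∀ k ≤ a, ((2 ^ k : ℕ) : ℝ) * ((2 ^ (a - k) : ℕ) * Y / n) = 2 ^ a * Y / n := by
    intro k hk
    have : ((2 ^ k : ℕ) : ℝ) * (2 ^ (a - k) : ℕ) = 2 ^ a := by exact_mod_cast hpow k hk
    rw [← this]
    ring
  have hstep : ∀ u ∈ s, (net S u 0 (τ (behind j (h u))) : ℝ) ≤
      (∑ k ∈ Finset.range K, if behind j (h u) ≤ Y then
        (net S u (τ (behind j (h u)) / 2 ^ (a - (k + 1)) / 2 * 2 * 2 ^ (a - (k + 1)))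
          (τ (behind j (h u)) / 2 ^ (a - (k + 1)) * 2 ^ (a - (k + 1))) : ℝ) else 0) +
      if behind j (h u) ≤ Y then
        (active S u (τ (behind j (h u)) / 2 ^ (a - K) * 2 ^ (a - K))
          ((τ (behind j (h u)) / 2 ^ (a - K) + 1) * 2 ^ (a - K)) : ℝ) else 0 := by
    intro u _
    split_ifs with hu
    · rw [net_dyadic S u _ a (hτlt _) K hK]
      push_cast
      refine add_le_add le_rfl ?_
      refine Int.cast_le.mpr ((le_abs_self _).trans (hS.abs_net_le_active u le_rfl ?_))
      rw [Nat.add_mul, one_mul]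
      exact (Nat.lt_div_mul_add (Nat.pow_pos (by norm_num))).le
    · rw [hτ0 _ (by omega)]
      simp [net]
  rw [surplus_eq_sum_net _ hs hg]
  push_cast
  refine (Finset.sum_le_sum hstep).trans ?_
  rw [Finset.sum_add_distrib, Finset.sum_comm]
  refine add_le_add (Finset.sum_le_sum fun k hk => ?_) ?_
  · rw [Finset.mem_range] at hk
    have h1 := sum_level_le (h := h) (j := j) (s := s) hτa (l := 2 ^ (a - (k + 1)))
      (N := 2 ^ (k + 1)) (Y := Y) (Nat.pow_pos (by norm_num)) (hlevel _ (by omega))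
      (fun u i => (net S u (i / 2 * 2 * 2 ^ (a - (k + 1))) (i * 2 ^ (a - (k + 1))) : ℝ))
      (c₀ := 1) (c₁ := 0) le_rfl hσ (fun i hi y z hyz hz => by
        have := (hc (k + 1) (Finset.mem_range.mpr (by omega)) i (Finset.mem_range.mpr hi) y
          (Finset.mem_range.mpr (by omega)) z (Finset.mem_range.mpr (by omega)) hyz).1
        linarith)
    rw [hV _ (by omega)] at h1
    refine h1.trans (le_of_eq ?_)
    push_cast
    ring
  · have h1 := sum_level_le (h := h) (j := j) (s := s) hτa (l := 2 ^ (a - K))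
      (N := 2 ^ K) (Y := Y) (Nat.pow_pos (by norm_num)) (hlevel _ hK)
      (fun u i => (active S u (i * 2 ^ (a - K)) ((i + 1) * 2 ^ (a - K)) : ℝ))
      (c₀ := 0) (c₁ := 1) zero_le_one hσ (fun i hi y z hyz hz => by
        have := (hc K (Finset.mem_range.mpr (by omega)) i (Finset.mem_range.mpr hi) y
          (Finset.mem_range.mpr (by omega)) z (Finset.mem_range.mpr (by omega)) hyz).2
        linarith)
    rw [hV _ hK] at h1
    refine h1.trans (le_of_eq ?_)
    have h2 : ((2 ^ (a - K) : ℕ) : ℝ) * Y / n = 2 ^ a * Y / n / 2 ^ K := by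
      rw [← hV K hK]
      push_cast
      field_simp
    rw [h2]
    push_cast
    ring

/-- The number of scales for the chaining. -/
noncomputable def scales (V : ℝ) : ℕ := Nat.log 2 ⌊√V⌋₊

theorem two_pow_scales_le (V : ℝ) : (2 : ℝ) ^ scales V ≤ √V + 1 := by
  unfold scales
  by_cases h0 : ⌊√V⌋₊ = 0
  · rw [h0]
    simp
  · have h1 := Nat.pow_log_le_self 2 h0
    have h2 := Nat.floor_le (Real.sqrt_nonneg V)
    have h3 : ((2 ^ Nat.log 2 ⌊√V⌋₊ : ℕ) : ℝ) ≤ ⌊√V⌋₊ := by exact_mod_cast h1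
    push_cast at h3
    linarith

theorem div_two_pow_scales_le {V : ℝ} (hV : 0 ≤ V) : V / 2 ^ scales V ≤ 2 * √V := by
  have h1 : √V < 2 * 2 ^ scales V := by
    have h2 := Nat.lt_floor_add_one (√V)
    have h3 := Nat.lt_pow_succ_log_self (b := 2) (by norm_num) ⌊√V⌋₊
    have h4 : ((⌊√V⌋₊ + 1 : ℕ) : ℝ) ≤ ((2 ^ (Nat.log 2 ⌊√V⌋₊).succ : ℕ) : ℝ) := by
      exact_mod_cast h3
    push_cast [Nat.succ_eq_add_one, pow_succ] at h4
    unfold scales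
    linarith
  rw [div_le_iff₀ (by positivity)]
  nlinarith [Real.sq_sqrt hV, Real.sqrt_nonneg V]

theorem scales_le {V : ℝ} {a : ℕ} (hV : V ≤ 2 ^ a) : scales V ≤ a := by
  unfold scales
  have h1 : ⌊√V⌋₊ ≤ 2 ^ a := by
    refine Nat.floor_le_of_le ?_
    push_cast
    rw [Real.sqrt_le_left (by positivity)]
    have : (1 : ℝ) ≤ 2 ^ a := one_le_pow₀ (by norm_num)
    nlinarith
  exact (Nat.log_mono_right h1).trans (Nat.log_pow (by norm_num) a).le

/-- For `V = 2 ^ a * Y / n`, stopping at `2 ^ K` near `√V` balances the number of boxes against the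
remainder `V / 2 ^ K`. Each scale then costs at most a multiple of `σ * (√V + 1)`. -/
theorem ChainGood.surplus_le {S : List (Op U)} {s : Finset U} {a Y : ℕ} {σ : ℝ}
    (hc : ChainGood h S s j a (scales (2 ^ a * Y / n)) Y σ) (hS : Balanced S)
    (hs : ∀ op ∈ S, op.key ∈ s) (hσ : 1 ≤ σ) (ha : S.length < 2 ^ a) (hY : Y ≤ n)
    {g : ℕ → ℕ} (hg : Antitone g) (hgY : ∀ t, g t ≤ Y) :
    (surplus (fun w => behind j (h w)) g S : ℝ) ≤
      12 * σ * (scales (2 ^ a * Y / n) + 1) * (√(2 ^ a * Y / n) + 1) := by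
  have hn : (0 : ℝ) < n := Nat.cast_pos.mpr (NeZero.pos n)
  have hVa : (2 ^ a * Y / n : ℝ) ≤ 2 ^ a := by
    rw [div_le_iff₀ hn]
    have : (Y : ℝ) ≤ n := by exact_mod_cast hY
    gcongr
  have h1 := hc.surplus_le_aux hS hs (by linarith) ha (scales_le hVa) hg hgY
  set V : ℝ := 2 ^ a * Y / n
  have hV : 0 ≤ V := by positivity
  have h2 := two_pow_scales_le V
  have h3 := div_two_pow_scales_le hV
  have h4 := Real.sqrt_nonneg V
  have h5 : ∀ K : ℕ, ∑ k ∈ Finset.range K, (2 : ℝ) ^ (k + 1) ≤ 2 * 2 ^ K := by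
    intro K
    induction K with
    | zero => simp
    | succ K ih =>
      rw [Finset.sum_range_succ, pow_succ (2 : ℝ) K]
      linarith
  rw [Finset.sum_add_distrib, ← Finset.sum_mul, Finset.sum_const, Finset.card_range,
    nsmul_eq_mul] at h1
  have h6 := mul_le_mul_of_nonneg_right (h5 (scales V)) (by linarith : (0 : ℝ) ≤ 1 + 2 * σ)
  have hK : (0 : ℝ) ≤ scales V := Nat.cast_nonneg _
  have h7 : 0 ≤ σ * √V := by positivity
  have h8 : 0 ≤ scales V * (σ * √V) := by positivity
  have h9 : 0 ≤ scales V * σ := by positivity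
  have h10 : (2 : ℝ) ^ scales V * σ ≤ (√V + 1) * σ := by gcongr
  have h11 : √V ≤ σ * √V := le_mul_of_one_le_left h4 hσ
  have h12 : (2 : ℝ) ^ scales V ≤ σ * √V + σ := by linarith
  nlinarith

end Chaining

end OrderedProbing

/-! ### Union bounds and the exceptional events. -/

theorem measureReal_not_forall_le {Ω ι : Type*} [MeasurableSpace Ω] (P : Measure Ω)
    [IsProbabilityMeasure P] (s : Finset ι) (p : ι → Ω → Prop) (f : ι → ℝ)
    (hp : ∀ i ∈ s, P.real {ω | ¬ p i ω} ≤ f i) :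
    P.real {ω | ¬ ∀ i ∈ s, p i ω} ≤ ∑ i ∈ s, f i := by
  have h1 : {ω | ¬ ∀ i ∈ s, p i ω} = ⋃ i ∈ s, {ω | ¬ p i ω} := by
    ext ω
    simp
  rw [h1]
  exact (measureReal_biUnion_finset_le _ _).trans (Finset.sum_le_sum hp)

theorem measureReal_not_and_le {Ω : Type*} [MeasurableSpace Ω] (P : Measure Ω)
    [IsProbabilityMeasure P] (p q : Ω → Prop) {a b : ℝ} (hp : P.real {ω | ¬ p ω} ≤ a)
    (hq : P.real {ω | ¬ q ω} ≤ b) : P.real {ω | ¬ (p ω ∧ q ω)} ≤ a + b := by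
  have h1 : {ω | ¬ (p ω ∧ q ω)} = {ω | ¬ p ω} ∪ {ω | ¬ q ω} := by
    ext ω
    simp only [Set.mem_ofPred_eq, Set.mem_union]
    tauto
  rw [h1]
  exact (measureReal_union_le _ _).trans (add_le_add hp hq)

namespace OrderedProbing

section Events

variable {n : ℕ} [NeZero n] {U Ω : Type*} [DecidableEq U] [MeasurableSpace Ω] {P : Measure Ω}
  [IsProbabilityMeasure P] {h : Ω → U → Fin n}

/-- There are fewer than `2 * 2 ^ K` time blocks and at most `(Y + 1) ^ 2` intervals, with two
Bernstein events for each pair. -/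
theorem measureReal_not_chainGood_le (hh : IsUniformHash P h) {S : List (Op U)} (hS : Balanced S)
    {s : Finset U} (hs : ∀ op ∈ S, op.key ∈ s) (j : Fin n) (a K : ℕ) {Y : ℕ} (hY : Y ≤ n) {σ : ℝ}
    (hσ : 1 ≤ σ) :
    P.real {ω | ¬ ChainGood (h ω) S s j a K Y σ} ≤ 4 * 2 ^ K * (Y + 1) ^ 2 * Real.exp (-σ) := by
  have hn : (0 : ℝ) < n := Nat.cast_pos.mpr (NeZero.pos n)
  have hnet : ∀ (l : ℕ) (i y z : ℕ), y ≤ z → z ≤ Y →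
      P.real {ω | ¬ (∑ u ∈ s, if h ω u ∈ slotsBehind j y z then
          (net S u (i / 2 * 2 * l) (i * l) : ℝ) else 0) ≤
        1 + 2 * σ * (√(l * (z - y) / n) + 1)} ≤ Real.exp (-σ) ∧
      P.real {ω | ¬ (∑ u ∈ s, if h ω u ∈ slotsBehind j y z then
          (active S u (i * l) ((i + 1) * l) : ℝ) else 0) ≤
        l * (z - y) / n + 2 * σ * (√(l * (z - y) / n) + 1)} ≤ Real.exp (-σ) := by
    intro l i y z hyz hz
    have hcard : ((slotsBehind j y z).card : ℝ) = z - y := by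
      rw [slotsBehind, card_behind j y z (hz.trans hY), Nat.cast_sub hyz]
    have hzy : (0 : ℝ) ≤ z - y := by
      have : (y : ℝ) ≤ z := by exact_mod_cast hyz
      linarith
    have hzn : ((z : ℝ) - y) / n ≤ 1 := by
      rw [div_le_one hn]
      have h1 : (z : ℝ) ≤ n := by exact_mod_cast hz.trans hY
      have h2 : (0 : ℝ) ≤ y := Nat.cast_nonneg _
      linarith
    have hp : 0 ≤ ((z : ℝ) - y) / n := by positivity
    have hact : ∑ u ∈ s, (active S u (i * l) ((i + 1) * l) : ℝ) ≤ l := by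
      have h1 := sum_active_le S s (i * l) ((i + 1) * l)
      rw [Nat.add_mul, one_mul, Nat.add_sub_cancel_left] at h1
      have : (((∑ u ∈ s, active S u (i * l) ((i + 1) * l) : ℤ)) : ℝ) ≤ ((l : ℤ) : ℝ) := by
        rw [Nat.add_mul, one_mul]
        exact_mod_cast h1
      push_cast at this
      exact this
    have hact2 : ∑ u ∈ s, (active S u (i / 2 * 2 * l) (i * l) : ℝ) ≤ l := by
      have h1 := sum_active_le S s (i / 2 * 2 * l) (i * l)
      have h2 : i * l - i / 2 * 2 * l ≤ l := by
        rw [← Nat.sub_mul]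
        calc (i - i / 2 * 2) * l ≤ 1 * l := Nat.mul_le_mul_right _ (by omega)
          _ = l := one_mul l
      have : (((∑ u ∈ s, active S u (i / 2 * 2 * l) (i * l) : ℤ)) : ℝ) ≤ ((l : ℤ) : ℝ) := by
        refine Int.cast_le.mpr (h1.trans ?_)
        exact_mod_cast h2
      push_cast at this
      exact this
    constructor
    · refine le_trans (measureReal_mono ?_) (hh.measureReal_le s
        (fun u => (net S u (i / 2 * 2 * l) (i * l) : ℝ)) ?_ (slotsBehind j y z)
        (μ := 1) (v := l * (z - y) / n) ?_ ?_ hσ)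
      · intro ω hω
        exact (not_le.mp hω).le
      · intro u _
        exact_mod_cast hS.abs_net_le u _ _
      · rw [hcard]
        have h1 : ∑ u ∈ s, (net S u (i / 2 * 2 * l) (i * l) : ℝ) ≤ 1 := by
          exact_mod_cast hS.sum_net_le hs (i / 2 * 2 * l) (i * l)
        nlinarith
      · rw [hcard, mul_comm (l : ℝ), mul_div_right_comm]
        refine mul_le_mul_of_nonneg_left (le_trans (Finset.sum_le_sum fun u _ => ?_) hact2) hp
        have h1 := hS.abs_net_le u (i / 2 * 2 * l) (i * l)
        have h2 := hS.abs_net_le_active u (a := i / 2 * 2 * l) (b := i * l) le_rfl le_rfl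
        have h3 : net S u (i / 2 * 2 * l) (i * l) ^ 2 ≤
            active S u (i / 2 * 2 * l) (i * l) := by
          rw [← sq_abs]
          nlinarith [abs_nonneg (net S u (i / 2 * 2 * l) (i * l))]
        exact_mod_cast h3
    · refine le_trans (measureReal_mono ?_) (hh.measureReal_le s
        (fun u => (active S u (i * l) ((i + 1) * l) : ℝ)) ?_ (slotsBehind j y z)
        (μ := l * (z - y) / n) (v := l * (z - y) / n) ?_ ?_ hσ)
      · intro ω hω
        exact (not_le.mp hω).le
      · intro u _
        have h1 := active_nonneg S u (i * l) ((i + 1) * l)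
        have h2 := active_le_one S u (i * l) ((i + 1) * l)
        exact_mod_cast abs_le.mpr ⟨by omega, h2⟩
      · rw [hcard, mul_comm (l : ℝ), mul_div_right_comm]
        exact mul_le_mul_of_nonneg_left hact hp
      · rw [hcard, mul_comm (l : ℝ), mul_div_right_comm]
        refine mul_le_mul_of_nonneg_left (le_trans (Finset.sum_le_sum fun u _ => ?_) hact) hp
        have h1 := active_nonneg S u (i * l) ((i + 1) * l)
        have h2 := active_le_one S u (i * l) ((i + 1) * l)
        have h3 : active S u (i * l) ((i + 1) * l) ^ 2 ≤ active S u (i * l) ((i + 1) * l) := by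
          nlinarith
        exact_mod_cast h3
  have hsum : ∀ K : ℕ, ∑ k ∈ Finset.range (K + 1), (2 : ℝ) ^ k ≤ 2 * 2 ^ K := by
    intro K
    induction K with
    | zero => norm_num
    | succ K ih =>
      rw [Finset.sum_range_succ, pow_succ (2 : ℝ) K]
      linarith
  unfold ChainGood
  refine (measureReal_not_forall_le P _ _ _ fun k _ => measureReal_not_forall_le P _ _ _ fun i _ =>
    measureReal_not_forall_le P _ _ _ fun y hy => measureReal_not_forall_le P _ _
    (fun _ => Real.exp (-σ) + Real.exp (-σ)) fun z hz => ?_).trans ?_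
  · by_cases hyz : y ≤ z
    · simp only [hyz, true_imp_iff]
      have h1 := hnet (2 ^ (a - k)) i y z hyz (by have := Finset.mem_range.mp hz; omega)
      exact measureReal_not_and_le P _ _ h1.1 h1.2
    · simp only [hyz, false_imp_iff, not_true_eq_false]
      have : {ω : Ω | False} = ∅ := rfl
      rw [this, measureReal_empty]
      positivity
  · simp only [Finset.sum_const, Finset.card_range, nsmul_eq_mul, ← Finset.sum_mul]
    push_cast
    have h1 := mul_le_mul_of_nonneg_right (hsum K)
      (by positivity : 0 ≤ ((Y : ℝ) + 1) * ((Y + 1) * (Real.exp (-σ) + Real.exp (-σ))))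
    refine h1.trans (le_of_eq ?_)
    ring

/-- The exponent of a power of two that exceeds the length of `S`. -/
def width (S : List (Op U)) : ℕ := Nat.log 2 S.length + 1

theorem length_lt_two_pow_width (S : List (Op U)) : S.length < 2 ^ width S :=
  Nat.lt_pow_succ_log_self (by norm_num) _

theorem two_pow_width_le {S : List (Op U)} (hS : S ≠ []) : 2 ^ width S ≤ 2 * S.length := by
  unfold width
  rw [pow_succ']
  exact Nat.mul_le_mul_left 2 (Nat.pow_log_le_self 2 (List.length_pos_iff.mpr hS).ne')

/-- The conditions under which all path surpluses within distance `Y` are small. -/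
def SurplusGood (h : U → Fin n) (S : List (Op U)) (s : Finset U) (j : Fin n) (Y : ℕ) (σ : ℝ) :
    Prop :=
  S ≠ [] → ChainGood h S s j (width S) (scales (2 ^ width S * Y / n)) Y σ

theorem two_pow_width_mul_le {S : List (Op U)} (hS : S ≠ []) (Y : ℕ) :
    (2 ^ width S * Y / n : ℝ) ≤ 2 * S.length * Y / n := by
  have : ((2 ^ width S : ℕ) : ℝ) ≤ (2 * S.length : ℕ) := by exact_mod_cast two_pow_width_le hS
  push_cast at this
  gcongr

theorem SurplusGood.surplus_le {h : U → Fin n} {S : List (Op U)} {s : Finset U} {j : Fin n}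
    {Y k : ℕ} {σ : ℝ} (hc : SurplusGood h S s j Y σ) (hS : Balanced S)
    (hs : ∀ op ∈ S, op.key ∈ s) (hσ : 1 ≤ σ) (hY : Y ≤ n) (hYk : Y ≤ 2 ^ k) (hSn : S.length ≤ n)
    {g : ℕ → ℕ} (hg : Antitone g) (hgY : ∀ t, g t ≤ Y) :
    (surplus (fun w => behind j (h w)) g S : ℝ) ≤
      12 * σ * (k + 2) * (√(2 * S.length * Y / n) + 1) := by
  have hn : (0 : ℝ) < n := Nat.cast_pos.mpr (NeZero.pos n)
  by_cases h0 : S = []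
  · subst h0
    simp only [surplus, Int.cast_zero]
    positivity
  have hV := two_pow_width_mul_le (n := n) h0 Y
  have hk : scales (2 ^ width S * Y / n) ≤ k + 1 := by
    refine scales_le (hV.trans ?_)
    rw [div_le_iff₀ hn, pow_succ]
    have h1 : (Y : ℝ) ≤ 2 ^ k := by exact_mod_cast hYk
    have h2 : (S.length : ℝ) ≤ n := by exact_mod_cast hSn
    have : (S.length : ℝ) * Y ≤ n * 2 ^ k := by gcongr
    linarith
  refine ((hc h0).surplus_le hS hs hσ (length_lt_two_pow_width S) hY hg hgY).trans ?_
  have h1 : (scales (2 ^ width S * Y / n : ℝ) : ℝ) ≤ k + 1 := by exact_mod_cast hk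
  have h2 := Real.sqrt_le_sqrt hV
  have h3 : (0 : ℝ) ≤ scales (2 ^ width S * Y / n : ℝ) := Nat.cast_nonneg _
  have h4 := Real.sqrt_nonneg (2 ^ width S * Y / n : ℝ)
  exact mul_le_mul (mul_le_mul_of_nonneg_left (by linarith) (by positivity)) (by linarith)
    (by positivity) (by positivity)

theorem measureReal_not_surplusGood_le (hh : IsUniformHash P h) {S : List (Op U)}
    (hS : Balanced S) {s : Finset U} (hs : ∀ op ∈ S, op.key ∈ s) (hSn : S.length ≤ n) (j : Fin n)
    {Y : ℕ} (hY : Y ≤ n) {σ : ℝ} (hσ : 1 ≤ σ) :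
    P.real {ω | ¬ SurplusGood (h ω) S s j Y σ} ≤ 4 * (Y + 2) ^ 3 * Real.exp (-σ) := by
  have hn : (0 : ℝ) < n := Nat.cast_pos.mpr (NeZero.pos n)
  by_cases h0 : S = []
  · have : {ω | ¬ SurplusGood (h ω) S s j Y σ} = ∅ := by
      ext ω
      simp [SurplusGood, h0]
    rw [this, measureReal_empty]
    positivity
  have hV := two_pow_width_mul_le (n := n) h0 Y
  have h1 := measureReal_not_chainGood_le hh hS hs j (width S)
    (scales (2 ^ width S * Y / n : ℝ)) hY hσ
  simp only [SurplusGood, ne_eq, h0, not_false_eq_true, true_imp_iff]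
  refine h1.trans ?_
  have h2 : (2 : ℝ) ^ scales (2 ^ width S * Y / n : ℝ) ≤ Y + 2 := by
    refine (two_pow_scales_le _).trans ?_
    have : √(2 ^ width S * Y / n : ℝ) ≤ Y + 1 := by
      rw [Real.sqrt_le_left (by positivity)]
      refine hV.trans ?_
      rw [div_le_iff₀ hn]
      have h2 : (S.length : ℝ) ≤ n := by exact_mod_cast hSn
      have h3 : (0 : ℝ) ≤ Y := Nat.cast_nonneg _
      have h4 : 2 * (S.length : ℝ) * Y ≤ 2 * n * Y := by gcongr
      nlinarith [mul_nonneg hn.le (sq_nonneg (Y : ℝ))]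
    linarith
  calc 4 * 2 ^ scales (2 ^ width S * Y / n : ℝ) * ((Y : ℝ) + 1) ^ 2 * Real.exp (-σ)
      ≤ 4 * (Y + 2) * (Y + 2) ^ 2 * Real.exp (-σ) := by gcongr; norm_num
    _ = 4 * (Y + 2) ^ 3 * Real.exp (-σ) := by ring

theorem measureReal_not_windows_le (hh : IsUniformHash P h) {S : List (Op U)}
    (hS : Balanced S) {s : Finset U} (hs : ∀ op ∈ S, op.key ∈ s) (hSn : S.length ≤ n) (j : Fin n)
    {Y : ℕ} (hY : Y ≤ n) {σ : ℝ} (hσ : 1 ≤ σ) :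
    P.real {ω | ¬ ∀ S₁, S₁ <:+: S → SurplusGood (h ω) S₁ s j Y σ} ≤
      (S.length + 1) ^ 2 * (4 * (Y + 2) ^ 3 * Real.exp (-σ)) := by
  have h1 : P.real {ω | ¬ ∀ i ∈ Finset.range (S.length + 1), ∀ k ∈ Finset.range (S.length + 1),
      SurplusGood (h ω) ((S.drop i).take k) s j Y σ} ≤
      ∑ i ∈ Finset.range (S.length + 1), ∑ k ∈ Finset.range (S.length + 1),
        4 * (Y + 2) ^ 3 * Real.exp (-σ) := by
    refine measureReal_not_forall_le P _ _ _ fun i _ => measureReal_not_forall_le P _ _ _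
      fun k _ => ?_
    have hinf : (S.drop i).take k <:+: S :=
      (List.take_prefix k _).isInfix.trans (List.drop_suffix i S).isInfix
    exact measureReal_not_surplusGood_le hh (hS.infix hinf) (fun op hop => hs op (hinf.subset hop))
      (hinf.length_le.trans hSn) j hY hσ
  refine (measureReal_mono fun ω hω => ?_).trans (h1.trans (le_of_eq ?_))
  · simp only [Set.mem_ofPred_eq] at hω ⊢
    contrapose! hω
    rintro S₁ ⟨A, B, rfl⟩
    have := hω A.length (by simp) S₁.length (by simp; omega)
    simpa using this
  · simp only [Finset.sum_const, Finset.card_range, nsmul_eq_mul]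
    push_cast
    ring

theorem countP_eq_sum {A : List U} (hA : A.Nodup) (q : U → Prop) [DecidablePred q] :
    ((A.countP fun w => decide (q w)) : ℝ) = ∑ w ∈ A.toFinset, if q w then (1 : ℝ) else 0 := by
  rw [Finset.sum_boole, List.countP_eq_length_filter]
  congr 1
  rw [← List.toFinset_card_of_nodup (hA.filter _), List.toFinset_filter]
  simp

/-- Deviation parameter `σ = √y / (8 * x)`: the deviation `2 * σ * (√y + 1)` is at most `4 * σ * √y
= y / (2 * x)`, half of the expected gap `y / x`. -/
theorem measureReal_drift_le (hh : IsUniformHash P h) {A : List U} (hA : A.Nodup) {x : ℝ}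
    (hx : 0 < x) (hload : (A.length : ℝ) = (1 - 1 / x) * n) (j : Fin n) {y : ℕ} (hy : y ≤ n)
    (hyx : 8 * x ≤ √y) :
    P.real {ω | ¬ ((A.countP fun w => behind j (h ω w) ≤ y) : ℝ) ≤ y - y / (2 * x)} ≤
      Real.exp (-(√y / (8 * x))) := by
  have hn : (0 : ℝ) < n := Nat.cast_pos.mpr (NeZero.pos n)
  have hcard : ((slotsBehind j 0 y).card : ℝ) = y := by
    rw [slotsBehind, card_behind j 0 y hy, Nat.sub_zero]
  have hlen : (A.toFinset.card : ℝ) = (1 - 1 / x) * n := by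
    rw [List.toFinset_card_of_nodup hA, hload]
  have hy0 : (0 : ℝ) ≤ y := Nat.cast_nonneg _
  refine le_trans (measureReal_mono ?_) (hh.measureReal_le A.toFinset (fun _ => 1) (by simp)
    (slotsBehind j 0 y) (μ := y - y / x) (v := y) ?_ ?_ ((one_le_div (by positivity)).mpr hyx))
  · intro ω hω
    simp only [Set.mem_ofPred_eq, not_le] at hω ⊢
    rw [countP_eq_sum hA] at hω
    have h1 : (∑ u ∈ A.toFinset, if h ω u ∈ slotsBehind j 0 y then (1 : ℝ) else 0) =
        ∑ u ∈ A.toFinset, if behind j (h ω u) ≤ y then (1 : ℝ) else 0 := by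
      simp [mem_slotsBehind, behind_pos]
    rw [h1]
    refine le_trans ?_ hω.le
    have h2 : 1 ≤ √(y : ℝ) := by
      by_contra hlt
      push Not at hlt
      have h3 : (y : ℝ) < 1 := by
        rw [Real.sqrt_lt' one_pos] at hlt
        simpa using hlt
      have h4 : y = 0 := by
        have : y < 1 := by exact_mod_cast h3
        omega
      rw [h4] at hyx
      simp at hyx
      linarith
    have h3 : √(y : ℝ) * √y = y := Real.mul_self_sqrt hy0
    calc (y : ℝ) - y / x + 2 * (√y / (8 * x)) * (√y + 1)
        ≤ y - y / x + 2 * (√y / (8 * x)) * (√y + √y) := by gcongr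
      _ = y - y / x + (√y * √y) / (2 * x) := by field_simp; ring
      _ = y - y / (2 * x) := by rw [h3]; field_simp; ring
  · rw [Finset.sum_const, nsmul_eq_mul, mul_one, hlen, hcard]
    apply le_of_eq
    field_simp
  · rw [Finset.sum_const, nsmul_eq_mul, one_pow, mul_one, hlen, hcard]
    have h1 : (0 : ℝ) ≤ 1 / x := by positivity
    calc (y : ℝ) / n * ((1 - 1 / x) * n) = y * (1 - 1 / x) := by field_simp
      _ ≤ y * 1 := mul_le_mul_of_nonneg_left (by linarith) hy0
      _ = y := mul_one _

/-- Through `Consistent.exists_le_card` this bounds the initial displacements by about `n / 4`. The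
Bernstein parameter is `√n / 16`. -/
theorem measureReal_initial_le (hh : IsUniformHash P h) {A : List U}
    (hlen : A.length ≤ n) (hn16 : 16 ≤ √(n : ℝ)) :
    P.real {ω | ¬ ∀ b ∈ (Finset.univ : Finset (Fin n)), ∀ l ∈ Finset.range (n + 1),
      ((A.toFinset.filter fun w => dist b (h ω w) < l).card : ℝ) ≤ l + n / 4} ≤
      (n + 1) ^ 2 * Real.exp (-(√n / 16)) := by
  have hn : (0 : ℝ) < n := Nat.cast_pos.mpr (NeZero.pos n)
  refine (measureReal_not_forall_le P _ _ _ fun b _ => measureReal_not_forall_le P _ _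
    (fun _ => Real.exp (-(√n / 16))) fun l hl => ?_).trans ?_
  · have hl' : l ≤ n := by have := Finset.mem_range.mp hl; omega
    have hcard := card_dist_lt b l hl'
    have hAc : (A.toFinset.card : ℝ) ≤ n := by
      exact_mod_cast (List.toFinset_card_le A).trans hlen
    have hl0 : (0 : ℝ) ≤ l := Nat.cast_nonneg _
    have hmean : (l : ℝ) / n * A.toFinset.card ≤ l := by
      calc (l : ℝ) / n * A.toFinset.card ≤ l / n * n := by gcongr
        _ = l := div_mul_cancel₀ _ hn.ne'
    refine le_trans (measureReal_mono ?_) (hh.measureReal_le A.toFinset (fun _ => 1) (by simp)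
      (Finset.univ.filter fun c => dist b c < l) (μ := l) (v := n) ?_ ?_
      ((one_le_div (by norm_num)).mpr hn16))
    · intro ω hω
      simp only [Set.mem_ofPred_eq, not_le, Finset.mem_filter, Finset.mem_univ, true_and,
        Finset.sum_boole] at hω ⊢
      refine le_trans ?_ hω.le
      have h3 : √(n : ℝ) * √n = n := Real.mul_self_sqrt hn.le
      nlinarith
    · rw [Finset.sum_const, nsmul_eq_mul, mul_one, hcard]
      exact hmean
    · rw [Finset.sum_const, nsmul_eq_mul, one_pow, mul_one, hcard]
      refine hmean.trans ?_
      exact_mod_cast hl'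
  · simp only [Finset.sum_const, Finset.card_range, Finset.card_univ, Fintype.card_fin,
      nsmul_eq_mul]
    push_cast
    have := (Real.exp_pos (-(√(n : ℝ) / 16))).le
    nlinarith [mul_nonneg hn.le this]

end Events

/-! ### The path bound for the initial table and the whole workload. -/

section Deterministic

variable {n : ℕ} [NeZero n] {U : Type*} {h : U → Fin n} {j : Fin n}

/-- Dropping the boundary to `0` after `S₁` excludes all later operations, since `Y` is positive. -/
theorem exists_surplus_append {Y : U → ℕ} (hY : ∀ u, 0 < Y u) (S₁ S₂ : List (Op U)) :
    ∀ g : ℕ → ℕ, Antitone g → ∃ g' : ℕ → ℕ, Antitone g' ∧ (∀ t, g' t ≤ g t) ∧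
      surplus Y g' (S₁ ++ S₂) = surplus Y g S₁ := by
  have h0 : ∀ S : List (Op U), surplus Y (fun _ => 0) S = 0 := by
    intro S
    induction S with
    | nil => rfl
    | cons op S ih => simp [surplus, ih, (hY op.key).ne']
  induction S₁ with
  | nil =>
    exact fun g _ => ⟨fun _ => 0, antitone_const, fun _ => Nat.zero_le _, h0 _⟩
  | cons op S₁ ih =>
    intro g hg
    obtain ⟨g', hg', hle, heq⟩ := ih (fun t => g (t + 1)) fun s t hst => hg (by omega)
    refine ⟨prepend (g 0) g', prepend_antitone hg' ((hle 0).trans (hg (Nat.zero_le _))),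
      fun t => ?_, ?_⟩
    · cases t with
      | zero => exact le_rfl
      | succ t => exact hle t
    · change _ + surplus Y g' (S₁ ++ S₂) = _ + surplus Y _ S₁
      rw [heq]
      rfl

theorem sum_map_sgn (S : List (Op U)) :
    (S.map Op.sgn).sum = ∑ t ∈ Finset.Ico 0 S.length, opSgn S t := by
  rw [← Finset.range_eq_Ico]
  induction S with
  | nil => simp
  | cons op S ih =>
    rw [List.map_cons, List.sum_cons, List.length_cons, Finset.sum_range_succ', ih, add_comm]
    rfl

theorem sum_map_sgn_eq (S : List (Op U)) :
    (S.map Op.sgn).sum = 2 * (S.countP Op.isInsert : ℤ) - S.length := by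
  induction S with
  | nil => simp
  | cons op S ih =>
    rw [List.map_cons, List.sum_cons, ih, List.countP_cons, List.length_cons]
    cases op <;> simp [Op.sgn, Op.isInsert] <;> ring

variable [DecidableEq U]

/-- If the initial displacements and the surplus of all paths over time windows are small, then the
crossing number is bounded by the surplus of a path minus the number of resources that are initially
in its region. -/
theorem crossingNumber_le {x κ : ℝ} {A : List U} {S : List (Op U)} (hadm : Admissible n x κ A S)
    (hn : 8 ≤ n)
    (hinit : ∀ b ∈ (Finset.univ : Finset (Fin n)), ∀ l ∈ Finset.range (n + 1),
      ((A.toFinset.filter fun w => dist b (h w) < l).card : ℝ) ≤ l + n / 4)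
    {β : ℝ} (hβ : 0 ≤ β)
    (hwin : ∀ S₁, S₁ <:+: S → ∀ g : ℕ → ℕ, Antitone g → (∀ t, g t ≤ n) →
      (surplus (fun w => behind j (h w)) g S₁ : ℝ) ≤ β * S₁.length + n / x - 2) :
    ∃ g : ℕ → ℕ, Antitone g ∧ (∀ t, g t ≤ n) ∧
      (crossingNumber h A S j : ℝ) ≤ surplus (fun w => behind j (h w)) g S + β * S.length ∧
      ∃ z ≤ n, g 0 ≤ z ∧ (crossingNumber h A S j : ℝ) +
        (z - (A.countP fun w => behind j (h w) ≤ z : ℕ)) ≤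
          surplus (fun w => behind j (h w)) g S + β * S.length := by
  have hx := hadm.one_lt
  have hn0 : (0 : ℝ) < n := Nat.cast_pos.mpr (NeZero.pos n)
  have hx0 : (0 : ℝ) < n / x := by positivity
  have hload : (A.length : ℝ) = n - n / x := by
    rw [hadm.load]
    ring
  have hlen : A.length < n := by
    have : (A.length : ℝ) < n := by linarith
    exact_mod_cast this
  obtain ⟨hc, hT, hres⟩ := initialTable_spec (h := h) A hadm.nodup hlen.le
  have hfree : ∃ v, vacant (initialTable h A) v = true :=
    exists_vacant_of_resourcesUpTo_pos (h := h) (j := j) (y := n) (by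
      have := (hres j).1
      omega)
  -- Each of at most `(n + 1) / 2` insertions raises the maximal depth by at most one. Starting from
  -- `n / 4 + 1` it thus stays within `n`, as `8 ≤ n`.
  have hdepth : ∀ p, depth h (initialTable h A) p ≤ n / 4 + 1 := by
    intro p
    by_cases hp : depth h (initialTable h A) p = 0
    · omega
    · obtain ⟨b, l, hl, hle⟩ := hc.exists_le_card (s := A.toFinset) (by simp) hT hfree hp
      have h1 := hinit b (Finset.mem_univ b) l (Finset.mem_range.mpr (by omega))
      have h2 : ((l + depth h (initialTable h A) p : ℕ) : ℝ) ≤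
          (((A.toFinset.filter fun w => dist b (h w) < l).card + 1 : ℕ) : ℝ) := by
        exact_mod_cast hle
      push_cast at h2
      have h3 : ((4 * depth h (initialTable h A) p : ℕ) : ℝ) ≤ ((n + 4 : ℕ) : ℝ) := by
        push_cast
        linarith
      have h4 : 4 * depth h (initialTable h A) p ≤ n + 4 := by exact_mod_cast h3
      omega
  have hbal : Balanced S := ⟨⟨_, hadm.valid⟩, hadm.alternating⟩
  have hsum : ∀ S₁, S₁ <:+: S → (S₁.map Op.sgn).sum ≤ 1 := fun S₁ hS₁ => by
    rw [sum_map_sgn]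
    exact (abs_le.mp ((hbal.infix hS₁).abs_sum_opSgn_le _ _)).2
  have hcount : S.countP Op.isInsert ≤ (n + 1) / 2 := by
    have h1 := hsum S List.infix_rfl
    rw [sum_map_sgn_eq] at h1
    have h2 := hadm.length_upper
    omega
  have hc' : Consistent h (initialTable h A) {u | u ∈ A} (n / 4 + 1) :=
    ⟨hc.sorted, hc.existsUnique, hc.mem, hdepth⟩
  have hM : ((resourcesUpTo h (initialTable h A) j n : ℕ) : ℝ) = n / x := by
    have : ((resourcesUpTo h (initialTable h A) j n + A.length : ℕ) : ℝ) = n := by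
      exact_mod_cast (hres j).1
    push_cast at this
    linarith
  obtain ⟨S₁, S₂, rfl, g, hg, hgn, hle⟩ := exists_path (j := j) hx0 hβ S hc' (by omega) hadm.valid
    (fun S₁ u hS₁ => by
      -- By alternation the operations before an insertion have nonpositive total sign, so every
      -- insertion meets at least `n / x` resources.
      have h1 := hsum _ hS₁.isInfix
      rw [List.map_append, List.sum_append] at h1
      simp only [List.map_cons, List.map_nil, List.sum_cons, List.sum_nil, Op.sgn] at h1
      have h2 : (((S₁.map Op.sgn).sum : ℤ) : ℝ) ≤ 0 := by
        exact_mod_cast (by omega : (S₁.map Op.sgn).sum ≤ 0)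
      rw [hM]
      linarith) hwin
  obtain ⟨g', hg', hgle, hgeq⟩ := exists_surplus_append (Y := fun w => behind j (h w))
    (fun u => behind_pos j (h u)) S₁ S₂ g hg
  have hlenS : β * S₂.length ≤ β * (S₁ ++ S₂).length := by
    refine mul_le_mul_of_nonneg_left ?_ hβ
    rw [List.length_append]
    exact_mod_cast Nat.le_add_left _ _
  refine ⟨g', hg', fun t => (hgle t).trans (hgn t), ?_, ?_⟩
  · rw [hgeq]
    have : (0 : ℝ) ≤ resourcesUpTo h (initialTable h A) j (g 0) := Nat.cast_nonneg _
    unfold crossingNumber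
    linarith
  · obtain ⟨z, hz, hgz, hzle⟩ := (hres j).2 (g 0) (hgn 0)
    refine ⟨z, hz, (hgle 0).trans hgz, ?_⟩
    rw [hgeq]
    have h1 : (z : ℝ) ≤ resourcesUpTo h (initialTable h A) j (g 0) +
        (A.countP fun w => behind j (h w) ≤ z : ℕ) := by exact_mod_cast hzle
    unfold crossingNumber
    linarith

end Deterministic

/-! ### Measurability of the crossing number. -/

section Measurability

variable {n : ℕ} [NeZero n] {U : Type*}

/-- The items in the table are in `s`. -/
def SupportedIn (T : Table n U) (s : Set U) : Prop :=
  ∀ p w, T p = .key w ∨ T p = .tomb w → w ∈ s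

variable {h h' : U → Fin n} {s : Set U}

theorem belongsAt_congr {T : Table n U} (hT : SupportedIn T s) (hh : ∀ u ∈ s, h u = h' u) :
    belongsAt h T = belongsAt h' T := by
  funext a p
  unfold belongsAt
  split
  · rfl
  · rename_i w hw
    rw [hh w (hT p w (Or.inl hw))]
  · rename_i w hw
    rw [hh w (hT p w (Or.inr hw))]

theorem insertKey_congr {T : Table n U} (hT : SupportedIn T s) (hh : ∀ u ∈ s, h u = h' u) {u : U}
    (hu : u ∈ s) : insertKey h T u = insertKey h' T u := by
  unfold insertKey
  rw [belongsAt_congr hT hh, hh u hu]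
  congr 1
  funext q
  congr 1
  funext e
  congr 1
  split
  · rename_i v hv
    exact hh v (hT _ v (Or.inr hv))
  · rfl

variable [DecidableEq U]

theorem SupportedIn.step {T : Table n U} (hT : SupportedIn T s) {op : Op U} (hop : op.key ∈ s) :
    SupportedIn (step h T op) s := by
  cases op with
  | insert u =>
    unfold OrderedProbing.step
    rcases hi : insertKey h T u with _ | ⟨T', k⟩
    · simpa [hi] using hT
    · obtain ⟨b, v, -, -, -, -, rfl, -⟩ := insertKey_spec hi
      intro p w hw
      simp only [hi, Option.map_some, Option.getD_some, shiftInsert] at hw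
      split_ifs at hw
      · simp only [Slot.key.injEq, or_false] at hw
        rw [← hw]
        exact hop
      · exact hT _ w hw
      · exact hT _ w hw
  | delete u =>
    intro p w hw
    simp only [OrderedProbing.step, deleteKey] at hw
    split at hw
    · rename_i v hv
      split_ifs at hw
      · simp only [Slot.tomb.injEq, false_or] at hw
        rw [← hw]
        exact hop
      · simp only [Slot.key.injEq, or_false] at hw
        rw [← hw]
        exact hT p v (Or.inl hv)
    · exact hT p w hw

theorem step_congr {T : Table n U} (hT : SupportedIn T s) (hh : ∀ u ∈ s, h u = h' u) {op : Op U}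
    (hop : op.key ∈ s) : step h T op = step h' T op := by
  cases op with
  | insert u => simp only [step, insertKey_congr (u := u) hT hh hop]
  | delete u => rfl

theorem crossingsFrom_congr (hh : ∀ u ∈ s, h u = h' u) (j : Fin n) (S : List (Op U)) :
    (∀ op ∈ S, op.key ∈ s) → ∀ {T : Table n U}, SupportedIn T s →
      crossingsFrom h j T S = crossingsFrom h' j T S := by
  induction S with
  | nil => intros; rfl
  | cons op S ih =>
    intro hS T hT
    have hop := hS op (by simp)
    have h1 : crossing h j T op = crossing h' j T op := by
      cases op with
      | insert u => simp only [crossing, insertKey_congr (u := u) hT hh hop, hh u hop]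
      | delete u => rfl
    rw [crossingsFrom, crossingsFrom, h1, step_congr hT hh hop]
    congr 1
    refine ih (fun op' hop' => hS op' (List.mem_cons_of_mem _ hop')) ?_
    rw [← step_congr hT hh hop]
    exact hT.step hop

theorem foldl_step_congr (hh : ∀ u ∈ s, h u = h' u) (S : List (Op U)) :
    (∀ op ∈ S, op.key ∈ s) → ∀ {T : Table n U}, SupportedIn T s →
      S.foldl (step h) T = S.foldl (step h') T ∧ SupportedIn (S.foldl (step h) T) s := by
  induction S with
  | nil => exact fun _ T hT => ⟨rfl, hT⟩
  | cons op S ih =>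
    intro hS T hT
    have hop := hS op (by simp)
    rw [List.foldl_cons, List.foldl_cons, ← step_congr hT hh hop]
    exact ih (fun op' hop' => hS op' (List.mem_cons_of_mem _ hop')) (hT.step hop)

theorem crossingNumber_congr (hh : ∀ u ∈ s, h u = h' u) {A : List U} {S : List (Op U)}
    (hA : ∀ u ∈ A, u ∈ s) (hS : ∀ op ∈ S, op.key ∈ s) (j : Fin n) :
    crossingNumber h A S j = crossingNumber h' A S j := by
  have h1 := foldl_step_congr hh (A.map Op.insert)
    (fun op hop => by
      obtain ⟨u, hu, rfl⟩ := List.mem_map.mp hop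
      exact hA u hu) (T := fun _ => .free) (by intro p w hw; simp at hw)
  unfold crossingNumber initialTable
  rw [← h1.1]
  exact crossingsFrom_congr hh j S hS h1.2

/-- Only the hashes of the finitely many keys in `A` and `S` matter, so the crossing number factors
through a finite space. -/
theorem measurable_crossingNumber {Ω : Type*} [MeasurableSpace Ω] {h : Ω → U → Fin n}
    (hh : ∀ u, Measurable fun ω => h ω u) (A : List U) (S : List (Op U)) (j : Fin n) :
    Measurable fun ω => crossingNumber (h ω) A S j := by
  set s : Finset U := A.toFinset ∪ (S.map Op.key).toFinset with hs
  let G : (s → Fin n) → ℕ := fun f =>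
    crossingNumber (fun u => if hu : u ∈ s then f ⟨u, hu⟩ else 0) A S j
  have hG : (fun ω => crossingNumber (h ω) A S j) = G ∘ fun ω (u : s) => h ω u := by
    funext ω
    refine crossingNumber_congr (s := s) (fun u hu => ?_) (fun u hu => ?_) (fun op hop => ?_) j
    · have hu' : u ∈ s := hu
      simp [hu']
    · simp [hs, hu]
    · simp only [hs, Finset.coe_union, List.coe_toFinset, Set.mem_union, Set.mem_ofPred_eq]
      exact Or.inr (List.mem_map_of_mem hop)
  rw [hG]
  exact (measurable_of_finite G).comp (measurable_pi_lambda _ fun u => hh u)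

end Measurability

/-! ### Comparisons between logarithms and powers. -/

section Analysis

open Filter

theorem eventually_mul_log_pow_le (C : ℝ) (k : ℕ) :
    ∀ᶠ t : ℝ in atTop, C * Real.log t ^ k ≤ √√t := by
  have hs : Tendsto (fun t : ℝ => √√t) atTop atTop :=
    Real.tendsto_sqrt_atTop.comp Real.tendsto_sqrt_atTop
  have h1 : ∀ᶠ s : ℝ in atTop, |C| * 4 ^ k * Real.log s ^ k ≤ s := by
    have h2 := (Real.isLittleO_pow_log_id_atTop (n := k)).bound
      (show (0 : ℝ) < (|C| * 4 ^ k + 1)⁻¹ by positivity)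
    filter_upwards [h2, eventually_ge_atTop 1] with s hs hs1
    have h0 : 0 ≤ Real.log s ^ k := pow_nonneg (Real.log_nonneg hs1) k
    rw [Real.norm_of_nonneg h0, id, Real.norm_of_nonneg (by linarith), inv_mul_eq_div,
      le_div_iff₀ (by positivity)] at hs
    nlinarith
  filter_upwards [hs.eventually h1, eventually_ge_atTop 1] with t ht ht1
  rw [Real.log_sqrt (Real.sqrt_nonneg t), Real.log_sqrt (by linarith)] at ht
  have h3 : |C| * 4 ^ k * (Real.log t / 2 / 2) ^ k = |C| * Real.log t ^ k := by
    rw [mul_assoc, ← mul_pow]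
    congr 2
    ring
  rw [h3] at ht
  refine le_trans ?_ ht
  exact mul_le_mul_of_nonneg_right (le_abs_self C) (pow_nonneg (Real.log_nonneg ht1) k)

/-- What is needed of a large threshold `r`. -/
structure Large (κ c b r : ℝ) : Prop where
  three_le : 3 ≤ r
  inv_le : 1 / κ ≤ r
  one_le_log : 1 ≤ Real.log r
  sq_le : 145800 * (b * Real.log r) ^ 2 ≤ r
  le_log : 2 * 4 ^ 5 * 10 ^ 10 * b ^ 4 ≤ Real.log r
  pow_le : 2 * 10 ^ 10 * (b * Real.log r) ^ 4 ≤ √r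
  sixteen_le : 256 ≤ r
  log_le : 16 * (4 + c) * Real.log r ≤ √r
  sq_log_le : 180 * b * Real.log r ^ 2 + 2 ≤ √√r

theorem sqrt_sqrt_le {r : ℝ} (hr : 1 ≤ r) : √√r ≤ √r := by
  refine Real.sqrt_le_sqrt ?_
  rw [Real.sqrt_le_left (by linarith)]
  nlinarith

theorem sqrt_le_self {r : ℝ} (hr : 1 ≤ r) : √r ≤ r := by
  rw [Real.sqrt_le_left (by linarith)]
  nlinarith

theorem eventually_large (κ c b : ℝ) : ∀ᶠ r : ℝ in atTop, Large κ c b r := by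
  filter_upwards [eventually_ge_atTop 256, eventually_ge_atTop (1 / κ),
    Real.tendsto_log_atTop.eventually (eventually_ge_atTop 1),
    Real.tendsto_log_atTop.eventually (eventually_ge_atTop (2 * 4 ^ 5 * 10 ^ 10 * b ^ 4)),
    eventually_mul_log_pow_le (145800 * b ^ 2) 2,
    eventually_mul_log_pow_le (2 * 10 ^ 10 * b ^ 4) 4,
    eventually_mul_log_pow_le (16 * (4 + c)) 1,
    eventually_mul_log_pow_le (180 * b + 2) 2] with r h1 h2 h3 h4 h5 h6 h7 h8
  have hr : 1 ≤ r := by linarith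
  have hs1 := sqrt_sqrt_le hr
  have hs2 := sqrt_le_self hr
  refine ⟨by linarith, h2, h3, ?_, h4, ?_, h1, ?_, ?_⟩
  · rw [mul_pow]
    linarith
  · rw [mul_pow]
    linarith
  · rw [pow_one] at h7
    linarith
  · have : 1 ≤ Real.log r ^ 2 := one_le_pow₀ h3
    nlinarith

/-- Write `√y = q * s ^ 2` with `s ≥ 1`; then `log y ≤ L + 4 * s`. The bracket is at most `45 * L *
s`, where `45 = 1 + 4 + 8 + 32`, and `145800 = 72 * 45 ^ 2`. -/
theorem log_sq_le_sqrt {x L q y : ℝ} (hx : 0 < x) (hL : 1 ≤ L) (hq : q = 145800 * x * L ^ 2)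
    (hqL : Real.log (q ^ 2) ≤ L) (hq1 : 1 ≤ q) (hy : q ^ 2 ≤ y) :
    72 * x * (L + 4 + 8 * Real.log y) ^ 2 ≤ √y := by
  have hq0 : 0 < q := by linarith
  have hy0 : 0 < y := lt_of_lt_of_le (by positivity) hy
  have hqy : q ≤ √y := Real.le_sqrt_of_sq_le hy
  set s : ℝ := √(√y / q) with hs
  have hs1 : 1 ≤ s := Real.one_le_sqrt.mpr ((one_le_div hq0).mpr hqy)
  have hs2 : q * s ^ 2 = √y := by
    rw [hs, Real.sq_sqrt (by positivity)]
    field_simp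
  have hy4 : y = q ^ 2 * s ^ 4 := by
    calc y = √y ^ 2 := (Real.sq_sqrt hy0.le).symm
      _ = q ^ 2 * s ^ 4 := by rw [← hs2]; ring
  have hlog : Real.log y ≤ L + 4 * s := by
    rw [hy4, Real.log_mul (by positivity) (by positivity), Real.log_pow s]
    have := Real.log_le_self (by linarith : 0 ≤ s)
    push_cast
    linarith
  have hlog0 : 0 ≤ Real.log y := Real.log_nonneg (by nlinarith)
  have h1 : L + 4 + 8 * Real.log y ≤ 45 * (L * s) := by nlinarith
  calc 72 * x * (L + 4 + 8 * Real.log y) ^ 2 ≤ 72 * x * (45 * (L * s)) ^ 2 := by gcongr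
    _ = q * s ^ 2 := by rw [hq]; ring
    _ = √y := hs2

theorem clog_le (y : ℕ) (hy : 1 ≤ y) : (Nat.clog 2 y : ℝ) ≤ 1 + 2 * Real.log y ∧
    2 ^ Nat.clog 2 y ≤ 2 * y := by
  have h1 : 2 ^ Nat.clog 2 y ≤ 2 * y := by
    rcases hy.eq_or_lt with rfl | hy
    · simp
    · have h2 := Nat.pow_pred_clog_lt_self (b := 2) (by norm_num) hy
      have h3 : Nat.clog 2 y ≠ 0 := (Nat.clog_pos (by norm_num) hy).ne'
      obtain ⟨k, hk⟩ := Nat.exists_eq_succ_of_ne_zero h3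
      rw [hk] at h2 ⊢
      rw [Nat.pred_succ] at h2
      rw [pow_succ]
      omega
  refine ⟨?_, h1⟩
  have hy0 : (0 : ℝ) < y := by exact_mod_cast hy
  have h2 : ((2 ^ Nat.clog 2 y : ℕ) : ℝ) ≤ ((2 * y : ℕ) : ℝ) := by exact_mod_cast h1
  push_cast at h2
  have h3 := Real.log_le_log (by positivity) h2
  rw [Real.log_pow, Real.log_mul (by norm_num) hy0.ne'] at h3
  have h4 := Real.log_two_gt_d9
  have h5 : 0 ≤ Real.log y := Real.log_nonneg (by exact_mod_cast hy)
  have h6 : (0 : ℝ) ≤ Nat.clog 2 y := Nat.cast_nonneg _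
  by_contra hlt
  push Not at hlt
  nlinarith

/-- The exponent `5` is needed here. If `r ≤ x ^ 4`, then `log r ≤ 4 * log x`, and `hR` provides
five logarithms of `r`: four are wanted, and the fifth beats the constants. Otherwise `R ≤ x ≤ √r`,
which leaves a factor `√r` to spare. -/
theorem mul_pow_le {b r x R : ℝ} {κ c : ℝ} (hb : 1 ≤ b) (hr : Large κ c b r) (hx : 1 < x)
    (hR0 : 0 ≤ R) (hRx : R ≤ x) (hR : R * Real.log x ^ 5 ≤ r) :
    10 ^ 10 * (b * Real.log r) ^ 4 * (R + 1) ≤ r := by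
  have hlr := hr.one_le_log
  have h3 := hr.three_le
  have hp := hr.pow_le
  have hs : √r * √r = r := Real.mul_self_sqrt (by linarith)
  have hs1 : 1 ≤ √r := Real.one_le_sqrt.mpr (by linarith)
  have hL : 0 ≤ (b * Real.log r) ^ 4 := by positivity
  rcases le_total r (x ^ 4) with hrx | hrx
  · have h1 : Real.log r ≤ 4 * Real.log x := by
      have := Real.log_le_log (by linarith) hrx
      rwa [Real.log_pow] at this
    have h2 : R * (Real.log r / 4) ^ 5 ≤ r := by
      refine le_trans (mul_le_mul_of_nonneg_left ?_ hR0) hR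
      exact pow_le_pow_left₀ (by positivity) (by linarith) 5
    have h4 := hr.le_log
    have h5 : 2 * (10 ^ 10 * (b * Real.log r) ^ 4 * R) ≤ r := by
      refine le_trans ?_ h2
      have h6 : 0 ≤ R * Real.log r ^ 4 := by positivity
      have h7 := mul_le_mul_of_nonneg_left h4 h6
      have h8 : 2 * (10 ^ 10 * (b * Real.log r) ^ 4 * R) * 4 ^ 5 ≤
          R * (Real.log r / 4) ^ 5 * 4 ^ 5 := by
        calc 2 * (10 ^ 10 * (b * Real.log r) ^ 4 * R) * 4 ^ 5
            = R * Real.log r ^ 4 * (2 * 4 ^ 5 * 10 ^ 10 * b ^ 4) := by ring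
          _ ≤ R * Real.log r ^ 4 * Real.log r := h7
          _ = R * (Real.log r / 4) ^ 5 * 4 ^ 5 := by ring
      linarith
    have h9 : √r ≤ r := sqrt_le_self (by linarith)
    linarith
  · have h1 : R ≤ √r := by
      refine hRx.trans (Real.le_sqrt_of_sq_le (le_trans ?_ hrx))
      exact pow_le_pow_right₀ hx.le (by norm_num)
    calc 10 ^ 10 * (b * Real.log r) ^ 4 * (R + 1)
        ≤ 10 ^ 10 * (b * Real.log r) ^ 4 * (√r + √r) := by gcongr
      _ = 2 * 10 ^ 10 * (b * Real.log r) ^ 4 * √r := by ring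
      _ ≤ √r * √r := by gcongr
      _ = r := hs

end Analysis

/-! ### Surplus bounds on the good events. -/

section Bounds

variable {n : ℕ} [NeZero n] {U : Type*} [DecidableEq U]

/-- Chaining is applied at the least power of two that is at least `g 0`, so that the bound adapts
to the extent of the path. -/
theorem surplus_le_of_good {h : U → Fin n} {j : Fin n} {S : List (Op U)} {s : Finset U} {L : ℝ}
    (hS : Balanced S) (hs : ∀ op ∈ S, op.key ∈ s) (hL : 2 ≤ L) (hSn : S.length ≤ n)
    (hgood : ∀ k ∈ Finset.range (Nat.clog 2 n + 1),
      SurplusGood h S s j (min (2 ^ k) n) (L + 4 * k))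
    {g : ℕ → ℕ} (hg : Antitone g) (hgn : ∀ t, g t ≤ n) {y : ℕ} (hy : y = max (g 0) 1) :
    (surplus (fun w => behind j (h w)) g S : ℝ) ≤
      12 * (L + 4 + 8 * Real.log y) ^ 2 * (2 * √(S.length * y / n) + 1) := by
  have hn : (0 : ℝ) < n := Nat.cast_pos.mpr (NeZero.pos n)
  have hy1 : 1 ≤ y := by omega
  have hyn : y ≤ n := by
    have := hgn 0
    have := NeZero.pos n
    omega
  obtain ⟨hk1, hk2⟩ := clog_le y hy1
  set k := Nat.clog 2 y with hk
  have hyk : y ≤ 2 ^ k := Nat.le_pow_clog (by norm_num) y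
  have hkn : k ≤ Nat.clog 2 n := Nat.clog_mono_right 2 hyn
  have h1 := (hgood k (Finset.mem_range.mpr (by omega))).surplus_le hS hs (k := k)
    (by have : (0 : ℝ) ≤ k := Nat.cast_nonneg _
        linarith) (min_le_right _ _) (min_le_left _ _) hSn hg
    (fun t => (hg (Nat.zero_le t)).trans (le_min (by omega) (hgn 0)))
  have hk0 : (0 : ℝ) ≤ k := Nat.cast_nonneg _
  have hlog : 0 ≤ Real.log y := Real.log_nonneg (by exact_mod_cast hy1)
  have h2 : √(2 * S.length * (min (2 ^ k) n : ℕ) / n : ℝ) ≤ 2 * √(S.length * y / n) := by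
    have h3 : ((min (2 ^ k) n : ℕ) : ℝ) ≤ 2 * y := by
      exact_mod_cast (min_le_left _ _).trans hk2
    have h4 : (2 : ℝ) = √4 := by
      rw [show (4 : ℝ) = 2 ^ 2 by norm_num, Real.sqrt_sq (by norm_num)]
    conv_rhs => rw [h4]
    rw [← Real.sqrt_mul (by norm_num)]
    refine Real.sqrt_le_sqrt ?_
    calc 2 * (S.length : ℝ) * (min (2 ^ k) n : ℕ) / n ≤ 2 * S.length * (2 * y) / n := by gcongr
      _ = 4 * (S.length * y / n) := by ring
  refine h1.trans ?_
  have h5 : 12 * (L + 4 * k) * (k + 2) ≤ 12 * (L + 4 + 8 * Real.log y) ^ 2 := by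
    have h6 : L + 4 * k ≤ L + 4 + 8 * Real.log y := by linarith
    have h7 : (k : ℝ) + 2 ≤ L + 4 + 8 * Real.log y := by linarith
    rw [mul_assoc, sq]
    exact mul_le_mul_of_nonneg_left (mul_le_mul h6 h7 (by linarith) (by linarith)) (by norm_num)
  exact mul_le_mul h5 (by linarith) (by positivity) (by positivity)

theorem window_surplus_le {h : U → Fin n} {j : Fin n} {S : List (Op U)} {s : Finset U} {b : ℝ}
    (hS : Balanced S) (hs : ∀ op ∈ S, op.key ∈ s) (hb : 1 ≤ b) (hn1 : 1 ≤ Real.log n)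
    (hSn : S.length ≤ n) (hgood : SurplusGood h S s j n (b * Real.log n))
    {g : ℕ → ℕ} (hg : Antitone g) (hgn : ∀ t, g t ≤ n) :
    (surplus (fun w => behind j (h w)) g S : ℝ) ≤
      60 * b * Real.log n ^ 2 * (√(2 * S.length) + 1) := by
  have hn : (0 : ℝ) < n := Nat.cast_pos.mpr (NeZero.pos n)
  have h1 := hgood.surplus_le hS hs (k := Nat.clog 2 n) (by nlinarith) le_rfl
    (Nat.le_pow_clog (by norm_num) n) hSn hg hgn
  rw [mul_div_cancel_right₀ _ hn.ne'] at h1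
  refine h1.trans (mul_le_mul_of_nonneg_right ?_ (by positivity))
  have h2 := (clog_le n (NeZero.pos n)).1
  have h3 : (Nat.clog 2 n : ℝ) + 2 ≤ 5 * Real.log n := by linarith
  calc 12 * (b * Real.log n) * (Nat.clog 2 n + 2)
      ≤ 12 * (b * Real.log n) * (5 * Real.log n) := by gcongr
    _ = 60 * b * Real.log n ^ 2 := by ring

end Bounds

/-! ### The deterministic bound on the good events. -/

section Tail

variable {n : ℕ} [NeZero n] {U : Type*} [DecidableEq U] {x κ c b r : ℝ} {A : List U}
  {S : List (Op U)}

theorem rate_eq (hx : 0 ≤ x) (m : ℕ) : √((m : ℝ) / n * x ^ 2) = √((m : ℝ) / n) * x := by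
  rw [Real.sqrt_mul (by positivity), Real.sqrt_sq hx]

theorem Admissible.kappa_mul_le (hadm : Admissible n x κ A S) :
    κ * x ≤ √((S.length : ℝ) / n * x ^ 2) ^ 2 := by
  have hn : (0 : ℝ) < n := Nat.cast_pos.mpr (NeZero.pos n)
  have hx : 0 < x := by linarith [hadm.one_lt]
  rw [Real.sq_sqrt (by positivity)]
  calc κ * x = κ * (n / x) / n * x ^ 2 := by field_simp
    _ ≤ S.length / n * x ^ 2 := by
      have := hadm.length_lower
      gcongr

/-- The lower bound on `|S|` gives `κ * x` at most the square of the rate. So `x` is polynomial in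
`r`, and logarithms of `x` are bounded by multiples of `log r`. -/
theorem Admissible.load_le (hadm : Admissible n x κ A S) (hκ : 0 < κ) (hr : Large κ c b r)
    (hR : √((S.length : ℝ) / n * x ^ 2) * Real.log x ^ 5 ≤ r) : x ≤ r ^ 3 := by
  have h1 := Admissible.kappa_mul_le hadm
  have hr3 := hr.three_le
  have hx := hadm.one_lt
  set R := √((S.length : ℝ) / n * x ^ 2)
  have hR0 : 0 ≤ R := Real.sqrt_nonneg _
  rcases le_total 1 (Real.log x) with hl | hl
  · have h2 : R ≤ r := by
      refine le_trans ?_ hR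
      exact le_mul_of_one_le_right hR0 (one_le_pow₀ hl)
    have h3 : κ * x ≤ r ^ 2 := h1.trans (pow_le_pow_left₀ hR0 h2 2)
    have h4 : 1 ≤ r * κ := (div_le_iff₀ hκ).mp hr.inv_le
    calc x = 1 * x := (one_mul x).symm
      _ ≤ r * κ * x := by gcongr
      _ = r * (κ * x) := by ring
      _ ≤ r * r ^ 2 := by gcongr
      _ = r ^ 3 := by ring
  · have h2 : x ≤ Real.exp 1 := by
      rw [← Real.log_le_iff_le_exp (by linarith)]
      exact hl
    have h3 := Real.exp_one_lt_d9
    have h4 : r ≤ r ^ 3 := le_self_pow₀ (by linarith) (by norm_num)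
    linarith

/-- The slope `β` which makes paths over time windows lose against `n / x` resources. -/
theorem exists_window_rate {n x m ρ b r L Q R κ c : ℝ} (hn0 : 0 < n) (hx0 : 0 < x)
    (hρ0 : 0 ≤ ρ) (hρ1 : ρ ≤ 1) (hρ2 : ρ * ρ = m / n) (hRdef : R = ρ * x) (hb : 1 ≤ b)
    (hr : Large κ c b r) (hn : Large κ c b n) (hxr : x ≤ r ^ 3) (hrm : r ≤ m)
    (hLdef : L = b * Real.log r) (hQ : Q = 24000 * L ^ 2) (hkey : 10 ^ 10 * L ^ 4 * (R + 1) ≤ r)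
    (hL4 : 1 ≤ L ^ 2) (hL24 : L ^ 2 ≤ L ^ 4) :
    ∃ β : ℝ, 0 ≤ β ∧ β * m ≤ Q ^ 2 * R ∧ ∀ w, 0 ≤ w → w ≤ n →
      60 * b * Real.log n ^ 2 * (√(2 * w) + 1) ≤ β * w + n / x - 2 := by
  have hR0 : 0 ≤ R := by
    rw [hRdef]
    positivity
  have hQ0 : 0 ≤ Q := by
    rw [hQ]
    positivity
  have hL40 : 1 ≤ L ^ 4 := hL4.trans hL24
  have hr3 := hr.three_le
  have hlr := hr.one_le_log
  rcases le_total (n : ℝ) (r ^ 20) with hnr | hnr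
  · have hlogn : Real.log n ≤ 20 * Real.log r := by
      have := Real.log_le_log hn0 hnr
      rwa [Real.log_pow] at this
    have hlogn0 := hn.one_le_log
    have hPQ : 60 * b * Real.log n ^ 2 ≤ Q := by
      calc 60 * b * Real.log n ^ 2 ≤ 60 * b * (20 * Real.log r) ^ 2 := by gcongr
        _ = 24000 * (b * Real.log r ^ 2) := by ring
        _ ≤ 24000 * (b ^ 2 * Real.log r ^ 2) := by
          gcongr
          nlinarith
        _ = Q := by
          rw [hQ, hLdef]
          ring
    -- Otherwise `m ≤ ρ * n ≤ 2 * (Q + 2) * R`, which `hkey` makes smaller than `r ≤ m`.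
    have hnx : Q + 2 ≤ n / (2 * x) := by
      by_contra hlt
      rw [not_le, div_lt_iff₀ (by positivity)] at hlt
      have h1 : m = ρ * ρ * n := by
        rw [hρ2]
        field_simp
      have h2 : m ≤ ρ * n := by
        rw [h1]
        have : ρ * ρ ≤ ρ * 1 := mul_le_mul_of_nonneg_left hρ1 hρ0
        nlinarith
      have h3 : m ≤ 2 * (Q + 2) * R := by
        refine h2.trans ((mul_le_mul_of_nonneg_left hlt.le hρ0).trans (le_of_eq ?_))
        rw [hRdef]
        ring
      have h4 : 2 * (Q + 2) * R ≤ 48004 * (L ^ 4 * R) := by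
        rw [hQ]
        have : L ^ 2 * R ≤ L ^ 4 * R := mul_le_mul_of_nonneg_right hL24 hR0
        have : R ≤ L ^ 4 * R := le_mul_of_one_le_left hR0 hL40
        linarith
      linarith
    -- By the inequality of arithmetic and geometric means, `Q * √(2 * w) ≤ Q ^ 2 * x / n * w + n /
    -- (2 * x)`. Over the whole workload the slope costs `Q ^ 2 * ρ ^ 2 * x ≤ Q ^ 2 * R`.
    refine ⟨Q ^ 2 * x / n, by positivity, ?_, fun w hw hwn => ?_⟩
    · have h1 : Q ^ 2 * x / n * m = Q ^ 2 * (ρ * ρ) * x := by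
        rw [hρ2]
        ring
      rw [h1, hRdef]
      have : ρ * ρ ≤ 1 * ρ := mul_le_mul_of_nonneg_right hρ1 hρ0
      calc Q ^ 2 * (ρ * ρ) * x ≤ Q ^ 2 * (1 * ρ) * x := by gcongr
        _ = Q ^ 2 * (ρ * x) := by ring
    · have h1 : 60 * b * Real.log n ^ 2 * (√(2 * w) + 1) ≤ Q * (√(2 * w) + 1) := by gcongr
      have h2 : √(2 * w) ^ 2 = 2 * w := Real.sq_sqrt (by positivity)
      have h3 : Q * √(2 * w) ≤ Q ^ 2 * x / n * w + n / (2 * x) := by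
        have h4 : 0 ≤ (Q * √(2 * w) - n / x) ^ 2 * (x / (2 * n)) := by positivity
        have h5 : (Q * √(2 * w) - n / x) ^ 2 * (x / (2 * n)) =
            Q ^ 2 * x / n * (√(2 * w) ^ 2 / 2) - Q * √(2 * w) + n / (2 * x) := by
          field_simp
          ring
        rw [h5, h2] at h4
        linarith
      have h6 : (n : ℝ) / x = n / (2 * x) + n / (2 * x) := by
        field_simp
        norm_num
      linarith
  -- Here `x ≤ r ^ 3` is at most the fourth root of `n`, so `n / x` exceeds every window surplus and
  -- no slope is needed.
  · refine ⟨0, le_rfl, by rw [zero_mul]; positivity, fun w hw hwn => ?_⟩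
    have hsn : √(n : ℝ) * √n = n := Real.mul_self_sqrt hn0.le
    have hssn : √√(n : ℝ) * √√n = √n := Real.mul_self_sqrt (Real.sqrt_nonneg _)
    have hn1 : 1 ≤ √(n : ℝ) := Real.one_le_sqrt.mpr (by linarith [hn.three_le])
    have h1 : √(2 * w) ≤ 2 * √n := by
      rw [Real.sqrt_le_left (by positivity)]
      nlinarith
    have hxn : x ≤ √√(n : ℝ) := by
      refine Real.le_sqrt_of_sq_le (Real.le_sqrt_of_sq_le ?_)
      calc (x ^ 2) ^ 2 ≤ ((r ^ 3) ^ 2) ^ 2 := by gcongr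
        _ = r ^ 12 := by ring
        _ ≤ r ^ 20 := pow_le_pow_right₀ (by linarith) (by norm_num)
        _ ≤ n := hnr
    have h2 := hn.sq_log_le
    have hP0 : 0 ≤ 60 * b * Real.log n ^ 2 := by positivity
    have h3 : (60 * b * Real.log n ^ 2 * (√(2 * w) + 1) + 2) * x ≤ n := by
      calc (60 * b * Real.log n ^ 2 * (√(2 * w) + 1) + 2) * x
          ≤ (60 * b * Real.log n ^ 2 * (2 * √n + √n) + 2 * √n) * √√n := by
            gcongr
            linarith
        _ = (180 * b * Real.log n ^ 2 + 2) * √n * √√n := by ring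
        _ ≤ √√n * √n * √√n := by gcongr
        _ = √n * (√√n * √√n) := by ring
        _ = n := by rw [hssn, hsn]
    rw [zero_mul, zero_add, le_sub_iff_add_le, le_div_iff₀ hx0]
    exact h3

theorem mul_sqrt_le_div {x y w ρ : ℝ} (hx0 : 0 < x) (hy1 : 1 ≤ y) (hρ1 : ρ ≤ 1)
    (h2 : 72 * x * w ^ 2 ≤ √y) : 12 * w ^ 2 * (2 * (ρ * √y) + 1) ≤ y / (2 * x) := by
  have h3 : 1 ≤ √y := Real.one_le_sqrt.mpr hy1
  have h4 : √y * √y = y := Real.mul_self_sqrt (by linarith)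
  have h6 : ρ * √y ≤ √y := mul_le_of_le_one_left (by linarith) hρ1
  rw [le_div_iff₀ (by positivity)]
  calc 12 * w ^ 2 * (2 * (ρ * √y) + 1) * (2 * x)
      ≤ 12 * w ^ 2 * (2 * √y + √y) * (2 * x) := by gcongr
    _ = 72 * x * w ^ 2 * √y := by ring
    _ ≤ √y * √y := by gcongr
    _ = y := h4

set_option maxHeartbeats 1000000 in
/-- The typical behaviour of the hash function implies a bound on the crossing number. -/
theorem crossingNumber_lt {h : U → Fin n} {j : Fin n} {s : Finset U}
    (hadm : Admissible n x κ A S) (hκ : 0 < κ) (hb : 12 ≤ b) (hr : Large κ c b r)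
    (hn : Large κ c b n) (hR : √((S.length : ℝ) / n * x ^ 2) * Real.log x ^ 5 ≤ r)
    (hrm : r ≤ S.length) (hs : ∀ op ∈ S, op.key ∈ s)
    (hinit : ∀ b ∈ (Finset.univ : Finset (Fin n)), ∀ l ∈ Finset.range (n + 1),
      ((A.toFinset.filter fun w => dist b (h w) < l).card : ℝ) ≤ l + n / 4)
    (hmain : ∀ k ∈ Finset.range (Nat.clog 2 n + 1),
      SurplusGood h S s j (min (2 ^ k) n) (b * Real.log r + 4 * k))
    (hdrift : ∀ z ∈ Finset.range (n + 1), (145800 * x * (b * Real.log r) ^ 2) ^ 2 ≤ z →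
      ((A.countP fun w => behind j (h w) ≤ z) : ℝ) ≤ z - z / (2 * x))
    (hwin : ∀ S₁, S₁ <:+: S → SurplusGood h S₁ s j n (b * Real.log n)) :
    (crossingNumber h A S j : ℝ) < r := by
  have hn0 : (0 : ℝ) < n := Nat.cast_pos.mpr (NeZero.pos n)
  have hx := hadm.one_lt
  have hx0 : 0 < x := by linarith
  have hxr := Admissible.load_le hadm hκ hr hR
  have hbal : Balanced S := ⟨⟨_, hadm.valid⟩, hadm.alternating⟩
  have hmn : (S.length : ℝ) ≤ n := by exact_mod_cast hadm.length_upper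
  have hn8 : 8 ≤ n := by
    have h1 : ((8 : ℕ) : ℝ) ≤ n := by
      have := hn.sixteen_le
      push_cast
      linarith
    exact_mod_cast h1
  rw [rate_eq hx0.le] at hR
  set m : ℝ := (S.length : ℝ) with hm
  set ρ : ℝ := √(m / n) with hρ
  have hρ0 : 0 ≤ ρ := Real.sqrt_nonneg _
  have hρ2 : ρ * ρ = m / n := Real.mul_self_sqrt (by positivity)
  have hρ1 : ρ ≤ 1 := by
    rw [hρ, Real.sqrt_le_left zero_le_one, one_pow]
    exact (div_le_one hn0).mpr hmn
  set R : ℝ := ρ * x with hRdef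
  have hR0 : 0 ≤ R := by positivity
  have hRx : R ≤ x := mul_le_of_le_one_left hx0.le hρ1
  have hkey := mul_pow_le (by linarith) hr hx hR0 hRx hR
  have hlr := hr.one_le_log
  set L : ℝ := b * Real.log r with hLdef
  have hL12 : 12 ≤ L := by nlinarith
  have hL0 : 0 ≤ L := by linarith
  have hL24 : L ^ 2 ≤ L ^ 4 := pow_le_pow_right₀ (by linarith) (by norm_num)
  have hL4 : 1 ≤ L ^ 2 := one_le_pow₀ (by linarith)
  have hr3 := hr.three_le
  set Q : ℝ := 24000 * L ^ 2 with hQ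
  have hQ0 : 0 ≤ Q := by positivity
  have hQR : Q ^ 2 * R = 576000000 * (L ^ 4 * R) := by
    rw [hQ]
    ring
  have hLR : 0 ≤ L ^ 4 * R := by positivity
  have hL40 : 1 ≤ L ^ 4 := hL4.trans hL24
  have hwin' : ∀ S₁, S₁ <:+: S → ∀ g : ℕ → ℕ, Antitone g → (∀ t, g t ≤ n) →
      (surplus (fun w => behind j (h w)) g S₁ : ℝ) ≤
        60 * b * Real.log n ^ 2 * (√(2 * S₁.length) + 1) := fun S₁ hS₁ g hg hgn =>
    window_surplus_le (hbal.infix hS₁) (fun op hop => hs op (hS₁.subset hop)) (by linarith)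
      hn.one_le_log (hS₁.length_le.trans hadm.length_upper) (hwin S₁ hS₁) hg hgn
  obtain ⟨β, hβ0, hβm, hβ'⟩ := exists_window_rate hn0 hx0 hρ0 hρ1 hρ2 hRdef
    (by linarith) hr hn hxr hrm hLdef hQ hkey hL4 hL24
  have hβ : ∀ S₁, S₁ <:+: S → ∀ g : ℕ → ℕ, Antitone g → (∀ t, g t ≤ n) →
      (surplus (fun w => behind j (h w)) g S₁ : ℝ) ≤ β * S₁.length + n / x - 2 :=
    fun S₁ hS₁ g hg hgn => (hwin' S₁ hS₁ g hg hgn).trans (hβ' _ (Nat.cast_nonneg _) (by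
      exact_mod_cast hS₁.length_le.trans hadm.length_upper))
  obtain ⟨g, hg, hgn, hle, z, hzn, hgz, hle2⟩ := crossingNumber_le (j := j) hadm hn8 hinit hβ0 hβ
  have hsur := surplus_le_of_good hbal hs (L := L) (by linarith) hadm.length_upper hmain hg hgn rfl
  set y : ℕ := max (g 0) 1 with hy
  have hy1 : (1 : ℝ) ≤ y := by exact_mod_cast le_max_right _ _
  have hlogy : 0 ≤ Real.log y := Real.log_nonneg hy1
  have hsq : √(m * y / n) = ρ * √y := by
    rw [hρ, ← Real.sqrt_mul (by positivity)]
    congr 1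
    ring
  rw [← hm, hsq] at hsur
  set q : ℝ := 145800 * x * L ^ 2 with hq
  have hq1 : 1 ≤ q := by nlinarith
  have hlogq : Real.log (q ^ 2) ≤ L := by
    have h1 : q ^ 2 ≤ r ^ 8 := by
      have h2 : q ≤ r ^ 4 := by
        calc q = (145800 * L ^ 2) * x := by rw [hq]; ring
          _ ≤ r * r ^ 3 := mul_le_mul hr.sq_le hxr hx0.le (by linarith)
          _ = r ^ 4 := by ring
      calc q ^ 2 ≤ (r ^ 4) ^ 2 := by gcongr
        _ = r ^ 8 := by ring
    have h3 := Real.log_le_log (by positivity) h1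
    rw [Real.log_pow r] at h3
    push_cast at h3
    nlinarith
  rcases le_or_gt (y : ℝ) (q ^ 2) with hyq | hyq
  -- Short paths: with `√y ≤ q` the surplus is of order `L ^ 2 * ρ * q`, that is `L ^ 4 * R`. Its
  -- constant together with that of `Q ^ 2 * R` is below the `10 ^ 10` of `hkey`.
  · have h1 : Real.log y ≤ L := (Real.log_le_log (by linarith) hyq).trans hlogq
    have h2 : √(y : ℝ) ≤ q := by
      rw [Real.sqrt_le_left (by linarith)]
      exact hyq
    have h3 : 12 * (L + 4 + 8 * Real.log y) ^ 2 * (2 * (ρ * √y) + 1) ≤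
        12 * (13 * L) ^ 2 * (2 * (ρ * q) + 1) := by
      have h5 : L + 4 + 8 * Real.log y ≤ 13 * L := by linarith
      have h6 : ρ * √y ≤ ρ * q := mul_le_mul_of_nonneg_left h2 hρ0
      gcongr
    have h4 : 12 * (13 * L) ^ 2 * (2 * (ρ * q) + 1) =
        591364800 * (L ^ 4 * R) + 2028 * L ^ 2 := by
      rw [hq, hRdef]
      ring
    linarith
  -- Long paths: the surplus is at most `y / (2 * x)`, which the initial resources cancel, so that
  -- only the cost of `β` remains.
  · have hyg : y = g 0 := by
      have h1 : (1 : ℝ) < y := lt_of_le_of_lt (by nlinarith) hyq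
      have h2 : 1 < y := by exact_mod_cast h1
      omega
    have hyz : (y : ℝ) ≤ z := by exact_mod_cast (hyg ▸ hgz)
    have h1 := hdrift z (Finset.mem_range.mpr (by omega)) (hyq.le.trans hyz)
    have h2 := log_sq_le_sqrt hx0 (by linarith) hq hlogq hq1 hyq.le
    have h5 := mul_sqrt_le_div hx0 hy1 hρ1 h2
    have h7 : (y : ℝ) / (2 * x) ≤ z / (2 * x) := by gcongr
    linarith

end Tail

/-! ### Probability of the exceptional events. -/

section Probability

variable {n : ℕ} [NeZero n] {U Ω : Type*} [DecidableEq U] [MeasurableSpace Ω] {P : Measure Ω}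
  [IsProbabilityMeasure P] {h : Ω → U → Fin n} {x κ c b r : ℝ} {A : List U} {S : List (Op U)}

theorem Large.rpow_pos (hr : Large κ c b r) (c : ℝ) : 0 < r ^ c :=
  Real.rpow_pos_of_pos (by linarith [hr.three_le]) c

theorem Large.exp_le (hr : Large κ c b r) (hcb : c ≤ b) :
    Real.exp (-(b * Real.log r)) ≤ 1 / r ^ c := by
  have hr3 := hr.three_le
  have h1 := hr.one_le_log
  rw [Real.rpow_def_of_pos (by linarith), one_div, ← Real.exp_neg]
  refine Real.exp_le_exp.mpr ?_
  nlinarith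

theorem Large.initial_le (hn : Large κ c b n) :
    ((n : ℝ) + 1) ^ 2 * Real.exp (-(√n / 16)) ≤ 1 / (n : ℝ) ^ c := by
  have hn3 := hn.three_le
  have h1 := hn.one_le_log
  have h2 := hn.log_le
  have h3 : ((n : ℝ) + 1) ^ 2 ≤ Real.exp (4 * Real.log n) := by
    have h4 : Real.exp (4 * Real.log n) = (n : ℝ) ^ 4 := by
      rw [mul_comm, Real.exp_mul, Real.exp_log (by linarith)]
      norm_cast
    rw [h4]
    have h5 : (n : ℝ) + 1 ≤ n ^ 2 := by nlinarith
    calc ((n : ℝ) + 1) ^ 2 ≤ (n ^ 2) ^ 2 := by gcongr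
      _ = (n : ℝ) ^ 4 := by ring
  calc ((n : ℝ) + 1) ^ 2 * Real.exp (-(√n / 16))
      ≤ Real.exp (4 * Real.log n) * Real.exp (-(√n / 16)) := by gcongr
    _ = Real.exp (4 * Real.log n - √n / 16) := by rw [← Real.exp_add, sub_eq_add_neg]
    _ ≤ Real.exp (-(c * Real.log n)) := Real.exp_le_exp.mpr (by linarith)
    _ = 1 / (n : ℝ) ^ c := by
      rw [Real.rpow_def_of_pos (by linarith), one_div, ← Real.exp_neg, mul_comm]

theorem Large.windows_le (hn : Large κ c (c + 12) n) {m : ℕ} (hm : m ≤ n) :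
    ((m : ℝ) + 1) ^ 2 * (4 * ((n : ℝ) + 2) ^ 3 * Real.exp (-((c + 12) * Real.log n))) ≤
      1 / (n : ℝ) ^ c := by
  have hn256 := hn.sixteen_le
  have h1 : Real.exp (-((c + 12) * Real.log n)) = 1 / (n : ℝ) ^ c * (1 / (n : ℝ) ^ 12) := by
    rw [← Real.rpow_natCast, Real.rpow_def_of_pos (by linarith), Real.rpow_def_of_pos (by linarith),
      one_div, one_div, ← Real.exp_neg, ← Real.exp_neg, ← Real.exp_add]
    congr 1
    push_cast
    ring
  have hmn : (m : ℝ) ≤ n := by exact_mod_cast hm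
  have h2 : ((m : ℝ) + 1) ^ 2 * (4 * ((n : ℝ) + 2) ^ 3) ≤ n ^ 12 := by
    have h3 : (m : ℝ) + 1 ≤ n ^ 2 := by nlinarith
    have h4 : (n : ℝ) + 2 ≤ n ^ 2 := by nlinarith
    have h5 : (4 : ℝ) ≤ n ^ 2 := by nlinarith
    calc ((m : ℝ) + 1) ^ 2 * (4 * ((n : ℝ) + 2) ^ 3)
        ≤ (n ^ 2) ^ 2 * (n ^ 2 * (n ^ 2) ^ 3) := by gcongr
      _ = (n : ℝ) ^ 12 := by ring
  rw [h1]
  have h6 : 0 < (n : ℝ) ^ c := hn.rpow_pos c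
  have h7 : 0 < (n : ℝ) ^ 12 := by positivity
  calc ((m : ℝ) + 1) ^ 2 * (4 * ((n : ℝ) + 2) ^ 3 * (1 / (n : ℝ) ^ c * (1 / (n : ℝ) ^ 12)))
      = 1 / (n : ℝ) ^ c * (((m : ℝ) + 1) ^ 2 * (4 * ((n : ℝ) + 2) ^ 3) / n ^ 12) := by ring
    _ ≤ 1 / (n : ℝ) ^ c * 1 := by
      gcongr
      exact (div_le_one h7).mpr h2
    _ = 1 / (n : ℝ) ^ c := mul_one _

/-- The extra `4 * k` contributes a factor at most `16 ^ (-k)` against the cubic count `4 * (3 * 2 ^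
k) ^ 3`, which leaves the geometric series of `108 * 2 ^ (-k)`. -/
theorem measureReal_not_boxes_le (hh : IsUniformHash P h) (hS : Balanced S) {s : Finset U}
    (hs : ∀ op ∈ S, op.key ∈ s) (hSn : S.length ≤ n) (j : Fin n) {L : ℝ} (hL : 1 ≤ L) (K : ℕ) :
    P.real {ω | ¬ ∀ k ∈ Finset.range K, SurplusGood (h ω) S s j (min (2 ^ k) n) (L + 4 * k)} ≤
      216 * Real.exp (-L) := by
  have h1 : ∀ k ∈ Finset.range K,
      P.real {ω | ¬ SurplusGood (h ω) S s j (min (2 ^ k) n) (L + 4 * k)} ≤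
        108 * (1 / 2) ^ k * Real.exp (-L) := by
    intro k _
    have hk : (0 : ℝ) ≤ k := Nat.cast_nonneg _
    refine (measureReal_not_surplusGood_le hh hS hs hSn j (min_le_right _ _)
      (by linarith)).trans ?_
    have h2 : ((min (2 ^ k) n : ℕ) : ℝ) + 2 ≤ 3 * 2 ^ k := by
      have h3 : ((min (2 ^ k) n : ℕ) : ℝ) ≤ 2 ^ k := by exact_mod_cast min_le_left _ _
      have h4 : (1 : ℝ) ≤ 2 ^ k := one_le_pow₀ (by norm_num)
      linarith
    have h5 : Real.exp (-(L + 4 * k)) ≤ (1 / 16) ^ k * Real.exp (-L) := by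
      rw [neg_add, Real.exp_add, mul_comm]
      refine mul_le_mul_of_nonneg_right ?_ (Real.exp_pos _).le
      have h6 : Real.exp (-(4 * (k : ℝ))) = Real.exp (-4) ^ k := by
        rw [← Real.exp_nat_mul]
        congr 1
        ring
      rw [h6]
      refine pow_le_pow_left₀ (Real.exp_pos _).le ?_ k
      rw [Real.exp_neg, ← one_div]
      refine one_div_le_one_div_of_le (by norm_num) ?_
      have h7 := Real.exp_one_gt_d9
      have h8 : Real.exp 4 = Real.exp 1 ^ 4 := by
        rw [← Real.exp_nat_mul]
        norm_num
      rw [h8]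
      calc (16 : ℝ) = 2 ^ 4 := by norm_num
        _ ≤ Real.exp 1 ^ 4 := pow_le_pow_left₀ (by norm_num) (by linarith) 4
    calc 4 * (((min (2 ^ k) n : ℕ) : ℝ) + 2) ^ 3 * Real.exp (-(L + 4 * k))
        ≤ 4 * (3 * 2 ^ k) ^ 3 * ((1 / 16) ^ k * Real.exp (-L)) := by gcongr
      _ = 108 * ((2 ^ 3) * (1 / 16)) ^ k * Real.exp (-L) := by
        rw [mul_pow (2 ^ 3 : ℝ), ← pow_mul, mul_comm 3 k, pow_mul]
        ring
      _ = 108 * (1 / 2) ^ k * Real.exp (-L) := by norm_num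
  refine (measureReal_not_forall_le P _ _ _ h1).trans ?_
  rw [← Finset.sum_mul, ← Finset.mul_sum]
  have h2 : ∑ k ∈ Finset.range K, (1 / 2 : ℝ) ^ k ≤ 2 := sum_geometric_two_le K
  have := Real.exp_pos (-L)
  nlinarith

/-- For `z ≥ q ^ 2`, `log_sq_le_sqrt` yields `√z / (8 * x) ≥ L + 2 * log z`, hence a failure
probability of at most `exp (-L) / z ^ 2`. -/
theorem measureReal_not_drift_le (hh : IsUniformHash P h) (hA : A.Nodup) (hx : 1 ≤ x)
    (hload : (A.length : ℝ) = (1 - 1 / x) * n) (j : Fin n) {L q : ℝ} (hL : 1 ≤ L)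
    (hq : q = 145800 * x * L ^ 2) (hqL : Real.log (q ^ 2) ≤ L) (hq1 : 1 ≤ q) :
    P.real {ω | ¬ ∀ z ∈ Finset.range (n + 1), q ^ 2 ≤ z →
      ((A.countP fun w => behind j (h ω w) ≤ z) : ℝ) ≤ z - z / (2 * x)} ≤
      (∑' z : ℕ, 1 / (z : ℝ) ^ 2) * Real.exp (-L) := by
  have hx0 : 0 < x := by linarith
  have h1 : ∀ z ∈ Finset.range (n + 1), P.real {ω | ¬ (q ^ 2 ≤ z →
      ((A.countP fun w => behind j (h ω w) ≤ z) : ℝ) ≤ z - z / (2 * x))} ≤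
      1 / (z : ℝ) ^ 2 * Real.exp (-L) := by
    intro z hz
    by_cases hqz : q ^ 2 ≤ z
    · simp only [hqz, true_imp_iff]
      have hz1 : (1 : ℝ) ≤ z := by nlinarith
      have h2 := log_sq_le_sqrt hx0 hL hq hqL hq1 hqz
      have hlog : 0 ≤ Real.log z := Real.log_nonneg hz1
      have h3 : L + 4 + 8 * Real.log z ≤ (L + 4 + 8 * Real.log z) ^ 2 := by nlinarith
      have h4 : 72 * x * (L + 4 + 8 * Real.log z) ≤ √(z : ℝ) := le_trans (by gcongr) h2
      have h5 : 8 * x ≤ √(z : ℝ) := by nlinarith [mul_nonneg hx0.le hlog]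
      refine (measureReal_drift_le hh hA hx0 hload j
        (by have := Finset.mem_range.mp hz; omega) h5).trans ?_
      have h6 : L + 2 * Real.log z ≤ √(z : ℝ) / (8 * x) := by
        rw [le_div_iff₀ (by positivity)]
        nlinarith [mul_nonneg hx0.le hlog]
      have h7 : 1 / (z : ℝ) ^ 2 = Real.exp (-(2 * Real.log z)) := by
        rw [Real.exp_neg, mul_comm, Real.exp_mul, Real.exp_log (by linarith), one_div]
        norm_cast
      rw [h7, ← Real.exp_add]
      exact Real.exp_le_exp.mpr (by linarith)
    · simp only [hqz, false_imp_iff, not_true_eq_false]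
      have : {ω : Ω | False} = ∅ := rfl
      rw [this, measureReal_empty]
      positivity
  refine (measureReal_not_forall_le P _ _ _ h1).trans ?_
  rw [← Finset.sum_mul]
  refine mul_le_mul_of_nonneg_right ?_ (Real.exp_pos _).le
  exact (Real.summable_one_div_nat_pow.mpr one_lt_two).sum_le_tsum _ fun z _ => by positivity

/-- Of the constant, `216` comes from the boxes, the series from the drift, and `1` each from
displacements and windows. The last two events have probability at most `1 / n ^ c`, which suffices
because `r ≤ |S| ≤ n`. -/
theorem measureReal_crossingNumber_le_of_large (hadm : Admissible n x κ A S)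
    (hh : IsUniformHash P h) (hκ : 0 < κ) (hc : 0 < c) (hr : Large κ c (c + 12) r)
    (hn : Large κ c (c + 12) n) (hrm : r ≤ S.length)
    (hR : √((S.length : ℝ) / n * x ^ 2) * Real.log x ^ 5 ≤ r) (j : Fin n) :
    P.real {ω | r ≤ (crossingNumber (h ω) A S j : ℝ)} ≤
      (218 + ∑' z : ℕ, 1 / (z : ℝ) ^ 2) / r ^ c := by
  set s : Finset U := (S.map Op.key).toFinset with hs
  have hsk : ∀ op ∈ S, op.key ∈ s := fun op hop => by
    rw [hs, List.mem_toFinset]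
    exact List.mem_map_of_mem hop
  have hbal : Balanced S := ⟨⟨_, hadm.valid⟩, hadm.alternating⟩
  have hx := hadm.one_lt
  have hx0 : 0 < x := by linarith
  have hlen : A.length ≤ n := by
    have h1 : (A.length : ℝ) ≤ n := by
      rw [hadm.load]
      have : 0 ≤ 1 / x := by positivity
      have : (0 : ℝ) ≤ n := Nat.cast_nonneg _
      nlinarith
    exact_mod_cast h1
  have hxr := Admissible.load_le hadm hκ hr hR
  have hr3 := hr.three_le
  have hlr := hr.one_le_log
  set L : ℝ := (c + 12) * Real.log r with hL
  have hL12 : 12 ≤ L := by nlinarith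
  have hq1 : 1 ≤ 145800 * x * L ^ 2 := by nlinarith
  have hlogq : Real.log ((145800 * x * L ^ 2) ^ 2) ≤ L := by
    have h1 : (145800 * x * L ^ 2) ^ 2 ≤ r ^ 8 := by
      have h2 : 145800 * x * L ^ 2 ≤ r ^ 4 := by
        calc 145800 * x * L ^ 2 = (145800 * L ^ 2) * x := by ring
          _ ≤ r * r ^ 3 := mul_le_mul hr.sq_le hxr hx0.le (by linarith)
          _ = r ^ 4 := by ring
      calc (145800 * x * L ^ 2) ^ 2 ≤ (r ^ 4) ^ 2 := by gcongr
        _ = r ^ 8 := by ring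
    have h3 := Real.log_le_log (by positivity) h1
    rw [Real.log_pow r] at h3
    push_cast at h3
    nlinarith
  have hrn : r ≤ n := hrm.trans (by exact_mod_cast hadm.length_upper)
  have hn16 : 16 ≤ √(n : ℝ) := Real.le_sqrt_of_sq_le (by linarith [hn.sixteen_le])
  have hnlog := hn.one_le_log
  have e1 := (measureReal_initial_le hh hlen hn16).trans hn.initial_le
  have e2 := measureReal_not_boxes_le hh hbal hsk hadm.length_upper j (by linarith : 1 ≤ L)
    (Nat.clog 2 n + 1)
  have e3 := measureReal_not_drift_le hh hadm.nodup hx.le hadm.load j (by linarith) rfl hlogq hq1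
  have e4 := (measureReal_not_windows_le hh hbal hsk hadm.length_upper j (le_refl n)
    (σ := (c + 12) * Real.log n) (by nlinarith)).trans (hn.windows_le hadm.length_upper)
  have hall := measureReal_not_and_le P _ _ e1 (measureReal_not_and_le P _ _ e2
    (measureReal_not_and_le P _ _ e3 e4))
  have hrc : 0 < r ^ c := hr.rpow_pos c
  have hnr : 1 / (n : ℝ) ^ c ≤ 1 / r ^ c :=
    one_div_le_one_div_of_le hrc (Real.rpow_le_rpow (by linarith) hrn hc.le)
  have hexp := hr.exp_le (by linarith)
  have hT : 0 ≤ ∑' z : ℕ, 1 / (z : ℝ) ^ 2 := tsum_nonneg fun z => by positivity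
  refine (measureReal_mono fun ω hω => ?_).trans (hall.trans ?_)
  · rintro ⟨g1, g2, g3, g4⟩
    exact absurd hω (not_le.mpr
      (crossingNumber_lt hadm hκ (by linarith) hr hn hR hrm hsk g1 g2 g3 g4))
  · have h1 := mul_le_mul_of_nonneg_left hexp hT
    have h2 : (218 + ∑' z : ℕ, 1 / (z : ℝ) ^ 2) / r ^ c =
        218 * (1 / r ^ c) + (∑' z : ℕ, 1 / (z : ℝ) ^ 2) * (1 / r ^ c) := by
      ring
    rw [h2]
    linarith

end Probability

/-! ### From large thresholds to the tail bound and the expectation. -/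

theorem le_sum_dyadic {r : ℝ} (hr : 0 < r) (v : ℝ) (K : ℕ) (hv : v < 2 ^ K * r) :
    v ≤ r + ∑ k ∈ Finset.range K, 2 ^ (k + 1) * r * if 2 ^ k * r ≤ v then 1 else 0 := by
  induction K with
  | zero =>
    simp only [pow_zero, one_mul] at hv
    simpa using hv.le
  | succ K ih =>
    rw [Finset.sum_range_succ]
    by_cases hk : 2 ^ K * r ≤ v
    · have h1 : 0 ≤ ∑ k ∈ Finset.range K, 2 ^ (k + 1) * r * if 2 ^ k * r ≤ v then (1 : ℝ) else 0 :=
        Finset.sum_nonneg fun k _ => by split_ifs <;> positivity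
      rw [if_pos hk]
      linarith
    · rw [if_neg hk, mul_zero, add_zero]
      exact ih (not_le.mp hk)

/-- A quadratic tail bound above `r` bounds the expectation. -/
theorem integral_le_of_tail {Ω : Type*} [MeasurableSpace Ω] {P : Measure Ω}
    [IsProbabilityMeasure P] {X : Ω → ℕ} (hX : Measurable X) {m : ℕ} (hm : ∀ ω, X ω ≤ m)
    {r C : ℝ} (hr : 0 < r) (hC : 0 ≤ C)
    (htail : ∀ t, r ≤ t → P.real {ω | t ≤ (X ω : ℝ)} ≤ C / t ^ 2) :
    Integrable (fun ω => (X ω : ℝ)) P ∧ ∫ ω, (X ω : ℝ) ∂P ≤ r + 4 * C / r := by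
  have hXm : Measurable fun ω => (X ω : ℝ) := measurable_from_top.comp hX
  have hint : Integrable (fun ω => (X ω : ℝ)) P := by
    refine Integrable.of_bound (C := m) hXm.aestronglyMeasurable (ae_of_all _ fun ω => ?_)
    rw [Real.norm_of_nonneg (Nat.cast_nonneg _)]
    exact_mod_cast hm ω
  refine ⟨hint, ?_⟩
  obtain ⟨K, hK⟩ := pow_unbounded_of_one_lt ((m : ℝ) / r) one_lt_two
  rw [div_lt_iff₀ hr] at hK
  have hset : ∀ t : ℝ, MeasurableSet {ω | t ≤ (X ω : ℝ)} := fun t =>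
    measurableSet_le measurable_const hXm
  have hind : ∀ t : ℝ, (fun ω => if t ≤ (X ω : ℝ) then (1 : ℝ) else 0) =
      {ω | t ≤ (X ω : ℝ)}.indicator fun _ => 1 := fun t => by
    ext ω
    simp [Set.indicator]
  have hiint : ∀ t : ℝ, Integrable (fun ω => if t ≤ (X ω : ℝ) then (1 : ℝ) else 0) P := fun t => by
    rw [hind]
    exact (integrable_const _).indicator (hset t)
  calc ∫ ω, (X ω : ℝ) ∂P
      ≤ ∫ ω, (r + ∑ k ∈ Finset.range K,
          2 ^ (k + 1) * r * if 2 ^ k * r ≤ (X ω : ℝ) then 1 else 0) ∂P := by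
        refine integral_mono hint ?_ fun ω => le_sum_dyadic hr _ K (lt_of_le_of_lt ?_ hK)
        · exact (integrable_const _).add
            (integrable_finsetSum _ fun k _ => (hiint _).const_mul _)
        · exact_mod_cast hm ω
    _ = r + ∑ k ∈ Finset.range K, 2 ^ (k + 1) * r * P.real {ω | 2 ^ k * r ≤ (X ω : ℝ)} := by
        rw [integral_add (integrable_const _)
          (integrable_finsetSum _ fun k _ => (hiint _).const_mul _),
          integral_finsetSum _ fun k _ => (hiint _).const_mul _]
        simp only [integral_const, probReal_univ, smul_eq_mul, one_mul]
        congr 1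
        refine Finset.sum_congr rfl fun k _ => ?_
        rw [integral_const_mul, hind, integral_indicator_const _ (hset _)]
        simp
    _ ≤ r + ∑ k ∈ Finset.range K, 2 * C / r * (1 / 2) ^ k := by
        refine add_le_add le_rfl (Finset.sum_le_sum fun k _ => ?_)
        have h1 : (1 : ℝ) ≤ 2 ^ k := one_le_pow₀ (by norm_num)
        have h2 := htail (2 ^ k * r) (by nlinarith)
        calc 2 ^ (k + 1) * r * P.real {ω | 2 ^ k * r ≤ (X ω : ℝ)}
            ≤ 2 ^ (k + 1) * r * (C / (2 ^ k * r) ^ 2) := by gcongr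
          _ = 2 * C / r * (1 / 2) ^ k := by
            rw [one_div, inv_pow, pow_succ]
            field_simp
    _ ≤ r + 4 * C / r := by
        rw [← Finset.mul_sum]
        have h1 : ∑ k ∈ Finset.range K, (1 / 2 : ℝ) ^ k ≤ 2 := sum_geometric_two_le K
        have h2 : 0 ≤ 2 * C / r := by positivity
        have h3 := mul_le_mul_of_nonneg_left h1 h2
        have h4 : 2 * C / r * 2 = 4 * C / r := by ring
        linarith

/-- Thresholds below `r₀` are absorbed by the term `(max r₀ 0) ^ c` of the constant, and thresholds
above `|S|` are never reached. In between, `n ≥ r` is large as well. -/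
theorem tail_bound {κ : ℝ} (hκ : 0 < κ) {c : ℝ} (hc : 0 < c) : ∃ C : ℝ, 0 < C ∧
    ∀ (n : ℕ) [NeZero n] (x : ℝ) (U : Type*) [DecidableEq U] (A : List U) (S : List (Op U))
      (Ω : Type*) [MeasurableSpace Ω] (P : Measure Ω) [IsProbabilityMeasure P]
      (h : Ω → U → Fin n), Admissible n x κ A S → IsUniformHash P h →
      ∀ (j : Fin n) (r : ℝ), 0 < r →
        √((S.length : ℝ) / n * x ^ 2) * Real.log x ^ 5 ≤ r →
        P.real {ω | r ≤ (crossingNumber (h ω) A S j : ℝ)} ≤ C / r ^ c := by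
  obtain ⟨r₀, hr₀⟩ := Filter.eventually_atTop.mp (eventually_large κ c (c + 12))
  have hT : 0 ≤ ∑' z : ℕ, 1 / (z : ℝ) ^ 2 := tsum_nonneg fun z => by positivity
  have hM : 0 ≤ (max r₀ 0) ^ c := Real.rpow_nonneg (le_max_right _ _) c
  refine ⟨218 + ∑' z : ℕ, 1 / (z : ℝ) ^ 2 + (max r₀ 0) ^ c, by positivity, ?_⟩
  intro n _ x U _ A S Ω _ P _ h hadm hh j r hr hR
  have hrc : 0 < r ^ c := Real.rpow_pos_of_pos hr c
  rcases lt_or_ge r r₀ with hlt | hge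
  · refine measureReal_le_one.trans ((one_le_div hrc).mpr ?_)
    have : r ^ c ≤ (max r₀ 0) ^ c :=
      Real.rpow_le_rpow hr.le (hlt.le.trans (le_max_left _ _)) hc.le
    linarith
  · rcases lt_or_ge (S.length : ℝ) r with hm | hm
    · have hempty : {ω | r ≤ (crossingNumber (h ω) A S j : ℝ)} = ∅ := by
        ext ω
        simp only [Set.mem_ofPred_eq, Set.mem_empty_iff_false, iff_false, not_le]
        refine lt_of_le_of_lt ?_ hm
        exact_mod_cast crossingsFrom_le _ S
      rw [hempty, measureReal_empty]
      positivity
    · have hrn : r ≤ n := hm.trans (by exact_mod_cast hadm.length_upper)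
      refine (measureReal_crossingNumber_le_of_large hadm hh hκ hc (hr₀ r hge)
        (hr₀ n (hge.trans hrn)) hm hR j).trans ?_
      exact div_le_div_of_nonneg_right (by linarith) hrc.le

/-- The tail with exponent `2` is used from `r = R * (1 + log x) ^ 5` on, where `R` is the rate.
Since `r ^ 2 ≥ R ^ 2 ≥ κ`, the term `4 * C / r` is at most a constant multiple of `r`. -/
theorem expectation_bound {κ : ℝ} (hκ : 0 < κ) : ∃ C : ℝ, 0 < C ∧
    ∀ (n : ℕ) [NeZero n] (x : ℝ) (U : Type*) [DecidableEq U] (A : List U) (S : List (Op U))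
      (Ω : Type*) [MeasurableSpace Ω] (P : Measure Ω) [IsProbabilityMeasure P]
      (h : Ω → U → Fin n), Admissible n x κ A S → IsUniformHash P h → ∀ j : Fin n,
        Integrable (fun ω => (crossingNumber (h ω) A S j : ℝ)) P ∧
        ∫ ω, (crossingNumber (h ω) A S j : ℝ) ∂P ≤
          √((S.length : ℝ) / n * x ^ 2) * (C * (1 + Real.log x) ^ 5) := by
  obtain ⟨C, hC, htail⟩ := tail_bound hκ (c := 2) two_pos
  refine ⟨1 + 4 * C / κ, by positivity, ?_⟩
  intro n _ x U _ A S Ω _ P _ h hadm hh j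
  have hx := hadm.one_lt
  have hlog : 0 ≤ Real.log x := Real.log_nonneg hx.le
  have hκR := Admissible.kappa_mul_le hadm
  set R := √((S.length : ℝ) / n * x ^ 2)
  have hR2 : κ ≤ R ^ 2 := le_trans (by nlinarith) hκR
  have hR0 : 0 < R := by
    refine lt_of_le_of_ne (Real.sqrt_nonneg _) fun h0 => ?_
    have h1 : R = 0 := h0.symm
    rw [h1] at hR2
    norm_num at hR2
    linarith
  set r : ℝ := R * (1 + Real.log x) ^ 5 with hrdef
  have hl1 : 1 ≤ (1 + Real.log x) ^ 5 := one_le_pow₀ (by linarith)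
  have hr0 : 0 < r := by positivity
  have hRr : R ≤ r := le_mul_of_one_le_right hR0.le hl1
  have hlr : R * Real.log x ^ 5 ≤ r := by
    rw [hrdef]
    gcongr
    linarith
  obtain ⟨hint, hle⟩ := integral_le_of_tail (P := P)
    (measurable_crossingNumber hh.measurable A S j) (m := S.length)
    (fun ω => crossingsFrom_le _ S) hr0 hC.le (fun t ht => by
      have := htail n x U A S Ω P h hadm hh j t (by linarith) (hlr.trans ht)
      rwa [Real.rpow_two] at this)
  refine ⟨hint, hle.trans ?_⟩
  have h1 : κ ≤ r ^ 2 := hR2.trans (by gcongr)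
  have h2 : 4 * C / r ≤ 4 * C / κ * r := by
    rw [div_mul_eq_mul_div, div_le_div_iff₀ hr0 hκ]
    nlinarith
  calc r + 4 * C / r ≤ r + 4 * C / κ * r := by linarith
    _ = R * ((1 + 4 * C / κ) * (1 + Real.log x) ^ 5) := by
      rw [hrdef]
      ring

end OrderedProbing

theorem mainTheorem12 :
    ∃ d : ℕ, 0 < d ∧ ∀ κ : ℝ, 0 < κ →
      (∀ c : ℝ, 0 < c → ∃ C : ℝ, 0 < C ∧
        ∀ (n : ℕ) [NeZero n] (x : ℝ) (U : Type*) [DecidableEq U] (A : List U) (S : List (Op U))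
          (Ω : Type*) [MeasurableSpace Ω] (P : Measure Ω) [IsProbabilityMeasure P]
          (h : Ω → U → Fin n),
          Admissible n x κ A S → IsUniformHash P h →
          ∀ (j : Fin n) (r : ℝ), 0 < r →
            Real.sqrt ((S.length : ℝ) / n * x ^ 2) * Real.log x ^ d ≤ r →
            P.real {ω | r ≤ (OrderedProbing.crossingNumber (h ω) A S j : ℝ)} ≤ C / r ^ c) ∧
      (∃ C : ℝ, 0 < C ∧
        ∀ (n : ℕ) [NeZero n] (x : ℝ) (U : Type*) [DecidableEq U] (A : List U) (S : List (Op U))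
          (Ω : Type*) [MeasurableSpace Ω] (P : Measure Ω) [IsProbabilityMeasure P]
          (h : Ω → U → Fin n),
          Admissible n x κ A S → IsUniformHash P h →
          ∀ j : Fin n,
            Integrable (fun ω => (OrderedProbing.crossingNumber (h ω) A S j : ℝ)) P ∧
            ∫ ω, (OrderedProbing.crossingNumber (h ω) A S j : ℝ) ∂P ≤
              Real.sqrt ((S.length : ℝ) / n * x ^ 2) * (C * (1 + Real.log x) ^ d)) :=
  ⟨5, by norm_num, fun _ hκ =>
    ⟨fun _ hc => OrderedProbing.tail_bound hκ hc, OrderedProbing.expectation_bound hκ⟩⟩
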